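/- A ringed space is a topological space with a sheaf of commutative $\mathbf{R}$-algebras. A local model is the zero set $Z=U\cap g^{-1}(0)$ of a real analytic map $g:U\to\mathbf{R}^m$, where $U\subset\mathbf{R}^n$ is open, with the sheaf of those real functions on open subsets of $Z$ that are locally restrictions of real analytic functions on open subsets of $\mathbf{R}^n$; it is smooth at $x\in Z$ if $g$ is a submersion at $x$. A real analytic space is a ringed space $X$ in which every point has an open neighborhood isomorphic to a local model. A point $x\in X$ is smooth if, for some such neighborhood of $x$, the local model is smooth at the point corresponding to $x$; otherwise it is singular. The dimension of $X$ at $x$ is the Krull dimension of the stalk $\mathcal{O}_{X,x}$. An end of a topological space $Y$ is an element of $\varprojlim_K \pi_0(Y\setminus K)$, where $K$ runs over the compact subsets of $Y$ and $\pi_0$ denotes the set of connected components. Corollary. Let $X$ be a Hausdorff real analytic space whose dimension at each point is $1$. Assume that the set of singular points of $X$ is compact. Then each connected component of $X$ has a finite, even number of ends. -/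

import Mathlib

open CategoryTheory TopologicalSpace Opposite AlgebraicGeometry

universe u

/-- A ringed space in the sense of real analytic geometry: a topological space together with a
sheaf of commutative `ℝ`-algebras. -/
abbrev RealRingedSpace : Type (u + 1) :=
  SheafedSpace.{u + 1, u, u} (CommAlgCat.{u} ℝ)

/-- The data of a local model: an open set `U ⊆ ℝⁿ` and a real analytic map `g : U → ℝᵐ`
(the values of `g` outside `U` are irrelevant). -/
structure LocalModelData where
  n : ℕ
  m : ℕ
  U : Set (EuclideanSpace ℝ (Fin n))
  isOpen_U : IsOpen U
  g : EuclideanSpace ℝ (Fin n) → EuclideanSpace ℝ (Fin m)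
  analytic_g : AnalyticOnNhd ℝ g U

namespace LocalModelData

variable (M : LocalModelData)

/-- The zero set `U ∩ g⁻¹(0)`. -/
def zeroSet : Set (EuclideanSpace ℝ (Fin M.n)) := {x | x ∈ M.U ∧ M.g x = 0}

/-- The underlying space of the local model, with the subspace topology (lifted to the universe
`u`, so that spaces living in any universe can be modelled on it). -/
abbrev space : TopCat.{u} := TopCat.of (ULift.{u} M.zeroSet)

/-- The inclusion of the local model in `ℝⁿ`. -/
def incl (x : M.space) : EuclideanSpace ℝ (Fin M.n) := x.down.1

variable {M} in
/-- A function on an open subset `W` of `U ∩ g⁻¹(0)` is a section of the structure sheaf if, near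
every point of `W`, it is the restriction of a real analytic function on an open subset
of `ℝⁿ`. -/
def IsSection {W : Opens M.space} (f : W → ℝ) : Prop :=
  ∀ x : W, ∃ (Ω : Set (EuclideanSpace ℝ (Fin M.n))) (F : EuclideanSpace ℝ (Fin M.n) → ℝ),
    IsOpen Ω ∧ M.incl x ∈ Ω ∧ AnalyticOnNhd ℝ F Ω ∧ ∀ y : W, M.incl y ∈ Ω → f y = F (M.incl y)

/-- The algebra of sections over an open subset of the local model. -/
def sections (W : Opens M.space) : Subalgebra ℝ (W → ℝ) where
  carrier := {f | IsSection f}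
  mul_mem' := by
    intro a b ha hb x
    obtain ⟨Ω, F, h1, h2, h3, h4⟩ := ha x
    obtain ⟨Ω', F', h1', h2', h3', h4'⟩ := hb x
    exact ⟨Ω ∩ Ω', F * F', h1.inter h1', ⟨h2, h2'⟩,
      fun z hz => (h3 z hz.1).mul (h3' z hz.2), fun y hy =>
        congrArg₂ (· * ·) (h4 y hy.1) (h4' y hy.2)⟩
  add_mem' := by
    intro a b ha hb x
    obtain ⟨Ω, F, h1, h2, h3, h4⟩ := ha x
    obtain ⟨Ω', F', h1', h2', h3', h4'⟩ := hb x
    exact ⟨Ω ∩ Ω', F + F', h1.inter h1', ⟨h2, h2'⟩,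
      fun z hz => (h3 z hz.1).add (h3' z hz.2), fun y hy =>
        congrArg₂ (· + ·) (h4 y hy.1) (h4' y hy.2)⟩
  algebraMap_mem' := fun r x =>
    ⟨Set.univ, fun _ => r, isOpen_univ, trivial, fun _ _ => analyticAt_const, fun _ _ => rfl⟩

variable {M} in
/-- Restriction of sections. -/
def resHom {V W : Opens M.space} (h : V ≤ W) : M.sections W →ₐ[ℝ] M.sections V where
  toFun f := ⟨fun x => f.1 ⟨x.1, h x.2⟩, by
    intro x
    obtain ⟨Ω, F, h1, h2, h3, h4⟩ := f.2 ⟨x.1, h x.2⟩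
    exact ⟨Ω, F, h1, h2, h3, fun y hy => h4 ⟨y.1, h y.2⟩ hy⟩⟩
  map_one' := rfl
  map_mul' _ _ := rfl
  map_zero' := rfl
  map_add' _ _ := rfl
  commutes' _ := rfl

/-- The structure presheaf of the local model. -/
def presheaf : TopCat.Presheaf (CommAlgCat.{u} ℝ) M.space where
  obj W := CommAlgCat.of ℝ (M.sections W.unop)
  map i := CommAlgCat.ofHom (resHom i.unop.le)
  map_id _ := rfl
  map_comp _ _ := rfl

theorem isSheaf_presheaf : M.presheaf.IsSheaf := by
  intro E W S hS fam hfam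
  have hcov : ∀ x : W, ∃ (V : Opens M.space) (i : V ⟶ W), S.arrows i ∧ x.1 ∈ V :=
    fun x => hS x.1 x.2
  choose V i hi hx using hcov
  -- two members of the family agree at every common point
  have key : ∀ (e : E) (A B : Opens M.space) (a : A ⟶ W) (b : B ⟶ W) (ha : S.arrows a)
      (hb : S.arrows b) (y : M.space) (hyA : y ∈ A) (hyB : y ∈ B),
      ((fam a ha).hom e).1 ⟨y, hyA⟩ = ((fam b hb).hom e).1 ⟨y, hyB⟩ := by
    intro e A B a b ha hb y hyA hyB
    have h := hfam (Opens.infLELeft A B) (Opens.infLERight A B) ha hb (by subsingleton)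
    have h' := congrArg (fun φ : E ⟶ CommAlgCat.of ℝ (M.sections (A ⊓ B)) =>
      (φ.hom e).1 ⟨y, hyA, hyB⟩) h
    exact h'
  let glue : E →ₐ[ℝ] M.sections W :=
    { toFun := fun e => ⟨fun x => ((fam (i x) (hi x)).hom e).1 ⟨x.1, hx x⟩, by
        intro x
        obtain ⟨Ω, F, h1, h2, h3, h4⟩ := ((fam (i x) (hi x)).hom e).2 ⟨x.1, hx x⟩
        obtain ⟨Ω', h1', h2'⟩ : ∃ Ω' : Set (EuclideanSpace ℝ (Fin M.n)), IsOpen Ω' ∧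
            M.incl ⁻¹' Ω' = (V x : Set M.space) := by
          obtain ⟨T, hT, hT'⟩ := (Homeomorph.ulift.isInducing.isOpen_iff).1 (V x).isOpen
          obtain ⟨T', hT1, hT2⟩ := isOpen_induced_iff.1 hT
          refine ⟨T', hT1, ?_⟩
          rw [← hT', ← hT2]
          rfl
        have hmem : ∀ y : M.space, M.incl y ∈ Ω' → y ∈ V x := by
          intro y hy
          have : y ∈ M.incl ⁻¹' Ω' := hy
          rw [h2'] at this
          exact this
        refine ⟨Ω ∩ Ω', F, h1.inter h1', ⟨h2, ?_⟩, fun z hz => h3 z hz.1, fun y hy => ?_⟩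
        · have : x.1 ∈ M.incl ⁻¹' Ω' := by rw [h2']; exact hx x
          exact this
        · exact (key e _ _ _ _ (hi y) (hi x) y.1 (hx y) (hmem _ hy.2)).trans
            (h4 ⟨y.1, hmem _ hy.2⟩ hy.1)⟩
      map_one' := Subtype.ext (funext fun x =>
        congrFun (congrArg Subtype.val (map_one (fam (i x) (hi x)).hom)) ⟨x.1, hx x⟩)
      map_mul' := fun a b => Subtype.ext (funext fun x =>
        congrFun (congrArg Subtype.val (map_mul (fam (i x) (hi x)).hom a b)) ⟨x.1, hx x⟩)
      map_zero' := Subtype.ext (funext fun x =>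
        congrFun (congrArg Subtype.val (map_zero (fam (i x) (hi x)).hom)) ⟨x.1, hx x⟩)
      map_add' := fun a b => Subtype.ext (funext fun x =>
        congrFun (congrArg Subtype.val (map_add (fam (i x) (hi x)).hom a b)) ⟨x.1, hx x⟩)
      commutes' := fun r => Subtype.ext (funext fun x =>
        congrFun (congrArg Subtype.val ((fam (i x) (hi x)).hom.commutes r)) ⟨x.1, hx x⟩) }
  refine ⟨CommAlgCat.ofHom glue, ?_, ?_⟩
  · intro B b hb
    refine CommAlgCat.hom_ext (AlgHom.ext fun e => Subtype.ext (funext fun y => ?_))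
    exact key e _ _ _ _ _ hb y.1 _ y.2
  · intro t ht
    refine CommAlgCat.hom_ext (AlgHom.ext fun e => Subtype.ext (funext fun x => ?_))
    have h := ht (i x) (hi x)
    have h' := congrArg (fun φ : E ⟶ CommAlgCat.of ℝ (M.sections (V x)) =>
      (φ.hom e).1 ⟨x.1, hx x⟩) h
    exact h'

/-- The local model as a ringed space: `U ∩ g⁻¹(0)` with the sheaf of restrictions of real analytic
functions on open subsets of `ℝⁿ`. -/
def toRingedSpace : RealRingedSpace.{u} where
  carrier := M.space
  presheaf := M.presheaf
  IsSheaf := M.isSheaf_presheaf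

/-- The local model is smooth at `x` if `g` is a submersion at `x`. -/
def SmoothAt (x : M.toRingedSpace) : Prop :=
  Function.Surjective (fderiv ℝ M.g (M.incl x))

end LocalModelData

namespace RealRingedSpace

/-- A chart of `X` at `x`: an open neighborhood `V` of `x` and an isomorphism of ringed spaces from
`V` onto a local model. -/
structure ChartAt (X : RealRingedSpace.{u}) (x : X) where
  V : Opens X
  mem : x ∈ V
  model : LocalModelData
  iso : X.restrict V.isOpenEmbedding ≅ model.toRingedSpace

/-- A real analytic space is a ringed space in which every point has a neighborhood isomorphic to
some local model. -/
def IsRealAnalyticSpace (X : RealRingedSpace.{u}) : Prop :=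
  ∀ x : X, Nonempty (ChartAt X x)

/-- `x` is a smooth point if some local model of `X` around `x` is smooth at the point
corresponding to `x`. -/
def IsSmoothPoint (X : RealRingedSpace.{u}) (x : X) : Prop :=
  ∃ c : ChartAt X x, c.model.SmoothAt (c.iso.hom.hom.base ⟨x, c.mem⟩)

/-- The singular set: the set of points that are not smooth. -/
def singularSet (X : RealRingedSpace.{u}) : Set X := {x | ¬ IsSmoothPoint X x}

/-- The stalk of the structure sheaf at `x`, as a commutative ring. -/
noncomputable def stalk (X : RealRingedSpace.{u}) (x : X) : CommRingCat.{u} :=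
  TopCat.Presheaf.stalk (C := CommRingCat.{u}) (X := X.carrier)
    (X.presheaf ⋙ forget₂ (CommAlgCat.{u} ℝ) CommRingCat.{u}) x

/-- The dimension of `X` at `x`: the Krull dimension of the stalk of the structure sheaf. -/
noncomputable def dimAt (X : RealRingedSpace.{u}) (x : X) : WithBot ℕ∞ :=
  ringKrullDim (stalk X x)

end RealRingedSpace

/-- An end of a topological space `Y`: a choice, for every compact `K ⊆ Y`, of a connected component
of `Y \ K`, compatible with inclusions. In other words, an element of the inverse limit of the sets
of connected components of the complements of the compact subsets. -/
@[ext]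
structure SpaceEnd (Y : Type u) [TopologicalSpace Y] where
  comp : Compacts Y → Set Y
  isComponent : ∀ K : Compacts Y, ∃ y ∈ (K : Set Y)ᶜ, comp K = connectedComponentIn (K : Set Y)ᶜ y
  compatible : ∀ K L : Compacts Y, K ≤ L → comp L ⊆ comp K

open Set Filter Topology

/-! ### One-dimensional topology -/

/-! ### Ends read off from nested families of tails -/

section Ends

variable {Y : Type u} [TopologicalSpace Y] {ι : Type*}

/-! Near each of its points, `X` is a cone over a finite set with an even number of points: a star
with evenly many arms. Granting this, ends are counted as follows. The points of a component that
are not line points form a finite set: they are discrete, because all points of a star except its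
center are line points, and they lie in the compact singular set, because a smooth star point is a
line point or isolated, and an isolated point is a whole component. Let `B` be this finite set with
one more point, and choose disjoint arms at the points of `B`, an even number in total. Each
component of the complement of `B` contains one or two of these arms. With two, it is a segment
between points of `B`, hence relatively compact; with one, it is a half line and carries exactly one
end. Thus ends correspond to the arms that are alone in their component, and the other arms cancel
in pairs (`finite_even_ends_of_connected`, `even_card_of_classes`).

The local statement is `isEvenStarPoint_of_ringKrullDim_le_one`. Germs at `z` of analytic functions
restricted to the zero set `Z` form a quotient of the stalk, so their ring has dimension at most
one. Weierstrass preparation, repeated as long as more than one variable is left, makes this ring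
integral over the germs in one linear coordinate `t` (`exists_integral_coordHom`). All coordinates
are then roots of one Weierstrass polynomial in `t`, which may be taken separable for `t ≠ 0`
(`exists_separable_weierstrass`), so on each side of `t = 0` the set `Z` consists of finitely many
continuous sheets (`exists_sheets`).

Parity comes from complex roots. `Z` is the zero set of a single function, a sum of squares. Its
values at the tuples of complex roots are the eigenvalues of a matrix analytic in `t`
(`exists_normMatrix`), so for small `t ≠ 0` of either sign the number of tuples where it vanishes is
the same integer `e`. Complex conjugation permutes these tuples and fixes the real ones, so the
numbers of sheets on both sides are congruent to `e` modulo 2 (`exists_ncard_solutionSet_modEq`),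
and their sum is even. -/

theorem connectedComponentIn_iUnion_eq {τ : ι → Set Y} (ho : ∀ i, IsOpen (τ i))
    (hc : ∀ i, IsPreconnected (τ i)) (hd : ∀ i j, i ≠ j → Disjoint (τ i) (τ j)) {i : ι} {y : Y}
    (hy : y ∈ τ i) : connectedComponentIn (⋃ j, τ j) y = τ i := by
  refine Subset.antisymm ?_ ((hc i).subset_connectedComponentIn hy (subset_iUnion τ i))
  have hsub : connectedComponentIn (⋃ j, τ j) y ⊆ τ i ∪ ⋃ j ∈ {j | j ≠ i}, τ j := by
    intro z hz
    obtain ⟨j, hj⟩ := mem_iUnion.1 (connectedComponentIn_subset _ _ hz)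
    by_cases h : j = i
    · exact Or.inl (h ▸ hj)
    · exact Or.inr (mem_biUnion h hj)
  refine isPreconnected_connectedComponentIn.subset_left_of_subset_union (ho i)
    (isOpen_biUnion fun j _ => ho j) ?_ hsub ⟨y, mem_connectedComponentIn (mem_iUnion.2 ⟨i, hy⟩), hy⟩
  exact disjoint_iUnion₂_right.2 fun j hj => hd i j (Ne.symm hj)

/-- If the complements of compact sets are described by finitely many nested families of connected
open sets, then the ends correspond to these families. -/
theorem SpaceEnd.nonempty_equiv_of_tails (𝒯 : ι → Set (Set Y))
    (hne : ∀ i, (𝒯 i).Nonempty) (hopen : ∀ i, ∀ T ∈ 𝒯 i, IsOpen T)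
    (hconn : ∀ i, ∀ T ∈ 𝒯 i, IsConnected T)
    (hchain : ∀ i, ∀ T ∈ 𝒯 i, ∀ T' ∈ 𝒯 i, T ⊆ T' ∨ T' ⊆ T)
    (hdisj : ∀ i j, i ≠ j → ∀ T ∈ 𝒯 i, ∀ T' ∈ 𝒯 j, Disjoint T T')
    (hcomp : ∀ τ : ι → Set Y, (∀ i, τ i ∈ 𝒯 i) → IsCompact (⋃ i, τ i)ᶜ)
    (havoid : ∀ K : Set Y, IsCompact K → ∀ i, ∃ T ∈ 𝒯 i, Disjoint T K) :
    Nonempty (SpaceEnd Y ≃ ι) := by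
  classical
  let L : (τ : ι → Set Y) → (∀ i, τ i ∈ 𝒯 i) → Compacts Y := fun τ h => ⟨(⋃ i, τ i)ᶜ, hcomp τ h⟩
  have hLc : ∀ τ h, ((L τ h : Compacts Y) : Set Y)ᶜ = ⋃ i, τ i := fun τ h => compl_compl _
  have hcc : ∀ (τ : ι → Set Y) (h : ∀ i, τ i ∈ 𝒯 i) (i : ι) (y : Y), y ∈ τ i →
      connectedComponentIn ((L τ h : Compacts Y) : Set Y)ᶜ y = τ i := by
    intro τ h i y hy
    rw [hLc τ h]
    exact connectedComponentIn_iUnion_eq (fun j => hopen j _ (h j))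
      (fun j => (hconn j _ (h j)).isPreconnected)
      (fun a b hab => hdisj a b hab _ (h a) _ (h b)) hy
  have hex : ∀ (e : SpaceEnd Y) (τ : ι → Set Y) (h : ∀ i, τ i ∈ 𝒯 i), ∃ i, e.comp (L τ h) = τ i := by
    intro e τ h
    obtain ⟨y, hy, hey⟩ := e.isComponent (L τ h)
    rw [hLc τ h] at hy
    obtain ⟨i, hi⟩ := mem_iUnion.1 hy
    exact ⟨i, hey.trans (hcc τ h i y hi)⟩
  have hle : ∀ (τ τ' : ι → Set Y) (h h'), (∀ i, τ' i ⊆ τ i) → L τ h ≤ L τ' h' := by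
    intro τ τ' h h' hsub
    exact compl_subset_compl.2 (iUnion_mono hsub)
  have hsame : ∀ {i j : ι} {T T' : Set Y}, T ∈ 𝒯 i → T' ∈ 𝒯 j → T ⊆ T' → i = j := by
    intro i j T T' hT hT' hsub
    by_contra hij
    obtain ⟨z, hz⟩ := (hconn i T hT).nonempty
    exact (Set.disjoint_left.1 (hdisj i j hij T hT T' hT')) hz (hsub hz)
  have hmin : ∀ i, ∀ T ∈ 𝒯 i, ∀ T' ∈ 𝒯 i, T ∩ T' ∈ 𝒯 i := by
    intro i T hT T' hT'
    rcases hchain i T hT T' hT' with h | h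
    · rwa [inter_eq_left.2 h]
    · rwa [inter_eq_right.2 h]
  choose τ₀ hτ₀ using hne
  choose idx hidx using fun e => hex e τ₀ hτ₀
  have hidx' : ∀ (e : SpaceEnd Y) (τ : ι → Set Y) (h : ∀ i, τ i ∈ 𝒯 i),
      e.comp (L τ h) = τ (idx e) := by
    intro e τ h
    -- Two choices of tails are compared through their intersection, again a choice because each
    -- family is a chain. The tail selected there lies in the tails selected by both, so the index
    -- does not depend on the choice.
    have h'' : ∀ i, τ i ∩ τ₀ i ∈ 𝒯 i := fun i => hmin i _ (h i) _ (hτ₀ i)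
    obtain ⟨k, hk⟩ := hex e (fun i => τ i ∩ τ₀ i) h''
    obtain ⟨k', hk'⟩ := hex e τ h
    have h1 := e.compatible _ _ (hle τ₀ _ hτ₀ h'' fun i => inter_subset_right)
    have h2 := e.compatible _ _ (hle τ _ h h'' fun i => inter_subset_left)
    rw [hk, hidx] at h1
    rw [hk, hk'] at h2
    rw [hk', ← hsame (h'' k) (hτ₀ _) h1, hsame (h'' k) (h _) h2]
  have hfull : ∀ K : Compacts Y, ∃ (τ : ι → Set Y) (h : ∀ i, τ i ∈ 𝒯 i), K ≤ L τ h := by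
    intro K
    choose τ hτ hτK using fun i => havoid K K.isCompact i
    refine ⟨τ, hτ, fun x hx => ?_⟩
    intro hcon
    obtain ⟨i, hi⟩ := mem_iUnion.1 hcon
    exact Set.disjoint_left.1 (hτK i) hi hx
  refine ⟨Equiv.ofBijective idx ⟨fun e e' hee => ?_, fun i => ?_⟩⟩
  · refine SpaceEnd.ext (funext fun K => ?_)
    obtain ⟨τ, hτ, hK⟩ := hfull K
    obtain ⟨z, hz⟩ := (hconn _ _ (hτ (idx e))).nonempty
    have h1 := e.compatible _ _ hK
    have h2 := e'.compatible _ _ hK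
    rw [hidx' e τ hτ] at h1
    rw [hidx' e' τ hτ, ← hee] at h2
    obtain ⟨y, -, hey⟩ := e.isComponent K
    obtain ⟨y', -, hey'⟩ := e'.isComponent K
    have a1 := h1 hz
    have a2 := h2 hz
    rw [hey] at a1 ⊢
    rw [hey'] at a2 ⊢
    exact (connectedComponentIn_eq a1).trans (connectedComponentIn_eq a2).symm
  -- The end attached to `i` selects the component of the complement of `K` containing some tail of
  -- `𝒯 i` that misses `K`. Compatibility holds because any two tails of `𝒯 i` meet.
  · have hKT : ∀ K : Compacts Y, ∃ C : Set Y, (∃ y ∈ (K : Set Y)ᶜ, C = connectedComponentIn (K : Set Y)ᶜ y) ∧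
        ∃ T ∈ 𝒯 i, Disjoint T K ∧ T ⊆ C := by
      intro K
      obtain ⟨T, hT, hd⟩ := havoid K K.isCompact i
      obtain ⟨z, hz⟩ := (hconn i T hT).nonempty
      exact ⟨_, ⟨z, Set.disjoint_left.1 hd hz, rfl⟩, T, hT, hd,
        (hconn i T hT).isPreconnected.subset_connectedComponentIn hz
          (disjoint_left.1 hd)⟩
    choose C hC T hT hTK hTC using hKT
    have hcompat : ∀ K K' : Compacts Y, K ≤ K' → C K' ⊆ C K := by
      intro K K' hKK
      obtain ⟨z, hz⟩ := (hconn i _ (hmin i _ (hT K) _ (hT K'))).nonempty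
      obtain ⟨y, -, hy⟩ := hC K
      obtain ⟨y', -, hy'⟩ := hC K'
      have a1 := hTC K hz.1
      have a2 := hTC K' hz.2
      rw [hy] at a1 ⊢
      rw [hy'] at a2 ⊢
      rw [connectedComponentIn_eq a1, connectedComponentIn_eq a2]
      exact connectedComponentIn_mono _ (compl_subset_compl.2 hKK)
    let e : SpaceEnd Y := ⟨C, hC, hcompat⟩
    refine ⟨e, ?_⟩
    have h1 : C (L τ₀ hτ₀) = τ₀ (idx e) := hidx' e τ₀ hτ₀
    have h2 := hTC (L τ₀ hτ₀)
    rw [h1] at h2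
    exact (hsame (hT _) (hτ₀ _) h2).symm

end Ends

/-- Follow `ρ` up to parameter `r₀`, then `φ` from parameter `s₀` on. -/
noncomputable def glueLines {Y : Type*} (ρ φ : ℝ → Y) (r₀ s₀ : ℝ) : ℝ → Y :=
  fun u => if u ≤ r₀ then ρ u else φ (s₀ + (u - r₀))

theorem glueLines_of_ge {Y : Type*} {ρ φ : ℝ → Y} {r₀ s₀ : ℝ} (h0 : φ s₀ = ρ r₀) {u : ℝ} (hu : r₀ ≤ u) :
    glueLines ρ φ r₀ s₀ u = φ (s₀ + (u - r₀)) := by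
  unfold glueLines
  split_ifs with h
  · obtain rfl := le_antisymm h hu
    simp [h0]
  · rfl

theorem glueLines_of_le {Y : Type*} {ρ φ : ℝ → Y} {r₀ s₀ : ℝ} {u : ℝ} (hu : u ≤ r₀) :
    glueLines ρ φ r₀ s₀ u = ρ u := if_pos hu

/-! ### Lines and half lines in a Hausdorff space -/

section Lines

variable {Y : Type*} [TopologicalSpace Y]

/-- A point with a neighborhood homeomorphic to the real line. -/
def IsLinePoint (y : Y) : Prop := ∃ φ : ℝ → Y, IsOpenEmbedding φ ∧ y ∈ range φ

theorem Topology.IsOpenEmbedding.isLinePoint {φ : ℝ → Y} (h : IsOpenEmbedding φ) (s : ℝ) :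
    IsLinePoint (φ s) := ⟨φ, h, mem_range_self s⟩

/-- An injective path in a space all of whose points are line points is an open embedding. -/
theorem isOpenEmbedding_of_isLinePoint {f : ℝ → Y} (hc : Continuous f)
    (hi : Function.Injective f) (hl : ∀ s, IsLinePoint (f s)) : IsOpenEmbedding f := by
  refine IsOpenEmbedding.of_continuous_injective_isOpenMap hc hi
    (isOpenMap_iff_nhds_le.2 fun s U hU => ?_)
  obtain ⟨φ, hφ, hs⟩ := hl s
  have hD : f ⁻¹' range φ ∈ 𝓝 s := hc.continuousAt (hφ.isOpen_range.mem_nhds hs)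
  obtain ⟨ε, hε, hεU⟩ := Metric.nhds_basis_closedBall.mem_iff.1 (inter_mem hD hU)
  rw [Real.closedBall_eq_Icc] at hεU
  -- Invariance of domain in dimension one: read in the chart `φ`, the path is an injective
  -- continuous real function, hence strictly monotone on a closed interval, and the intermediate
  -- value theorem makes its image a neighborhood.
  let g : ℝ → ℝ := fun t => Function.invFun φ (f t)
  have hg : ∀ t ∈ Icc (s - ε) (s + ε), φ (g t) = f t := fun t ht =>
    Function.invFun_eq (hεU ht).1
  have hgc : ContinuousOn g (Icc (s - ε) (s + ε)) := by
    rw [hφ.isInducing.continuousOn_iff]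
    exact hc.continuousOn.congr fun t ht => hg t ht
  have hgi : InjOn g (Icc (s - ε) (s + ε)) := fun a ha b hb hab =>
    hi (by rw [← hg a ha, ← hg b hb, hab])
  have hle : s - ε ≤ s + ε := by linarith
  have hss : s ∈ Icc (s - ε) (s + ε) := ⟨by linarith, by linarith⟩
  have key : ∃ W ∈ 𝓝 (g s), W ⊆ g '' Icc (s - ε) (s + ε) := by
    have hl : s - ε ∈ Icc (s - ε) (s + ε) := left_mem_Icc.2 hle
    have hr : s + ε ∈ Icc (s - ε) (s + ε) := right_mem_Icc.2 hle
    rcases le_total (g (s - ε)) (g (s + ε)) with h | h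
    · have hm := hgc.strictMonoOn_of_injOn_Icc hle h hgi
      exact ⟨Icc (g (s - ε)) (g (s + ε)), Icc_mem_nhds (hm hl hss (by linarith))
        (hm hss hr (by linarith)), intermediate_value_Icc hle hgc⟩
    · have hm := hgc.strictAntiOn_of_injOn_Icc hle h hgi
      exact ⟨Icc (g (s + ε)) (g (s - ε)), Icc_mem_nhds (hm hss hr (by linarith))
        (hm hl hss (by linarith)), intermediate_value_Icc' hle hgc⟩
  obtain ⟨W, hW, hWs⟩ := key
  have h1 : φ '' W ∈ 𝓝 (f s) := by
    rw [← hg s hss]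
    exact hφ.isOpenMap.image_mem_nhds hW
  refine mem_of_superset h1 ?_
  rintro _ ⟨w, hw, rfl⟩
  obtain ⟨t, ht, rfl⟩ := hWs hw
  rw [hg t ht]
  exact (hεU ht).2


theorem isOpenEmbedding_neg {φ : ℝ → Y} (h : IsOpenEmbedding φ) :
    IsOpenEmbedding (fun s => φ (-s)) :=
  h.comp (Homeomorph.neg ℝ).isOpenEmbedding

/-- The real line is homeomorphic to every bounded open interval around `0`. -/
theorem exists_isOpenEmbedding_range_eq_Ioo {ε : ℝ} (hε : 0 < ε) :
    ∃ f : ℝ → ℝ, IsOpenEmbedding f ∧ f 0 = 0 ∧ range f = Ioo (-ε) ε := by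
  let e := (Homeomorph.unitBall : ℝ ≃ₜ Metric.ball (0 : ℝ) 1)
  have he : IsOpenEmbedding (fun t : ℝ => ε * (e t : ℝ)) :=
    ((Homeomorph.mulLeft₀ ε hε.ne').isOpenEmbedding.comp
      (Metric.isOpen_ball.isOpenEmbedding_subtypeVal)).comp e.isOpenEmbedding
  refine ⟨_, he, ?_, ?_⟩
  · have : (e 0 : ℝ) = 0 := by simp [e]
    simp [this]
  · ext t
    constructor
    · rintro ⟨s, rfl⟩
      have := (e s).2
      rw [mem_ball_zero_iff, Real.norm_eq_abs, abs_lt] at this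
      exact ⟨by nlinarith, by nlinarith⟩
    · rintro ⟨h1, h2⟩
      have hm : t / ε ∈ Metric.ball (0 : ℝ) 1 := by
        rw [mem_ball_zero_iff, Real.norm_eq_abs, abs_lt]
        exact ⟨by rw [lt_div_iff₀ hε]; linarith, by rw [div_lt_iff₀ hε]; linarith⟩
      exact ⟨e.symm ⟨t / ε, hm⟩, by simp [mul_div_cancel₀ _ hε.ne']⟩

theorem IsLinePoint.exists_subset {y : Y} (h : IsLinePoint y) {U : Set Y} (hU : U ∈ 𝓝 y) :
    ∃ φ : ℝ → Y, IsOpenEmbedding φ ∧ φ 0 = y ∧ range φ ⊆ U := by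
  obtain ⟨φ, hφ, s, rfl⟩ := h
  obtain ⟨ε, hε, hs⟩ := Metric.nhds_basis_ball.mem_iff.1 (hφ.continuous.continuousAt hU)
  obtain ⟨f, hf, hf0, hfr⟩ := exists_isOpenEmbedding_range_eq_Ioo hε
  refine ⟨fun t => φ (s + f t), hφ.comp ((Homeomorph.addLeft s).isOpenEmbedding.comp hf),
    by simp [hf0], ?_⟩
  rintro _ ⟨t, rfl⟩
  refine hs ?_
  have : f t ∈ Ioo (-ε) ε := hfr ▸ mem_range_self t
  rw [Real.ball_eq_Ioo]
  exact ⟨by linarith [this.1], by linarith [this.2]⟩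

/-- The map `u ↦ ρ (s - |u|)` covers the segment and tends to `b` at infinity in both directions, so
its range becomes compact once `b` is added. -/
theorem isCompact_insert_image_Iic {ρ : ℝ → Y} {b : Y} (hc : Continuous ρ)
    (hb : Tendsto ρ atBot (𝓝 b)) (s : ℝ) : IsCompact (insert b (ρ '' Iic s)) := by
  have h : Tendsto (fun u : ℝ => ρ (s - |u|)) (cocompact ℝ) (𝓝 b) := by
    refine hb.comp ?_
    have : Tendsto (fun u : ℝ => |u|) (cocompact ℝ) atTop := tendsto_norm_cocompact_atTop
    exact tendsto_atBot_add_const_left _ s (tendsto_neg_atTop_atBot.comp this)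
  have := h.isCompact_insert_range_of_cocompact (by fun_prop)
  convert! this using 2
  ext y
  constructor
  · rintro ⟨u, hu, rfl⟩
    refine ⟨s - u, ?_⟩
    have hu' : 0 ≤ s - u := sub_nonneg.2 hu
    simp [abs_of_nonneg hu']
  · rintro ⟨u, rfl⟩
    exact ⟨_, by simp, rfl⟩

/-- An open embedding of the line whose lower end converges to `b`. -/
structure IsHalfLine (b : Y) (ρ : ℝ → Y) : Prop where
  emb : IsOpenEmbedding ρ
  tendsto : Tendsto ρ atBot (𝓝 b)

variable [T2Space Y] {b : Y}

theorem IsHalfLine.isClosed_preimage {ρ φ : ℝ → Y} (h : IsHalfLine b ρ) (hφ : Continuous φ)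
    (hb : ∀ s, φ s ≠ b) (s : ℝ) : IsClosed (φ ⁻¹' (ρ '' Iic s)) := by
  have := (isCompact_insert_image_Iic h.emb.continuous h.tendsto s).isClosed.preimage hφ
  convert! this using 1
  ext t
  simp [hb t]

/-- The segment `ρ '' Iic s` is closed once `b` is added, and open once `ρ s` is removed. A path
avoiding both points can therefore neither enter nor leave it. -/
theorem IsHalfLine.subset_or_disjoint {ρ φ : ℝ → Y} (h : IsHalfLine b ρ) (hφ : Continuous φ)
    (hb : ∀ s, φ s ≠ b) {s : ℝ} {I : Set ℝ} (hI : _root_.IsPreconnected I) (hs : ∀ u ∈ I, φ u ≠ ρ s) :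
    I ⊆ φ ⁻¹' (ρ '' Iic s) ∨ Disjoint I (φ ⁻¹' (ρ '' Iic s)) := by
  have h1 : IsOpen (φ ⁻¹' (ρ '' Iio s)) := (h.emb.isOpenMap _ isOpen_Iio).preimage hφ
  have h2 := (h.isClosed_preimage hφ hb s).isOpen_compl
  have h3 : φ ⁻¹' (ρ '' Iio s) ⊆ φ ⁻¹' (ρ '' Iic s) :=
    preimage_mono (image_mono Iio_subset_Iic_self)
  have hcov : I ⊆ φ ⁻¹' (ρ '' Iio s) ∪ (φ ⁻¹' (ρ '' Iic s))ᶜ := by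
    intro u hu
    by_cases hm : u ∈ φ ⁻¹' (ρ '' Iic s)
    · obtain ⟨v, hv, hv'⟩ := hm
      rcases (mem_Iic.1 hv).lt_or_eq with h' | h'
      · exact Or.inl ⟨v, h', hv'⟩
      · exact absurd hv'.symm (h' ▸ hs u hu)
    · exact Or.inr hm
  by_cases hne : (I ∩ φ ⁻¹' (ρ '' Iic s)).Nonempty
  · left
    obtain ⟨u, hu, hu'⟩ := hne
    have hu'' : u ∈ φ ⁻¹' (ρ '' Iio s) := (hcov hu).resolve_right (not_not_intro hu')
    exact (hI.subset_left_of_subset_union h1 h2 (disjoint_compl_right_iff_subset.2 h3) hcov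
      ⟨u, hu, hu''⟩).trans h3
  · exact Or.inr (disjoint_iff_inter_eq_empty.2 (not_nonempty_iff_eq_empty.1 hne))

/-- Two half lines that agree near their lower end have comparable initial segments. -/
theorem IsHalfLine.initial_total {ρ ρ' : ℝ → Y} (h : IsHalfLine b ρ) (h' : IsHalfLine b ρ')
    (hb : ∀ s, ρ s ≠ b) (hb' : ∀ s, ρ' s ≠ b) (hg : ρ =ᶠ[atBot] ρ') (s s' : ℝ) :
    ρ '' Iic s ⊆ ρ' '' Iic s' ∨ ρ' '' Iic s' ⊆ ρ '' Iic s := by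
  have key : ∀ {ρ ρ' : ℝ → Y} (_ : IsHalfLine b ρ) (_ : IsHalfLine b ρ') (_ : ∀ s, ρ s ≠ b)
      (_ : ρ =ᶠ[atBot] ρ') (t t' : ℝ), (∀ u ∈ Iio t, ρ u ≠ ρ' t') →
      Iio t ⊆ ρ ⁻¹' (ρ' '' Iic t') := by
    intro ρ ρ' h h' hb hg t t' hne
    refine (h'.subset_or_disjoint h.emb.continuous hb (isPreconnected_Iio (a := t)) hne).resolve_right ?_
    intro hd
    obtain ⟨u, hu, hut, hut'⟩ := (hg.and ((eventually_lt_atBot t).and (eventually_le_atBot t'))).exists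
    exact disjoint_left.1 hd hut ⟨u, hut', hu.symm⟩
  have fin : ∀ {ρ ρ' : ℝ → Y} (_ : IsHalfLine b ρ) (_ : IsHalfLine b ρ') (_ : ∀ s, ρ s ≠ b)
      (_ : ρ =ᶠ[atBot] ρ') (t t' : ℝ), (∀ u ∈ Iic t, ρ u ≠ ρ' t') → ρ '' Iic t ⊆ ρ' '' Iic t' := by
    intro ρ ρ' h h' hb hg t t' hne
    have h1 := key h h' hb hg t t' fun u hu => hne u (mem_Iio.1 hu).le
    have h2 := (h'.isClosed_preimage h.emb.continuous hb t').closure_subset_iff.2 h1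
    rw [closure_Iio] at h2
    exact image_subset_iff.2 h2
  by_cases h1 : ∀ u ∈ Iic s, ρ u ≠ ρ' s'
  · exact Or.inl (fin h h' hb hg s s' h1)
  by_cases h2 : ∀ u ∈ Iic s', ρ' u ≠ ρ s
  · exact Or.inr (fin h' h hb' hg.symm s' s h2)
  -- Remaining case: each segment contains the endpoint of the other. If `ρ u = ρ' s'`, then `ρ`
  -- stays in the segment of `ρ'` below `u` by the common germ, and above `u` because it passes
  -- through `ρ s = ρ' v`.
  push Not at h1 h2
  obtain ⟨u, hu, hus⟩ := h1
  obtain ⟨v, hv, hvs⟩ := h2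
  left
  have hinj : ∀ w, ρ w = ρ' s' → w = u := fun w hw => h.emb.injective (hw.trans hus.symm)
  have a1 := key h h' hb hg u s' fun w hw hw' => (mem_Iio.1 hw).ne (hinj w hw')
  rintro _ ⟨w, hw, rfl⟩
  rcases lt_trichotomy w u with hwu | rfl | hwu
  · exact a1 hwu
  · exact ⟨s', self_mem_Iic, hus.symm⟩
  · have a2 := (h'.subset_or_disjoint h.emb.continuous hb (isPreconnected_Ioi (a := u)) (s := s')
      fun w hw hw' => (mem_Ioi.1 hw).ne' (hinj w hw')).resolve_right fun hd =>
        disjoint_left.1 hd (mem_Ioi.2 (hwu.trans_le hw)) ⟨v, hv, hvs⟩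
    exact a2 hwu

/-- After leaving `ρ r₀`, the line `φ` cannot return to that point, so it stays on one side of the
segment `ρ '' Iic r₀`. The point `φ s₁` shows that this is the outside. Hence the concatenation is
injective, and open by invariance of domain. -/
theorem IsHalfLine.glue {ρ φ : ℝ → Y} (h : IsHalfLine b ρ) (hφ : IsOpenEmbedding φ)
    (hb : ∀ s, φ s ≠ b) {r₀ s₀ s₁ : ℝ} (h0 : φ s₀ = ρ r₀) (h01 : s₀ < s₁)
    (h1 : φ s₁ ∉ range ρ) : IsHalfLine b (glueLines ρ φ r₀ s₀) := by
  have hd : Disjoint (Ioi s₀) (φ ⁻¹' (ρ '' Iic r₀)) :=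
    (h.subset_or_disjoint hφ.continuous hb (isPreconnected_Ioi (a := s₀)) fun u hu hu' =>
      (mem_Ioi.1 hu).ne' (hφ.injective (hu'.trans h0.symm))).resolve_left fun hsub =>
        h1 (image_subset_range _ _ (hsub h01))
  have hne : ∀ u v, u ≤ r₀ → r₀ < v → glueLines ρ φ r₀ s₀ u ≠ glueLines ρ φ r₀ s₀ v := by
    intro u v hu hv heq
    rw [glueLines_of_le hu, glueLines_of_ge h0 hv.le] at heq
    exact disjoint_left.1 hd (show s₀ + (v - r₀) ∈ Ioi s₀ by simp [hv]) ⟨u, hu, heq⟩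
  refine ⟨isOpenEmbedding_of_isLinePoint ?_ ?_ ?_, h.tendsto.congr' ?_⟩
  · refine Continuous.if_le h.emb.continuous (hφ.continuous.comp (by fun_prop)) continuous_id
      continuous_const ?_
    rintro u rfl
    simp [h0]
  · intro u v huv
    rcases le_or_gt u r₀ with hu | hu <;> rcases le_or_gt v r₀ with hv | hv
    · rw [glueLines_of_le hu, glueLines_of_le hv] at huv
      exact h.emb.injective huv
    · exact absurd huv (hne u v hu hv)
    · exact absurd huv.symm (hne v u hv hu)
    · rw [glueLines_of_ge h0 hu.le, glueLines_of_ge h0 hv.le] at huv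
      linarith [hφ.injective huv]
  · intro u
    unfold glueLines
    split_ifs
    · exact h.emb.isLinePoint _
    · exact hφ.isLinePoint _
  · filter_upwards [eventually_le_atBot r₀] with u hu
    rw [glueLines_of_le hu]

end Lines

/-! ### Arms and the components of the complement of `B` -/

section Arms

variable {Y : Type*} [TopologicalSpace Y] {B : Set Y}

/-- A half line emanating from a point of `B` and avoiding `B`. -/
structure IsArm (B : Set Y) (b : Y) (α : ℝ → Y) : Prop extends IsHalfLine b α where
  mem : b ∈ B
  avoid : ∀ s, α s ∉ B

/-- The component of the complement of `B` containing an arm. -/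
def armComponent (B : Set Y) (α : ℝ → Y) : Set Y := connectedComponentIn Bᶜ (α 0)

variable {b b' : Y} {α α' ρ : ℝ → Y}

theorem IsArm.ne (h : IsArm B b α) (s : ℝ) : α s ≠ b := fun hs => h.avoid s (hs ▸ h.mem)

theorem IsArm.mem_armComponent (h : IsArm B b α) (s : ℝ) : α s ∈ armComponent B α :=
  (isPreconnected_range h.emb.continuous).subset_connectedComponentIn (mem_range_self 0)
    (by rintro _ ⟨t, rfl⟩; exact h.avoid t) (mem_range_self s)

theorem armComponent_subset : armComponent B α ⊆ Bᶜ := connectedComponentIn_subset _ _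

theorem IsArm.armComponent_eq (h : IsArm B b α) (h' : IsArm B b' α') {s s' : ℝ}
    (hs : α s = α' s') : armComponent B α = armComponent B α' :=
  (connectedComponentIn_eq (h.mem_armComponent s)).trans
    (by rw [hs]; exact (connectedComponentIn_eq (h'.mem_armComponent s')).symm)

theorem IsArm.armComponent_eq_of_germ (h : IsArm B b α) (h' : IsArm B b' α')
    (hg : α =ᶠ[atBot] α') : armComponent B α = armComponent B α' := by
  obtain ⟨s, hs⟩ := hg.exists
  exact h.armComponent_eq h' hs

theorem IsArm.range_subset (h : IsArm B b α) : range α ⊆ armComponent B α := by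
  rintro _ ⟨t, rfl⟩
  exact h.mem_armComponent t

theorem IsArm.glue [T2Space Y] {φ : ℝ → Y} (h : IsArm B b ρ) (hφ : IsOpenEmbedding φ)
    (hb : ∀ s, φ s ∉ B) {r₀ s₀ s₁ : ℝ} (h0 : φ s₀ = ρ r₀) (h01 : s₀ < s₁)
    (h1 : φ s₁ ∉ range ρ) : IsArm B b (glueLines ρ φ r₀ s₀) := by
  refine ⟨h.toIsHalfLine.glue hφ (fun s hs => hb s (hs ▸ h.mem)) h0 h01 h1, h.mem, ?_⟩
  intro u
  unfold glueLines
  split_ifs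
  · exact h.avoid u
  · exact hb _

omit [TopologicalSpace Y] in
theorem glueLines_eventuallyEq {ρ φ : ℝ → Y} {r₀ s₀ : ℝ} : glueLines ρ φ r₀ s₀ =ᶠ[atBot] ρ := by
  filter_upwards [eventually_le_atBot r₀] with u hu using glueLines_of_le hu

theorem isOpen_armComponent [LocallyConnectedSpace Y] (hB : IsClosed B) :
    IsOpen (armComponent B α) := hB.isOpen_compl.connectedComponentIn

variable [T2Space Y]

/-- The component containing an arm is covered by the prolongations of any initial segment. -/
theorem IsArm.exists_prolongation (hB : IsClosed B) (hreg : ∀ y, y ∉ B → IsLinePoint y)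
    (h : IsArm B b α) (s : ℝ) {q : Y} (hq : q ∈ armComponent B α) (hqs : q ∉ α '' Iic s) :
    ∃ ρ, IsArm B b ρ ∧ EqOn ρ α (Iic s) ∧ q ∈ ρ '' Ioi s := by
  -- `W` is open, and relatively closed in the component: a line neighborhood of a limit point `q`
  -- meets some prolongation `ρ`, and if `q` is not on `ρ` then `ρ` can be continued along this line
  -- up to `q`.
  let W : Set Y := ⋃ ρ ∈ {ρ : ℝ → Y | IsArm B b ρ ∧ EqOn ρ α (Iic s)}, range ρ
  have hWo : IsOpen W := isOpen_biUnion fun ρ hρ => hρ.1.emb.isOpen_range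
  have hW : armComponent B α ⊆ W := by
    refine isPreconnected_connectedComponentIn.subset_of_closure_inter_subset hWo
      ⟨α 0, h.mem_armComponent 0, mem_biUnion (show α ∈ _ from ⟨h, fun _ _ => rfl⟩)
        (mem_range_self 0)⟩ ?_
    rintro q ⟨hqW, hqC⟩
    by_contra hq
    have hqB : q ∉ B := armComponent_subset hqC
    have hqs : q ∉ insert b (α '' Iic s) := by
      rintro (rfl | hqs)
      · exact hqB h.mem
      · exact hq (mem_biUnion (show α ∈ _ from ⟨h, fun _ _ => rfl⟩) (image_subset_range _ _ hqs))
    have hcl := (isCompact_insert_image_Iic h.emb.continuous h.tendsto s).isClosed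
    have hU : Bᶜ ∩ (insert b (α '' Iic s))ᶜ ∈ 𝓝 q :=
      (hB.isOpen_compl.inter hcl.isOpen_compl).mem_nhds ⟨hqB, hqs⟩
    obtain ⟨φ, hφ, hφ0, hφU⟩ := (hreg q hqB).exists_subset hU
    obtain ⟨_, ⟨s₀, rfl⟩, hsW⟩ := mem_closure_iff.1 hqW _ hφ.isOpen_range (hφ0 ▸ mem_range_self 0)
    simp only [W, mem_ofPred_eq, mem_iUnion, exists_prop] at hsW
    obtain ⟨ρ, ⟨hρ, hρα⟩, r₀, hr₀⟩ := hsW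
    have hqρ : q ∉ range ρ := fun hc => hq (mem_biUnion (show ρ ∈ _ from ⟨hρ, hρα⟩) hc)
    have hr₀s : s < r₀ := by
      by_contra hle
      push Not at hle
      refine (hφU (mem_range_self s₀)).2 (Or.inr ⟨r₀, hle, ?_⟩)
      rw [← hr₀, hρα hle]
    have hφB : ∀ t, φ t ∉ B := fun t => (hφU (mem_range_self t)).1
    -- Stated for every line `φ`, so that it also applies to the reversed line when `q` lies in the
    -- backward direction.
    have fin : ∀ (φ : ℝ → Y) (s₀ : ℝ), IsOpenEmbedding φ → (∀ t, φ t ∉ B) → φ 0 = q →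
        φ s₀ = ρ r₀ → s₀ < 0 → False := by
      intro φ s₀ hφ hφB hφ0 h0 hlt
      have hχ := hρ.glue hφ hφB h0 hlt (hφ0.symm ▸ hqρ)
      refine hq (mem_biUnion (show glueLines ρ φ r₀ s₀ ∈ _ from ⟨hχ, fun u hu => ?_⟩)
        ⟨r₀ + (0 - s₀), ?_⟩)
      · rw [glueLines_of_le ((mem_Iic.1 hu).trans hr₀s.le), hρα hu]
      · rw [glueLines_of_ge h0 (by linarith), ← hφ0]
        congr 1; ring
    rcases lt_trichotomy s₀ 0 with hs | rfl | hs
    · exact fin φ s₀ hφ hφB hφ0 hr₀.symm hs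
    · exact hqρ (hφ0 ▸ ⟨r₀, hr₀⟩)
    · exact fin (fun t => φ (-t)) (-s₀) (isOpenEmbedding_neg hφ) (fun t => hφB _) (by simpa)
        (by simpa using hr₀.symm) (by linarith)
  have := hW hq
  simp only [W, mem_ofPred_eq, mem_iUnion, exists_prop] at this
  obtain ⟨ρ, ⟨hρ, hρα⟩, r, rfl⟩ := this
  refine ⟨ρ, hρ, hρα, r, ?_, rfl⟩
  by_contra hle
  rw [mem_Ioi, not_lt] at hle
  exact hqs ⟨r, hle, (hρα hle).symm⟩

/-- Any point of the tail lies on a prolongation `ρ` of the segment. Beyond `s`, both `ρ` and `α`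
are connected and stay in the tail, and they meet just after `α s` because the range of `α` is open.
-/
theorem IsArm.isConnected_tail (hB : IsClosed B) (hreg : ∀ y, y ∉ B → IsLinePoint y)
    (h : IsArm B b α) (s : ℝ) : _root_.IsConnected (armComponent B α \ α '' Iic s) := by
  have hsub : ∀ {ρ}, IsArm B b ρ → EqOn ρ α (Iic s) →
      ρ '' Ioi s ⊆ armComponent B α \ α '' Iic s := by
    rintro ρ hρ hρα _ ⟨u, hu, rfl⟩
    refine ⟨?_, ?_⟩
    · rw [h.armComponent_eq hρ (hρα self_mem_Iic).symm]
      exact hρ.mem_armComponent u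
    · rintro ⟨v, hv, hvu⟩
      rw [← hρα hv] at hvu
      have := hρ.emb.injective hvu
      subst this
      exact absurd (mem_Ioi.1 hu) (not_lt.2 hv)
  refine ⟨⟨α (s + 1), hsub h (fun _ _ => rfl) ⟨s + 1, by simp, rfl⟩⟩,
    isPreconnected_of_forall (α (s + 1)) fun q hq => ?_⟩
  obtain ⟨ρ, hρ, hρα, hqρ⟩ := h.exists_prolongation hB hreg s hq.1 hq.2
  refine ⟨ρ '' Ioi s ∪ α '' Ioi s, union_subset (hsub hρ hρα) (hsub h fun _ _ => rfl),
    Or.inr ⟨s + 1, by simp, rfl⟩, Or.inl hqρ, ?_⟩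
  refine IsPreconnected.union' ?_ (isPreconnected_Ioi.image _ hρ.emb.continuous.continuousOn)
    (isPreconnected_Ioi.image _ h.emb.continuous.continuousOn)
  have h1 : ρ ⁻¹' range α ∈ 𝓝 s := hρ.emb.continuous.continuousAt
    (h.emb.isOpen_range.mem_nhds ⟨s, (hρα self_mem_Iic).symm⟩)
  obtain ⟨u, ⟨v, hv⟩, hu⟩ := (Filter.nonempty_of_mem (inter_mem (mem_nhdsWithin_of_mem_nhds h1 : _ ∈ 𝓝[>] s)
    self_mem_nhdsWithin))
  refine ⟨ρ u, ⟨u, hu, rfl⟩, v, ?_, hv⟩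
  by_contra hle
  rw [mem_Ioi, not_lt] at hle
  rw [← hρα hle] at hv
  have := hρ.emb.injective hv
  subst this
  exact absurd (mem_Ioi.1 hu) (not_lt.2 hle)

theorem IsArm.isClosed_segment (h : IsArm B b α) (s : ℝ) : IsClosed (insert b (α '' Iic s)) :=
  (isCompact_insert_image_Iic h.emb.continuous h.tendsto s).isClosed

theorem IsArm.isOpen_tail [LocallyConnectedSpace Y] (hB : IsClosed B) (h : IsArm B b α) (s : ℝ) :
    IsOpen (armComponent B α \ α '' Iic s) := by
  have := (isOpen_armComponent (α := α) hB).sdiff (h.isClosed_segment s)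
  convert! this using 1
  ext y
  simp only [Set.mem_sdiff, mem_insert_iff, not_or, and_congr_right_iff, iff_and_self]
  rintro hy - rfl
  exact armComponent_subset hy h.mem

/-- If two disjoint arms lie in the same component, then some prolongation of the first one fills
the component and ends inside the second one. -/
theorem IsArm.exists_range_eq (hB : IsClosed B) (hreg : ∀ y, y ∉ B → IsLinePoint y)
    (h : IsArm B b α) (h' : IsArm B b' α') (hd : Disjoint (range α) (range α'))
    (hC : armComponent B α = armComponent B α') :
    ∃ ρ, IsArm B b ρ ∧ ρ =ᶠ[atBot] α ∧ range ρ = armComponent B α ∧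
      ∃ r, ρ '' Ici r ⊆ range α' ∧
        armComponent B α ⊆ insert b (ρ '' Iic r) ∪ insert b' (α' '' Iic 0) := by
  -- Such a `ρ` fills the component: its range is covered by two compact segments, and the limit
  -- points of these outside `B` lie on `ρ` itself, so the range is relatively closed as well as
  -- open.
  suffices hex : ∃ ρ, IsArm B b ρ ∧ ρ =ᶠ[atBot] α ∧
      ∃ r, ρ '' Ici r ⊆ α' '' Iic 0 ∧ α' '' Iic 0 ⊆ range ρ by
    obtain ⟨ρ, hρ, hρα, r, h1, h2⟩ := hex
    have hCρ := hρ.armComponent_eq_of_germ h hρα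
    have hcov : range ρ ⊆ insert b (ρ '' Iic r) ∪ insert b' (α' '' Iic 0) := by
      rintro _ ⟨u, rfl⟩
      rcases le_total u r with hu | hu
      · exact Or.inl (Or.inr ⟨u, hu, rfl⟩)
      · exact Or.inr (Or.inr (h1 ⟨u, hu, rfl⟩))
    have hcl := (hρ.isClosed_segment r).union (h'.isClosed_segment 0)
    have hsub : armComponent B α ⊆ range ρ := by
      refine isPreconnected_connectedComponentIn.subset_of_closure_inter_subset
        hρ.emb.isOpen_range ⟨ρ 0, ?_, mem_range_self 0⟩ ?_
      · have := hρ.mem_armComponent 0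
        rwa [hCρ] at this
      · rintro q ⟨hq, hqC⟩
        have hqB : q ∉ B := armComponent_subset hqC
        rcases hcl.closure_subset_iff.2 hcov hq with (rfl | hq) | (rfl | hq)
        · exact absurd h.mem hqB
        · exact image_subset_range _ _ hq
        · exact absurd h'.mem hqB
        · exact h2 hq
    exact ⟨ρ, hρ, hρα, (hCρ ▸ hρ.range_subset).antisymm hsub, r,
      h1.trans (image_subset_range _ _), hsub.trans hcov⟩
  have hq : α' 0 ∈ armComponent B α := hC ▸ h'.mem_armComponent 0
  have hqα : α' 0 ∉ α '' Iic 0 := fun hc =>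
    disjoint_left.1 hd (image_subset_range _ _ hc) (mem_range_self 0)
  obtain ⟨ρ, hρ, hρα, r₁, -, hr₁⟩ := h.exists_prolongation hB hreg 0 hq hqα
  have hρg : ρ =ᶠ[atBot] α := by
    filter_upwards [eventually_le_atBot 0] with u hu using hρα hu
  -- At this stage `ρ` has reached `α' 0`. If it misses a point of `α'` closer to `b'`, it is
  -- continued along `α'` backwards; otherwise it already contains the whole segment of `α'`.
  by_cases hcase : ∃ s₁, s₁ < 0 ∧ α' s₁ ∉ range ρ
  · obtain ⟨s₁, hs₁, hs₁'⟩ := hcase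
    have h0 : (fun t => α' (-t)) 0 = ρ r₁ := by simpa using hr₁.symm
    refine ⟨glueLines ρ (fun t => α' (-t)) r₁ 0, hρ.glue (s₁ := -s₁)
      (isOpenEmbedding_neg h'.emb) (fun t => h'.avoid _) h0 (by linarith) (by simpa using hs₁'),
      glueLines_eventuallyEq.trans hρg, r₁, ?_, ?_⟩
    · rintro _ ⟨u, hu, rfl⟩
      rw [glueLines_of_ge (φ := fun t => α' (-t)) h0 hu]
      refine ⟨_, ?_, rfl⟩
      simp only [mem_Ici, mem_Iic] at hu ⊢
      linarith
    · rintro _ ⟨v, hv, rfl⟩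
      rw [mem_Iic] at hv
      refine ⟨r₁ - v, ?_⟩
      rw [glueLines_of_ge (φ := fun t => α' (-t)) h0 (by linarith)]
      congr 1; ring
  · push Not at hcase
    have hsub : α' '' Iic 0 ⊆ range ρ := by
      rintro _ ⟨v, hv, rfl⟩
      rcases (mem_Iic.1 hv).lt_or_eq with hv | rfl
      · exact hcase v hv
      · exact ⟨r₁, hr₁⟩
    refine ⟨ρ, hρ, hρg, r₁, ?_, hsub⟩
    let I : Set ℝ := ρ ⁻¹' (α' '' Iic 0)
    have hρI : ρ '' I = α' '' Iic 0 := by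
      rw [image_preimage_eq_inter_range, inter_eq_left.2 hsub]
    have hIc : _root_.IsPreconnected I :=
      (hρ.emb.isInducing.isPreconnected_image).1
        (hρI ▸ isPreconnected_Iic.image _ h'.emb.continuous.continuousOn)
    have hI1 : r₁ ∈ I := ⟨0, self_mem_Iic, hr₁.symm⟩
    have hI0 : I ⊆ Ici 0 := by
      rintro u ⟨v, hv, hvu⟩
      by_contra hu
      rw [mem_Ici, not_le] at hu
      rw [hρα hu.le] at hvu
      exact disjoint_left.1 hd (mem_range_self u) ⟨v, hvu⟩
    -- If `I` were bounded, `α'` would approach `b'` inside a compact piece of `ρ`, and `b'` would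
    -- lie on `ρ`, which avoids `B`. So the interval `I` contains all parameters above `r₁`.
    have hunb : ¬ BddAbove I := by
      rintro ⟨M, hM⟩
      have hK : IsCompact (ρ '' Icc 0 M) := isCompact_Icc.image hρ.emb.continuous
      have hb' : b' ∈ ρ '' Icc 0 M := by
        refine hK.isClosed.mem_of_tendsto h'.tendsto ?_
        filter_upwards [eventually_le_atBot 0] with v hv
        obtain ⟨u, hu⟩ := hsub ⟨v, hv, rfl⟩
        have huI : u ∈ I := ⟨v, hv, hu.symm⟩
        exact ⟨u, ⟨hI0 huI, hM huI⟩, hu⟩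
      obtain ⟨u, -, hu⟩ := hb'
      exact hρ.avoid u (hu ▸ h'.mem)
    rintro _ ⟨u, hu, rfl⟩
    rw [not_bddAbove_iff] at hunb
    obtain ⟨v, hv, huv⟩ := hunb u
    exact hIc.ordConnected.out hI1 hv ⟨hu, huv.le⟩

/-- A component containing two disjoint arms contains no third arm. -/
theorem IsArm.eq_or_eq_of_armComponent_eq (hB : IsClosed B) (hreg : ∀ y, y ∉ B → IsLinePoint y)
    {b'' : Y} {α'' : ℝ → Y} (h : IsArm B b α) (h' : IsArm B b' α') (h'' : IsArm B b'' α'')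
    (hd : Disjoint (range α) (range α')) (hd₁ : Disjoint (range α) (range α''))
    (hd₂ : Disjoint (range α') (range α''))
    (hC : armComponent B α = armComponent B α') : armComponent B α ≠ armComponent B α'' := by
  intro hC'
  obtain ⟨ρ, hρ, hρα, hran, r, hr, -⟩ := h.exists_range_eq hB hreg h' hd hC
  obtain ⟨s, hs⟩ := (eventually_atBot.1 hρα)
  have hK : IsCompact (ρ '' Icc s r) := isCompact_Icc.image hρ.emb.continuous
  -- Below `s` the line `ρ` runs in `α`, above `r` in `α'`. A disjoint third arm filling none of
  -- these is trapped in a compact piece of `ρ`, and so is its limit `b''`, although `ρ` avoids `B`.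
  have hb'' : b'' ∈ ρ '' Icc s r := by
    refine hK.isClosed.mem_of_tendsto h''.tendsto (Eventually.of_forall fun v => ?_)
    obtain ⟨u, hu⟩ : α'' v ∈ range ρ := by rw [hran, hC']; exact h''.mem_armComponent v
    refine ⟨u, ⟨?_, ?_⟩, hu⟩
    · by_contra hlt
      rw [not_le] at hlt
      exact disjoint_left.1 hd₁ (mem_range_self u) ⟨v, by rw [← hu, hs u hlt.le]⟩
    · by_contra hlt
      rw [not_le] at hlt
      exact disjoint_left.1 hd₂ (hr ⟨u, hlt.le, rfl⟩) ⟨v, hu.symm⟩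
  obtain ⟨u, -, hu⟩ := hb''
  exact hρ.avoid u (hu ▸ h''.mem)

end Arms

/-! ### Stars with an even number of arms -/

section Stars

variable {Y X : Type*} [TopologicalSpace Y] [TopologicalSpace X]

/-- A point with a neighborhood that is a cone over a finite set with an even number of points. -/
def IsEvenStarPoint (x : Y) : Prop :=
  ∃ (n : ℕ) (α : Fin n → ℝ → Y), Even n ∧ (∀ i, IsHalfLine x (α i)) ∧ (∀ i s, α i s ≠ x) ∧
    (∀ i j, i ≠ j → Disjoint (range (α i)) (range (α j))) ∧
    ∀ s, insert x (⋃ i, α i '' Iio s) ∈ 𝓝 x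

theorem IsLinePoint.map {f : Y → X} (hf : IsOpenEmbedding f) {y : Y} (h : IsLinePoint y) :
    IsLinePoint (f y) := by
  obtain ⟨φ, hφ, s, rfl⟩ := h
  exact ⟨_, hf.comp hφ, s, rfl⟩

theorem IsLinePoint.of_map {f : Y → X} (hf : IsOpenEmbedding f) {y : Y} (h : IsLinePoint (f y)) :
    IsLinePoint y := by
  obtain ⟨φ, hφ, h0, hr⟩ := h.exists_subset (hf.isOpen_range.mem_nhds (mem_range_self y))
  choose ψ hψ using fun s => hr (mem_range_self s)
  have : f ∘ ψ = φ := funext hψ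
  exact ⟨ψ, IsOpenEmbedding.of_comp ψ hf (this ▸ hφ), 0, hf.injective (by rw [hψ, h0])⟩

theorem IsEvenStarPoint.map {f : Y → X} (hf : IsOpenEmbedding f) {y : Y}
    (h : IsEvenStarPoint y) : IsEvenStarPoint (f y) := by
  obtain ⟨n, α, hn, hα, hne, hd, hnhds⟩ := h
  refine ⟨n, fun i => f ∘ α i, hn, fun i => ⟨hf.comp (hα i).emb,
    (hf.continuous.tendsto y).comp (hα i).tendsto⟩, fun i s hs => hne i s (hf.injective hs),
    fun i j hij => ?_, fun s => ?_⟩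
  · rw [range_comp, range_comp]
    exact (disjoint_image_iff hf.injective).2 (hd i j hij)
  · have := hf.isOpenMap.image_mem_nhds (hnhds s)
    rw [image_insert_eq, image_iUnion] at this
    simpa only [image_comp] using this

/-- The map `u ↦ s - exp (-u)`. It reparametrizes an initial segment of an arm as a complete arm,
which is how stars are shrunk into neighborhoods. -/
theorem exists_isOpenEmbedding_image_Iio (s : ℝ) : ∃ f : ℝ → ℝ, IsOpenEmbedding f ∧
    Tendsto f atBot atBot ∧ range f = Iio s ∧ ∀ t, f '' Iio t = Iio (f t) := by
  have hr : ∀ v, v < s → s - Real.exp (- -Real.log (s - v)) = v := by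
    intro v hv
    rw [neg_neg, Real.exp_log (by linarith)]; ring
  refine ⟨fun u => s - Real.exp (-u), ?_, ?_, ?_, fun t => ?_⟩
  · exact isOpenEmbedding_of_isLinePoint (by fun_prop) (fun a b hab => by simpa using hab)
      fun t => ⟨id, IsOpenEmbedding.id, mem_range_self _⟩
  · exact tendsto_const_nhds.add_atBot (tendsto_neg_atTop_atBot.comp
      (Real.tendsto_exp_atTop.comp tendsto_neg_atBot_atTop))
  · ext v
    constructor
    · rintro ⟨u, rfl⟩
      simp [Real.exp_pos]
    · exact fun hv => ⟨_, hr v hv⟩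
  · ext v
    constructor
    · rintro ⟨u, hu, rfl⟩
      simpa using hu
    · intro hv
      have hv' : v < s - Real.exp (-t) := hv
      have hvs : v < s := hv'.trans (by linarith [Real.exp_pos (-t)])
      refine ⟨-Real.log (s - v), ?_, hr v hvs⟩
      rw [← hr v hvs] at hv'
      have : -t < Real.log (s - v) := by simpa using hv'
      rw [mem_Iio]; linarith

theorem IsEvenStarPoint.exists_subset {x : Y} (h : IsEvenStarPoint x) {U : Set Y} (hU : U ∈ 𝓝 x) :
    ∃ (n : ℕ) (α : Fin n → ℝ → Y), Even n ∧ (∀ i, IsHalfLine x (α i)) ∧ (∀ i s, α i s ≠ x) ∧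
      (∀ i j, i ≠ j → Disjoint (range (α i)) (range (α j))) ∧
      (∀ s, insert x (⋃ i, α i '' Iio s) ∈ 𝓝 x) ∧ ∀ i, range (α i) ⊆ U := by
  obtain ⟨n, α, hn, hα, hne, hd, hnhds⟩ := h
  have h1 : ∀ᶠ t in atBot, ∀ i, α i t ∈ U := eventually_all.2 fun i => (hα i).tendsto hU
  obtain ⟨s, hs⟩ := eventually_atBot.1 h1
  obtain ⟨f, hf, hfb, hfr, hfi⟩ := exists_isOpenEmbedding_image_Iio s
  refine ⟨n, fun i => α i ∘ f, hn, fun i => ⟨(hα i).emb.comp hf, (hα i).tendsto.comp hfb⟩,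
    fun i t => hne i _, fun i j hij => (hd i j hij).mono (range_comp_subset_range _ _)
      (range_comp_subset_range _ _), fun t => ?_, fun i => ?_⟩
  · simpa only [image_comp, hfi] using hnhds (f t)
  · rintro _ ⟨t, rfl⟩
    exact hs _ (hfr ▸ mem_range_self t : f t ∈ Iio s).le i

theorem IsEvenStarPoint.of_map {f : Y → X} (hf : IsOpenEmbedding f) {y : Y}
    (h : IsEvenStarPoint (f y)) : IsEvenStarPoint y := by
  obtain ⟨n, α, hn, hα, hne, hd, hnhds, hr⟩ :=
    h.exists_subset (hf.isOpen_range.mem_nhds (mem_range_self y))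
  choose β hβ using fun i s => hr i (mem_range_self s)
  have hfβ : ∀ i, f ∘ β i = α i := fun i => funext (hβ i)
  refine ⟨n, β, hn, fun i => ⟨IsOpenEmbedding.of_comp _ hf (hfβ i ▸ (hα i).emb), ?_⟩,
    fun i s hs => hne i s (by rw [← hβ, hs]), fun i j hij => ?_, fun s => ?_⟩
  · rw [hf.isInducing.tendsto_nhds_iff, hfβ]
    exact (hα i).tendsto
  · have := hd i j hij
    rw [← hfβ, ← hfβ, range_comp, range_comp] at this
    exact (disjoint_image_iff hf.injective).1 this
  · have := hf.continuous.continuousAt (hnhds s)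
    refine mem_of_superset this ?_
    rintro z (hz | hz)
    · exact Or.inl (hf.injective hz)
    · obtain ⟨i, t, ht, htz⟩ := mem_iUnion.1 hz
      refine Or.inr (mem_iUnion.2 ⟨i, t, ht, hf.injective ?_⟩)
      rw [hβ, htz]

/-- All other points of the star lie on the arms, which are open lines. Branch points are therefore
isolated from one another. -/
theorem IsEvenStarPoint.eventually_isLinePoint {x : Y} (h : IsEvenStarPoint x) :
    ∀ᶠ y in 𝓝[≠] x, IsLinePoint y := by
  obtain ⟨n, α, hn, hα, hne, hd, hnhds⟩ := h
  refine eventually_nhdsWithin_iff.2 (mem_of_superset (hnhds 0) ?_)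
  rintro y (rfl | hy) hyx
  · exact absurd rfl hyx
  · obtain ⟨i, t, ht, rfl⟩ := mem_iUnion.1 hy
    exact (hα i).emb.isLinePoint t

/-- A truncated arm stays connected when its limit, the center, is added, and all arms share the
center. -/
theorem locallyConnectedSpace_of_isEvenStarPoint (h : ∀ y : Y, IsEvenStarPoint y) :
    LocallyConnectedSpace Y := by
  refine locallyConnectedSpace_iff_connected_subsets.2 fun x U hU => ?_
  obtain ⟨n, α, hn, hα, hne, hd, hnhds, hr⟩ := (h x).exists_subset hU
  refine ⟨_, hnhds 0, isPreconnected_of_forall x ?_, ?_⟩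
  · rintro y (rfl | hy)
    · exact ⟨{y}, by simp, rfl, rfl, isPreconnected_singleton⟩
    · obtain ⟨i, hi⟩ := mem_iUnion.1 hy
      refine ⟨insert x (α i '' Iio 0), insert_subset_insert (subset_iUnion (fun i => α i '' Iio 0) i),
        mem_insert _ _, Or.inr hi, ?_⟩
      refine (isPreconnected_Iio.image _ (hα i).emb.continuous.continuousOn).subset_closure
        (subset_insert _ _) (insert_subset ?_ subset_closure)
      refine mem_closure_of_tendsto (hα i).tendsto ?_
      filter_upwards [eventually_lt_atBot 0] with t ht using ⟨t, ht, rfl⟩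
  · rintro y (rfl | hy)
    · exact mem_of_mem_nhds hU
    · obtain ⟨i, t, ht, rfl⟩ := mem_iUnion.1 hy
      exact hr i (mem_range_self t)

end Stars

/-! ### Parity of the number of unpaired arms -/

section Counting

/-- By `h3` the fibres of `C` have at most two elements. Those with exactly two are removed by a
fixed point free involution, which does not change the parity. -/
theorem even_card_of_classes {A : Type*} [Fintype A] [DecidableEq A] {γ : Type*} (C : A → γ)
    (h3 : ∀ a b c, a ≠ b → a ≠ c → b ≠ c → C a = C b → C a ≠ C c) (hA : Even (Fintype.card A)) :
    Even (Nat.card {a : A // ∀ a', C a' = C a → a' = a}) := by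
  classical
  rw [Nat.card_eq_fintype_card, Fintype.card_subtype]
  have hcompl : Even (Finset.univ.filter fun a : A => ¬ ∀ a', C a' = C a → a' = a).card := by
    have hex : ∀ a ∈ Finset.univ.filter fun a : A => ¬ ∀ a', C a' = C a → a' = a,
        ∃ a', C a' = C a ∧ a' ≠ a := by
      intro a ha
      simpa using (Finset.mem_filter.1 ha).2
    choose! g hg hg' using hex
    have hmem : ∀ a ∈ Finset.univ.filter fun a : A => ¬ ∀ a', C a' = C a → a' = a,
        g a ∈ Finset.univ.filter fun a : A => ¬ ∀ a', C a' = C a → a' = a := by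
      intro a ha
      refine Finset.mem_filter.2 ⟨Finset.mem_univ _, fun hall => hg' a ha ?_⟩
      exact (hall a (hg a ha).symm).symm
    have hs : ∑ a ∈ Finset.univ.filter fun a : A => ¬ ∀ a', C a' = C a → a' = a, (1 : ZMod 2) = 0 := by
      refine Finset.sum_involution (fun a _ => g a) (fun a _ => by decide) (fun a ha _ => hg' a ha)
        hmem fun a ha => ?_
      by_contra hne
      exact h3 a (g a) (g (g a)) (hg' a ha).symm (Ne.symm hne) (hg' _ (hmem a ha)).symm
        (hg a ha).symm ((hg _ (hmem a ha)).trans (hg a ha)).symm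
    rw [Finset.sum_const, nsmul_one] at hs
    exact ZMod.natCast_eq_zero_iff_even.1 hs
  have := Finset.card_filter_add_card_filter_not (s := (Finset.univ : Finset A))
    (fun a => ∀ a', C a' = C a → a' = a)
  rw [Finset.card_univ] at this
  rw [← this] at hA
  exact (Nat.even_add.1 hA).2 hcompl

end Counting

/-! ### Ends of connected curves -/

section ConnectedCurve

variable {Y : Type u} [TopologicalSpace Y] [T2Space Y]

/-- A choice of pairwise disjoint arms at all points of a finite set. -/
theorem exists_arms (hstar : ∀ y : Y, IsEvenStarPoint y) {B : Set Y} (hB : B.Finite) :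
    ∃ (A : Type u) (_ : Fintype A) (b : A → Y) (α : A → ℝ → Y), Even (Fintype.card A) ∧
      (∀ a, IsArm B (b a) (α a)) ∧
      (∀ a a', a ≠ a' → Disjoint (range (α a)) (range (α a'))) ∧
      ∀ x ∈ B, ∀ s : A → ℝ, insert x (⋃ a ∈ {a | b a = x}, α a '' Iio (s a)) ∈ 𝓝 x := by
  classical
  -- Taking the star at each point of `B` inside disjoint neighborhoods makes arms at different
  -- points disjoint and keeps every arm away from the other points of `B`.
  obtain ⟨U, hU, hUd⟩ := hB.t2_separation
  choose n α hn hα hne hd hnhds hr using fun x : Y =>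
    (hstar x).exists_subset ((hU x).2.mem_nhds (hU x).1)
  have := hB.fintype
  refine ⟨Σ b : B, Fin (n b), inferInstance, fun a => a.1, fun a => α a.1 a.2, ?_, ?_, ?_, ?_⟩
  · rw [Fintype.card_sigma]
    exact Finset.even_sum _ fun b _ => by simpa using hn b
  · refine fun a => ⟨hα _ _, a.1.2, fun s hs => hne a.1 a.2 s ?_⟩
    by_contra hcon
    exact disjoint_left.1 (hUd hs a.1.2 hcon) (hU _).1 (hr _ _ (mem_range_self s))
  · rintro ⟨x, i⟩ ⟨y, j⟩ hij
    by_cases hxy : x = y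
    · subst hxy
      exact hd _ i j fun h => hij (h ▸ rfl)
    · exact (hUd x.2 y.2 fun h => hxy (Subtype.ext h)).mono (hr _ _) (hr _ _)
  · intro x hx s
    have hfin : ∃ t, ∀ i : Fin (n x), t ≤ s ⟨⟨x, hx⟩, i⟩ := by
      have : ∀ᶠ t in atBot, ∀ i : Fin (n x), t ≤ s ⟨⟨x, hx⟩, i⟩ :=
        eventually_all.2 fun i => eventually_le_atBot _
      exact this.exists
    obtain ⟨t, ht⟩ := hfin
    refine mem_of_superset (hnhds x t) (insert_subset_insert (iUnion_subset fun i => ?_))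
    refine subset_trans ?_ (subset_biUnion_of_mem
      (u := fun a : Σ b : B, Fin (n b) => α a.1 a.2 '' Iio (s a)) (x := ⟨⟨x, hx⟩, i⟩) rfl)
    exact image_mono (Iio_subset_Iio (ht i))

/-- A connected Hausdorff space that is locally a cone over an even number of points, and locally
a line away from finitely many points, has a finite even number of ends. -/
theorem finite_even_ends_of_connected [PreconnectedSpace Y] [Nonempty Y]
    (hstar : ∀ y : Y, IsEvenStarPoint y) (hfin : {y : Y | ¬ IsLinePoint y}.Finite) :
    Finite (SpaceEnd Y) ∧ Even (Nat.card (SpaceEnd Y)) := by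
  classical
  have := locallyConnectedSpace_of_isEvenStarPoint hstar
  obtain ⟨y₀⟩ := ‹Nonempty Y›
  -- The extra point makes `B` nonempty even without branch points, so that a circle or a line is
  -- also cut into arms.
  obtain ⟨B, hBdef⟩ : ∃ B, B = insert y₀ {y : Y | ¬ IsLinePoint y} := ⟨_, rfl⟩
  have hBf : B.Finite := hBdef ▸ hfin.insert y₀
  have hB : IsClosed B := hBf.isClosed
  have hy₀ : y₀ ∈ B := hBdef ▸ mem_insert _ _
  have hreg : ∀ y, y ∉ B → IsLinePoint y := by
    intro y hy
    by_contra h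
    exact hy (hBdef ▸ mem_insert_of_mem _ h)
  clear hBdef
  obtain ⟨A, _, b, α, hA, hα, hd, hnhds⟩ := exists_arms hstar hBf
  let C : A → Set Y := fun a => armComponent B (α a)
  have hCopen : ∀ a, IsOpen (C a) := fun a => isOpen_armComponent hB
  have hCdisj : ∀ a (y : Y), y ∉ B → y ∉ C a → Disjoint (C a) (connectedComponentIn Bᶜ y) :=
    fun a y hy hya => by
      refine disjoint_left.2 fun z hz hz' => hya ?_
      have h1 : armComponent B (α a) = connectedComponentIn Bᶜ z := connectedComponentIn_eq hz
      change y ∈ armComponent B (α a)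
      rw [h1, ← connectedComponentIn_eq hz']
      exact mem_connectedComponentIn hy
  -- A component of the complement of `B` without arms would also be closed, since near a point of
  -- `B` every other point lies on an arm. By connectedness it would be everything, but it misses
  -- `y₀`.
  have hcover : ∀ y, y ∉ B → ∃ a, y ∈ C a := by
    intro y hy
    by_contra hno
    push Not at hno
    have hDo : IsOpen (connectedComponentIn Bᶜ y) := hB.isOpen_compl.connectedComponentIn
    have hDc : IsClosed (connectedComponentIn Bᶜ y) := by
      refine isOpen_compl_iff.1 (isOpen_iff_mem_nhds.2 fun z hz => ?_)
      by_cases hzB : z ∈ B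
      · refine mem_of_superset (hnhds z hzB fun _ => 0) ?_
        rintro w (rfl | hw)
        · exact hz
        · simp only [mem_iUnion] at hw
          obtain ⟨a, -, t, -, rfl⟩ := hw
          exact disjoint_left.1 (hCdisj a y hy (hno a)) ((hα a).mem_armComponent t)
      · refine mem_of_superset
          ((hB.isOpen_compl.connectedComponentIn).mem_nhds (mem_connectedComponentIn hzB)) ?_
        intro w hw hw'
        refine hz ?_
        rw [connectedComponentIn_eq hw', ← connectedComponentIn_eq hw]
        exact mem_connectedComponentIn hzB
    have huniv := IsClopen.eq_univ ⟨hDc, hDo⟩ ⟨y, mem_connectedComponentIn hy⟩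
    have : y₀ ∈ connectedComponentIn Bᶜ y := huniv ▸ mem_univ _
    exact connectedComponentIn_subset _ _ this hy₀
  let E := {a : A // ∀ a', C a' = C a → a' = a}
  have hE : Even (Nat.card E) := even_card_of_classes C (fun a a' a'' h1 h2 h3 h =>
    (hα a).eq_or_eq_of_armComponent_eq hB hreg (hα a') (hα a'') (hd _ _ h1) (hd _ _ h2)
      (hd _ _ h3) h) hA
  have hCeq : ∀ {a ρ}, IsArm B (b a) ρ → ρ =ᶠ[atBot] α a → armComponent B ρ = C a :=
    fun {a ρ} h hg => h.armComponent_eq_of_germ (hα a) hg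
  -- All arms with the germ of `α a` are used, not only `α a`, whose range need not exhaust the
  -- component. Segments of such arms are comparable, so the tails still form a chain.
  let 𝒯 : E → Set (Set Y) := fun a => {T | ∃ ρ s, IsArm B (b a) ρ ∧ ρ =ᶠ[atBot] α a ∧
    T = C a \ ρ '' Iic s}
  have htotal : ∀ a : E, ∀ ρ ρ' s s', IsArm B (b a) ρ → ρ =ᶠ[atBot] α a → IsArm B (b a) ρ' →
      ρ' =ᶠ[atBot] α a → (C a \ ρ '' Iic s ⊆ C a \ ρ' '' Iic s' ∨
        C a \ ρ' '' Iic s' ⊆ C a \ ρ '' Iic s) := by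
    intro a ρ ρ' s s' h hg h' hg'
    exact (h.toIsHalfLine.initial_total h'.toIsHalfLine h.ne h'.ne (hg.trans hg'.symm) s s').symm.imp
      (fun hs => sdiff_subset_sdiff_right hs) (fun hs => sdiff_subset_sdiff_right hs)
  have hequiv : Nonempty (SpaceEnd Y ≃ E) := by
    refine SpaceEnd.nonempty_equiv_of_tails 𝒯 ?_ ?_ ?_ ?_ ?_ ?_ ?_
    · exact fun a => ⟨_, α a, 0, hα a, EventuallyEq.rfl, rfl⟩
    · rintro a _ ⟨ρ, s, hρ, hg, rfl⟩
      rw [← hCeq hρ hg]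
      exact hρ.isOpen_tail hB s
    · rintro a _ ⟨ρ, s, hρ, hg, rfl⟩
      rw [← hCeq hρ hg]
      exact hρ.isConnected_tail hB hreg s
    · rintro a _ ⟨ρ, s, hρ, hg, rfl⟩ _ ⟨ρ', s', hρ', hg', rfl⟩
      exact htotal a ρ ρ' s s' hρ hg hρ' hg'
    · rintro a a' haa _ ⟨ρ, s, hρ, hg, rfl⟩ _ ⟨ρ', s', hρ', hg', rfl⟩
      refine Disjoint.mono sdiff_subset sdiff_subset (disjoint_left.2 fun z hz hz' => haa ?_)
      refine Subtype.ext (a'.2 a ?_)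
      exact (connectedComponentIn_eq hz : armComponent B (α a) = _).trans
        (connectedComponentIn_eq hz' : armComponent B (α a') = _).symm
    · intro τ hτ
      choose ρ s hρ hg hτs using hτ
      -- Outside the tails, a component with a lone arm leaves only an initial segment; a component
      -- with two arms is covered by two compact segments.
      have hK : ∀ a : A, ∃ K : Set Y, IsCompact K ∧ ∀ y ∈ C a, (∀ e : E, y ∉ τ e) → y ∈ K := by
        intro a
        by_cases ha : ∀ a', C a' = C a → a' = a
        · refine ⟨_, isCompact_insert_image_Iic (hρ ⟨a, ha⟩).emb.continuous (hρ ⟨a, ha⟩).tendsto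
            (s ⟨a, ha⟩), fun y hy hyτ => Or.inr ?_⟩
          by_contra hcon
          exact hyτ ⟨a, ha⟩ (by rw [hτs]; exact ⟨hy, hcon⟩)
        · push Not at ha
          obtain ⟨a', ha', hne⟩ := ha
          obtain ⟨ρ', hρ', -, -, r, -, hsub⟩ := (hα a).exists_range_eq hB hreg (hα a')
            (hd _ _ hne.symm) ha'.symm
          exact ⟨_, (isCompact_insert_image_Iic hρ'.emb.continuous hρ'.tendsto r).union
            (isCompact_insert_image_Iic (hα a').emb.continuous (hα a').tendsto 0),
            fun y hy _ => hsub hy⟩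
      choose K hKc hK using hK
      refine (hBf.isCompact.union (isCompact_iUnion hKc)).of_isClosed_subset ?_ ?_
      · refine isClosed_compl_iff.2 (isOpen_iUnion fun e => ?_)
        rw [hτs, ← hCeq (hρ e) (hg e)]
        exact (hρ e).isOpen_tail hB _
      · intro y hy
        by_cases hyB : y ∈ B
        · exact Or.inl hyB
        · obtain ⟨a, ha⟩ := hcover y hyB
          exact Or.inr (mem_iUnion.2 ⟨a, hK a y ha fun e he => hy (mem_iUnion.2 ⟨e, he⟩)⟩)
    · intro K hK a
      let J := {p : (ℝ → Y) × ℝ // IsArm B (b a) p.1 ∧ p.1 =ᶠ[atBot] α a}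
      let T : J → Set Y := fun p => C a \ p.1.1 '' Iic p.1.2
      have : Nonempty J := ⟨⟨(α a, 0), hα a, EventuallyEq.rfl⟩⟩
      have hJ : ∀ p q : J, T p ⊆ T q ∨ T q ⊆ T p := fun p q =>
        htotal a _ _ _ _ p.2.1 p.2.2 q.2.1 q.2.2
      -- No point lies in the closures of all tails. The complements of these closures are thus a
      -- directed open cover of `K`, and a single one of them contains `K`.
      have hcov : K ⊆ ⋃ p : J, (closure (T p))ᶜ := by
        intro z hz
        rw [mem_iUnion]
        by_cases hzB : z ∈ B
        · refine ⟨⟨(α a, 0), hα a, EventuallyEq.rfl⟩, fun hcl => ?_⟩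
          obtain ⟨w, hw, hwT⟩ := mem_closure_iff_nhds.1 hcl _ (hnhds z hzB fun _ => 0)
          rcases hw with rfl | hw
          · exact armComponent_subset hwT.1 hzB
          · simp only [mem_iUnion] at hw
            obtain ⟨a', -, t, ht, rfl⟩ := hw
            have haa : a' = a := a.2 a' <|
              (connectedComponentIn_eq ((hα a').mem_armComponent t) : armComponent B (α a') = _).trans
                (connectedComponentIn_eq hwT.1 : armComponent B (α a) = _).symm
            subst haa
            exact hwT.2 ⟨t, Iio_subset_Iic_self ht, rfl⟩
        · by_cases hzC : z ∈ C a
          · obtain ⟨ρ, hρ, hg, s, hs⟩ : ∃ ρ, IsArm B (b a) ρ ∧ ρ =ᶠ[atBot] α a ∧ ∃ s, ρ s = z := by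
              by_cases hz0 : z ∈ α a '' Iic 0
              · obtain ⟨s, -, hs⟩ := hz0
                exact ⟨α a, hα a, EventuallyEq.rfl, s, hs⟩
              · obtain ⟨ρ, hρ, hρα, s, -, hs⟩ := (hα a).exists_prolongation hB hreg 0 hzC hz0
                refine ⟨ρ, hρ, ?_, s, hs⟩
                filter_upwards [eventually_le_atBot 0] with u hu using hρα hu
            refine ⟨⟨(ρ, s + 1), hρ, hg⟩, fun hcl => ?_⟩
            obtain ⟨w, hw, hwT⟩ := mem_closure_iff_nhds.1 hcl (ρ '' Iio (s + 1))
              ((hρ.emb.isOpenMap _ isOpen_Iio).mem_nhds ⟨s, by simp, hs⟩)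
            exact hwT.2 (image_mono Iio_subset_Iic_self hw)
          · refine ⟨⟨(α a, 0), hα a, EventuallyEq.rfl⟩, fun hcl => ?_⟩
            obtain ⟨w, hw, hwT⟩ := mem_closure_iff_nhds.1 hcl _
              ((hB.isOpen_compl.connectedComponentIn).mem_nhds (mem_connectedComponentIn hzB))
            exact disjoint_left.1 (hCdisj a z hzB hzC) hwT.1 hw
      have hdir : Directed (· ⊆ ·) (fun p : J => (closure (T p))ᶜ) := by
        intro p q
        rcases hJ p q with h | h
        · exact ⟨p, Subset.rfl, compl_subset_compl.2 (closure_mono h)⟩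
        · exact ⟨q, compl_subset_compl.2 (closure_mono h), Subset.rfl⟩
      obtain ⟨p, hp⟩ := hK.elim_directed_cover (fun p : J => (closure (T p))ᶜ)
        (fun p => isClosed_closure.isOpen_compl) hcov hdir
      exact ⟨T p, ⟨_, _, p.2.1, p.2.2, rfl⟩, disjoint_left.2 fun z hz hzK =>
        hp hzK (subset_closure hz)⟩
  obtain ⟨e⟩ := hequiv
  exact ⟨Finite.of_equiv _ e.symm, Nat.card_congr e ▸ hE⟩

/-- A Hausdorff space that is locally a cone over an even number of points, and locally a line at
nonisolated points outside a compact set, has components with a finite even number of ends. -/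
theorem finite_even_ends (hstar : ∀ y : Y, IsEvenStarPoint y) {S : Set Y} (hS : IsCompact S)
    (hreg : ∀ y, y ∉ S → IsLinePoint y ∨ IsOpen {y}) (x : Y) :
    Finite (SpaceEnd (connectedComponent x)) ∧
      Even (Nat.card (SpaceEnd (connectedComponent x))) := by
  have := locallyConnectedSpace_of_isEvenStarPoint hstar
  have hemb : IsOpenEmbedding ((↑) : connectedComponent x → Y) :=
    isOpen_connectedComponent.isOpenEmbedding_subtypeVal
  have : PreconnectedSpace (connectedComponent x) :=
    Subtype.preconnectedSpace isPreconnected_connectedComponent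
  have : Nonempty (connectedComponent x) := ⟨⟨x, mem_connectedComponent⟩⟩
  refine finite_even_ends_of_connected (fun y => (hstar y).of_map hemb) ?_
  -- Each point of the compact set `S` has a neighborhood in which it is the only possible point
  -- that is not a line point.
  have hfin : (S ∩ {y | ¬ IsLinePoint y}).Finite := by
    obtain ⟨t, ht, hSt⟩ := hS.elim_nhds_subcover (fun y => insert y {z | IsLinePoint z})
      fun y _ => insert_mem_nhds_iff.2 ((hstar y).eventually_isLinePoint)
    refine t.finite_toSet.subset ?_
    rintro y ⟨hyS, hy⟩
    obtain ⟨z, hz, hyz⟩ := mem_iUnion₂.1 (hSt hyS)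
    rcases hyz with rfl | hyz
    · exact hz
    · exact absurd hyz hy
  -- An isolated point is clopen and hence its whole component. Without isolated points, every point
  -- of the component that is not a line point lies in `S`.
  by_cases hiso : ∃ y : connectedComponent x, IsOpen {(y : Y)}
  · obtain ⟨y, hy⟩ := hiso
    have hy' : IsOpen {y} := by
      have := hy.preimage hemb.continuous
      convert! this using 1
      ext z
      simp [Subtype.ext_iff]
    have huniv : ({y} : Set (connectedComponent x)) = univ :=
      IsClopen.eq_univ ⟨isClosed_singleton, hy'⟩ (singleton_nonempty y)
    exact (finite_singleton y).subset (huniv ▸ subset_univ _)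
  · push Not at hiso
    refine Finite.subset (hfin.preimage Subtype.val_injective.injOn) fun y hy => ?_
    have hyl : ¬ IsLinePoint (y : Y) := fun h => hy (h.of_map hemb)
    exact ⟨by_contra fun hyS => (hreg y hyS).elim hyl (hiso y), hyl⟩

end ConnectedCurve

/-! ### Extension of power series to algebras -/

section AlgExt

variable {ι : Type*} [Fintype ι]

open Classical in
/-- The extension of a power series in commuting real variables to a Banach algebra. -/
noncomputable def algExt (p : FormalMultilinearSeries ℝ (ι → ℝ) ℝ) (A : Type*) [NormedRing A]
    [NormedAlgebra ℝ A] : FormalMultilinearSeries ℝ (ι → A) A :=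
  fun k => ∑ w : Fin k → ι, p k (fun j => Pi.single (w j) 1) •
    (ContinuousMultilinearMap.mkPiAlgebraFin ℝ k A).compContinuousLinearMap
      fun j => ContinuousLinearMap.proj (R := ℝ) (φ := fun _ : ι => A) (w j)

/-- A radius of convergence that is good for all the extensions of a power series. -/
def IsExtRadius (p : FormalMultilinearSeries ℝ (ι → ℝ) ℝ) (δ : ℝ) : Prop :=
  0 < δ ∧ ∃ C, ∀ k, ‖p k‖ * ((Fintype.card ι : ℝ) * δ) ^ k ≤ C

variable {p : FormalMultilinearSeries ℝ (ι → ℝ) ℝ} {δ : ℝ}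

variable (A : Type*) [NormedRing A] [NormedAlgebra ℝ A]

open Classical in
theorem algExt_apply (k : ℕ) (M : Fin k → ι → A) :
    algExt p A k M =
      ∑ w : Fin k → ι, p k (fun j => Pi.single (w j) 1) • (List.ofFn fun j => M j (w j)).prod := by
  simp only [algExt, sum_apply, smul_apply,
    ContinuousMultilinearMap.compContinuousLinearMap_apply,
    ContinuousMultilinearMap.mkPiAlgebraFin_apply, ContinuousLinearMap.proj_apply]

/-- There are `card ι ^ k` words of length `k`, and each has a coefficient of size at most `‖p k‖`.
The last factor accounts for `k = 0`, where the empty product is the unit of `A`. -/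
theorem norm_algExt_le (k : ℕ) :
    ‖algExt p A k‖ ≤ (Fintype.card ι : ℝ) ^ k * ‖p k‖ * max 1 ‖(1 : A)‖ := by
  classical
  refine ContinuousMultilinearMap.opNorm_le_bound (by positivity) fun M => ?_
  rw [algExt_apply]
  have hw : ∀ w : Fin k → ι, ‖p k (fun j => Pi.single (w j) 1) •
      (List.ofFn fun j => M j (w j)).prod‖ ≤ ‖p k‖ * (max 1 ‖(1 : A)‖ * ∏ j, ‖M j‖) := by
    intro w
    rw [norm_smul]
    refine mul_le_mul ?_ ?_ (norm_nonneg _) (norm_nonneg _)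
    · refine ((p k).le_opNorm _).trans ?_
      rw [Finset.prod_eq_one, mul_one]
      intro j _
      rw [Pi.norm_single, norm_one]
    · rw [← ContinuousMultilinearMap.mkPiAlgebraFin_apply (R := ℝ)]
      refine (ContinuousMultilinearMap.le_opNorm _ _).trans ?_
      gcongr with j
      · exact ContinuousMultilinearMap.norm_mkPiAlgebraFin_le
      · exact norm_le_pi_norm (M j) (w j)
  refine (norm_sum_le _ _).trans ((Finset.sum_le_sum fun w _ => hw w).trans_eq ?_)
  simp [mul_assoc]

theorem IsExtRadius.le_radius (h : IsExtRadius p δ) : ENNReal.ofReal δ ≤ (algExt p A).radius := by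
  obtain ⟨h0, C, hC⟩ := h
  refine FormalMultilinearSeries.le_radius_of_bound _ (C * max 1 ‖(1 : A)‖) fun k => ?_
  rw [Real.coe_toNNReal _ h0.le]
  calc ‖algExt p A k‖ * δ ^ k ≤ (Fintype.card ι : ℝ) ^ k * ‖p k‖ * max 1 ‖(1 : A)‖ * δ ^ k := by
        gcongr; exact norm_algExt_le A k
    _ = ‖p k‖ * ((Fintype.card ι : ℝ) * δ) ^ k * max 1 ‖(1 : A)‖ := by rw [mul_pow]; ring
    _ ≤ _ := by gcongr; exact hC k

theorem IsExtRadius.hasFPowerSeriesOnBall [CompleteSpace A] (h : IsExtRadius p δ) :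
    HasFPowerSeriesOnBall (algExt p A).sum (algExt p A) 0 (ENNReal.ofReal δ) := by
  have h1 : 0 < ENNReal.ofReal δ := ENNReal.ofReal_pos.2 h.1
  exact ((algExt p A).hasFPowerSeriesOnBall (h1.trans_le (h.le_radius A))).mono h1 (h.le_radius A)

variable {A}

theorem IsExtRadius.hasSum [CompleteSpace A] (h : IsExtRadius p δ) {M : ι → A} (hM : ‖M‖ < δ) :
    HasSum (fun k => algExt p A k fun _ => M) ((algExt p A).sum M) := by
  have := (h.hasFPowerSeriesOnBall A).hasSum (y := M) (by
    rw [Metric.mem_eball, edist_zero_right, ← ofReal_norm, ENNReal.ofReal_lt_ofReal_iff h.1]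
    exact hM)
  simpa using this

theorem IsExtRadius.analyticAt [CompleteSpace A] (h : IsExtRadius p δ) {M : ι → A} (hM : ‖M‖ < δ) :
    AnalyticAt ℝ (algExt p A).sum M := by
  refine (h.hasFPowerSeriesOnBall A).analyticAt_of_mem ?_
  rw [Metric.mem_eball, edist_zero_right, ← ofReal_norm, ENNReal.ofReal_lt_ofReal_iff h.1]
  exact hM

/-- Compatibility of the extensions of a power series with common left eigenvectors. -/
theorem IsExtRadius.map_ext_sum [CompleteSpace A] (h : IsExtRadius p δ) {A' : Type*}
    [NormedCommRing A'] [NormedAlgebra ℝ A'] [CompleteSpace A'] {W : Type*} [NormedAddCommGroup W]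
    [NormedSpace ℝ W] [Module A' W] [IsScalarTower ℝ A' W] [ContinuousSMul A' W]
    (ψ : A →L[ℝ] W) {M : ι → A} {c : ι → A'} (hM : ‖M‖ < δ) (hc : ‖c‖ < δ)
    (hψ : ∀ i a, ψ (M i * a) = c i • ψ a) :
    ψ ((algExt p A).sum M) = (algExt p A').sum c • ψ 1 := by
  classical
  -- Words in `M` are turned by `ψ` into the same words in `c`; the series are then compared term by
  -- term.
  have hlist : ∀ l : List ι, ψ (l.map M).prod = (l.map c).prod • ψ 1 := by
    intro l
    induction l with
    | nil => simp
    | cons i l ih => simp [hψ, ih, mul_smul]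
  have h1 : HasSum (fun k => ψ (algExt p A k fun _ => M)) (ψ ((algExt p A).sum M)) :=
    (h.hasSum hM).mapL ψ
  have h2 : HasSum (fun k => (algExt p A' k fun _ => c) • ψ 1) ((algExt p A').sum c • ψ 1) :=
    (h.hasSum hc).smul_const _
  have h3 : ∀ k, ψ (algExt p A k fun _ => M) = (algExt p A' k fun _ => c) • ψ 1 := by
    intro k
    rw [algExt_apply, algExt_apply, map_sum, Finset.sum_smul]
    refine Finset.sum_congr rfl fun w _ => ?_
    rw [map_smul, smul_assoc]
    congr 1
    have := hlist (List.ofFn w)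
    rw [List.map_ofFn, List.map_ofFn] at this
    exact this
  simp_rw [h3] at h1
  exact h1.unique h2

/-- Every analytic function is the sum of a power series with a good radius. -/
theorem exists_isExtRadius {f : (ι → ℝ) → ℝ} (hf : AnalyticAt ℝ f 0) :
    ∃ (p : FormalMultilinearSeries ℝ (ι → ℝ) ℝ) (δ : ℝ), IsExtRadius p δ ∧
      ∀ x, ‖x‖ < δ → (algExt p ℝ).sum x = f x := by
  classical
  obtain ⟨p, r, hp⟩ := hf
  have hr0 : 0 < p.radius := hp.r_pos.trans_le hp.r_le
  obtain ⟨s, hs0, hs⟩ := ENNReal.lt_iff_exists_nnreal_btwn.1 (lt_min hr0 hp.r_pos)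
  have hs0' : 0 < s := by simpa using hs0
  obtain ⟨C, hC0, hC⟩ := p.norm_le_div_pow_of_pos_of_lt_radius hs0' (hs.trans_le (min_le_left _ _))
  -- The division absorbs the factor `card ι ^ k` from the number of words; adding 1 keeps the
  -- denominator positive when `ι` is empty.
  let δ : ℝ := s / (Fintype.card ι + 1)
  have hcard : (0 : ℝ) < Fintype.card ι + 1 := by positivity
  have hs' : (0 : ℝ) < s := hs0'
  have hδ0 : 0 < δ := by positivity
  have hδs : δ ≤ s := div_le_self hs'.le (by linarith [Nat.cast_nonneg (α := ℝ) (Fintype.card ι)])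
  have hext : IsExtRadius p δ := by
    refine ⟨hδ0, C, fun k => ?_⟩
    have h1 : (Fintype.card ι : ℝ) * δ ≤ s := by
      have : δ * (Fintype.card ι + 1) = s := div_mul_cancel₀ _ hcard.ne'
      nlinarith
    calc ‖p k‖ * ((Fintype.card ι : ℝ) * δ) ^ k ≤ C / s ^ k * s ^ k := by
          gcongr
          exact hC k
      _ = C := div_mul_cancel₀ _ (by positivity)
  refine ⟨p, δ, hext, fun x hx => ?_⟩
  have h1 := hext.hasSum (A := ℝ) hx
  have h2 : HasSum (fun k => p k fun _ => x) (f x) := by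
    have := hp.hasSum (y := x) (by
      rw [Metric.mem_eball, edist_zero_right, enorm_eq_nnnorm]
      refine lt_trans ?_ (hs.trans_le (min_le_right _ _))
      rw [ENNReal.coe_lt_coe, ← NNReal.coe_lt_coe, coe_nnnorm]
      exact hx.trans_le hδs)
    simpa using this
  refine h1.unique ?_
  convert! h2 using 1
  ext k
  rw [algExt_apply]
  -- Expanding every argument in the standard basis turns `p k` into the sum over words that defines
  -- `algExt`.
  have hx' : ∀ j : Fin k, x = ∑ i : ι, x i • (Pi.single i (1 : ℝ) : ι → ℝ) := fun _ =>
    (pi_eq_sum_univ' x).trans (by congr!)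
  conv_rhs => rw [show (fun _ : Fin k => x) = fun j => ∑ i : ι, x i • (Pi.single i (1 : ℝ) : ι → ℝ)
    from funext hx']
  rw [ContinuousMultilinearMap.map_sum]
  refine Finset.sum_congr rfl fun w _ => ?_
  rw [ContinuousMultilinearMap.map_smul_univ, List.prod_ofFn, smul_eq_mul, smul_eq_mul, mul_comm]

end AlgExt

/-! ### Weierstrass polynomials -/

section Shift

/-- Bounded sequences of real numbers. -/
abbrev BddSeq : Type := BoundedContinuousFunction ℕ ℝ

namespace BddSeq

noncomputable def mk (v : ℕ → ℝ) (C : ℝ) (h : ∀ n, ‖v n‖ ≤ C) : BddSeq :=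
  BoundedContinuousFunction.ofNormedAddCommGroupDiscrete v C h

/-- The right shift. -/
noncomputable def shift : BddSeq →L[ℝ] BddSeq :=
  LinearMap.mkContinuous
    { toFun := fun v => mk (fun n => Nat.casesOn n 0 fun k => v k) ‖v‖ fun n => by
        cases n with
        | zero => simp
        | succ k => exact v.norm_coe_le_norm k
      map_add' := fun v w => by
        ext n
        cases n <;> simp [mk]
      map_smul' := fun c v => by
        ext n
        cases n <;> simp [mk] } 1 fun v => by
    rw [one_mul]
    refine (BoundedContinuousFunction.norm_le (norm_nonneg _)).2 fun n => ?_
    cases n with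
    | zero => simp [mk]
    | succ k => exact v.norm_coe_le_norm k

/-- The left shift. -/
noncomputable def drop (v : BddSeq) (d : ℕ) : BddSeq :=
  mk (fun n => v (n + d)) ‖v‖ fun _ => v.norm_coe_le_norm _

@[simp] theorem drop_apply (v : BddSeq) (d n : ℕ) : v.drop d n = v (n + d) := rfl

@[simp] theorem shift_zero (v : BddSeq) : shift v 0 = 0 := rfl

@[simp] theorem shift_succ (v : BddSeq) (n : ℕ) : shift v (n + 1) = v n := rfl

theorem norm_shift_le : ‖shift‖ ≤ 1 := LinearMap.mkContinuous_norm_le _ zero_le_one _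

theorem shift_pow_add (v : BddSeq) (d n : ℕ) : (shift ^ d) v (n + d) = v n := by
  induction d generalizing n with
  | zero => rfl
  | succ d ih =>
    rw [pow_succ', mul_apply_eq_comp, ← add_assoc, shift_succ, ih]

theorem shift_pow_of_lt (v : BddSeq) (d n : ℕ) (h : n < d) : (shift ^ d) v n = 0 := by
  induction d generalizing n with
  | zero => omega
  | succ d ih =>
    rw [pow_succ', mul_apply_eq_comp]
    cases n with
    | zero => rfl
    | succ n => rw [shift_succ, ih n (by omega)]

theorem summable_mul_pow (v : BddSeq) {x : ℝ} (hx : |x| < 1) : Summable fun n => v n * x ^ n := by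
  refine Summable.of_norm_bounded (g := fun n => ‖v‖ * |x| ^ n)
    ((summable_geometric_of_lt_one (abs_nonneg x) hx).mul_left _) fun n => ?_
  rw [norm_mul, norm_pow, Real.norm_eq_abs x]
  gcongr
  exact v.norm_coe_le_norm n

/-- The value at `x` of the power series with a given bounded sequence of coefficients. -/
noncomputable def evalAt (x : ℝ) (hx : |x| < 1) : BddSeq →L[ℝ] ℝ :=
  LinearMap.mkContinuous
    { toFun := fun v => ∑' n, v n * x ^ n
      map_add' := fun v w => by
        rw [← (v.summable_mul_pow hx).tsum_add (w.summable_mul_pow hx)]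
        exact tsum_congr fun n => by simp [add_mul]
      map_smul' := fun c v => by
        simp [mul_assoc, tsum_mul_left] } (1 - |x|)⁻¹ fun v => by
    have h := hasSum_geometric_of_lt_one (abs_nonneg x) hx
    rw [mul_comm]
    refine tsum_of_norm_bounded (h.mul_left ‖v‖) fun n => ?_
    rw [norm_mul, norm_pow, Real.norm_eq_abs x]
    gcongr
    exact v.norm_coe_le_norm n

variable {x : ℝ} (hx : |x| < 1)

theorem evalAt_apply (v : BddSeq) : evalAt x hx v = ∑' n, v n * x ^ n := rfl

theorem norm_evalAt_apply_le (v : BddSeq) : |evalAt x hx v| ≤ (1 - |x|)⁻¹ * ‖v‖ :=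
  (evalAt x hx).le_of_opNorm_le (LinearMap.mkContinuous_norm_le _ (by
    rw [inv_nonneg]; linarith) _) v

theorem evalAt_shift (v : BddSeq) : evalAt x hx (shift v) = x * evalAt x hx v := by
  rw [evalAt_apply, evalAt_apply, ((shift v).summable_mul_pow hx).tsum_eq_zero_add, ← tsum_mul_left]
  simp only [shift_zero, zero_mul, zero_add, shift_succ]
  exact tsum_congr fun n => by ring

theorem evalAt_shift_pow (v : BddSeq) (d : ℕ) :
    evalAt x hx ((shift ^ d) v) = x ^ d * evalAt x hx v := by
  induction d with
  | zero => simp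
  | succ d ih => rw [pow_succ', mul_apply_eq_comp, evalAt_shift, ih]; ring

theorem evalAt_eq_add (v : BddSeq) : evalAt x hx v = v 0 + x * evalAt x hx (v.drop 1) := by
  rw [evalAt_apply, evalAt_apply, (v.summable_mul_pow hx).tsum_eq_zero_add, ← tsum_mul_left]
  simp only [pow_zero, mul_one, drop_apply]
  congr 1
  exact tsum_congr fun n => by ring

/-- Identity theorem for power series: letting `x → 0` gives `v 0 = 0`, and dividing by `x` passes
to the sequence with its first term dropped. This needs only a punctured neighborhood. -/
theorem eq_zero_of_evalAt {v : BddSeq}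
    (h : ∀ᶠ x in 𝓝[≠] (0 : ℝ), ∀ hx : |x| < 1, evalAt x hx v = 0) : v = 0 := by
  have hsmall : ∀ᶠ x in 𝓝[≠] (0 : ℝ), |x| < 1 / 2 := by
    refine eventually_nhdsWithin_of_eventually_nhds ?_
    exact (continuous_abs.tendsto' (0 : ℝ) 0 abs_zero).eventually_lt_const (by norm_num)
  have step : ∀ w : BddSeq, (∀ᶠ x in 𝓝[≠] (0 : ℝ), ∀ hx : |x| < 1, evalAt x hx w = 0) →
      w 0 = 0 := by
    intro w hw
    have hle : ∀ᶠ x in 𝓝[≠] (0 : ℝ), |w 0| ≤ |x| * (2 * ‖w.drop 1‖) := by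
      filter_upwards [hw, hsmall] with x h1 h2
      have hx : |x| < 1 := by linarith
      have h3 := h1 hx
      rw [evalAt_eq_add] at h3
      rw [eq_neg_of_add_eq_zero_left h3, abs_neg, abs_mul]
      gcongr
      refine (norm_evalAt_apply_le hx _).trans ?_
      gcongr
      rw [inv_le_comm₀ (by linarith) (by norm_num)]
      linarith
    have hlim : Tendsto (fun x : ℝ => |x| * (2 * ‖w.drop 1‖)) (𝓝[≠] 0) (𝓝 0) := by
      refine tendsto_nhdsWithin_of_tendsto_nhds ?_
      exact Continuous.tendsto' (by fun_prop) _ _ (by simp)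
    exact abs_eq_zero.1 (le_antisymm (ge_of_tendsto hlim hle) (abs_nonneg _))
  have all : ∀ n, ∀ᶠ x in 𝓝[≠] (0 : ℝ), ∀ hx : |x| < 1, evalAt x hx (v.drop n) = 0 := by
    intro n
    induction n with
    | zero => exact h
    | succ n ih =>
      filter_upwards [ih, self_mem_nhdsWithin] with x h1 h2 hx
      have h3 := h1 hx
      rw [evalAt_eq_add, step _ ih, zero_add] at h3
      have h4 : (v.drop n).drop 1 = v.drop (n + 1) := by
        ext k
        simp [add_assoc, add_comm 1 n]
      exact h4 ▸ (mul_eq_zero.1 h3).resolve_left h2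
  ext n
  simpa using step _ (all n)

theorem eq_of_evalAt {v w : BddSeq}
    (h : ∀ᶠ x in 𝓝[≠] (0 : ℝ), ∀ hx : |x| < 1, evalAt x hx v = evalAt x hx w) : v = w := by
  refine sub_eq_zero.1 (eq_zero_of_evalAt ?_)
  filter_upwards [h] with x h1 hx
  rw [map_sub, h1 hx, sub_self]

/-- Finite sequences as bounded sequences. -/
noncomputable def ofFin (d : ℕ) : (Fin d → ℝ) →L[ℝ] BddSeq :=
  LinearMap.toContinuousLinearMap
    { toFun := fun a => mk (fun n => if h : n < d then a ⟨n, h⟩ else 0) ‖a‖ fun n => by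
        split_ifs with h
        · exact norm_le_pi_norm a _
        · simp
      map_add' := fun a b => by
        ext n
        by_cases h : n < d <;> simp [mk, h]
      map_smul' := fun c a => by
        ext n
        by_cases h : n < d <;> simp [mk, h] }

theorem ofFin_apply {d : ℕ} (a : Fin d → ℝ) (n : ℕ) :
    ofFin d a n = if h : n < d then a ⟨n, h⟩ else 0 := rfl

theorem evalAt_ofFin {d : ℕ} (a : Fin d → ℝ) :
    evalAt x hx (ofFin d a) = ∑ i, a i * x ^ (i : ℕ) := by
  rw [evalAt_apply, tsum_eq_sum (s := Finset.range d), Finset.sum_range]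
  · refine Finset.sum_congr rfl fun i _ => ?_
    simp [ofFin_apply]
  · intro n hn
    simp only [Finset.mem_range] at hn
    simp [ofFin_apply, hn]

/-- The coefficients of the polynomial `1`. -/
noncomputable def single : BddSeq := ofFin 1 fun _ => 1

theorem evalAt_single : evalAt x hx single = 1 := by
  simp [single, evalAt_ofFin]

end BddSeq

end Shift

theorem BddSeq.shift_iterate_add (v : BddSeq) (d n : ℕ) : (⇑shift)^[d] v (n + d) = v n := by
  rw [← pow_apply_eq_iterate, shift_pow_add]

theorem BddSeq.shift_iterate_of_lt (v : BddSeq) (d n : ℕ) (h : n < d) : (⇑shift)^[d] v n = 0 := by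
  rw [← pow_apply_eq_iterate, shift_pow_of_lt v d n h]

section Weierstrass

variable {κ : Type*} [Fintype κ]

/-- The point of `ℝ^(κ + 1)` with given first coordinates and last coordinate. -/
abbrev lastCoord {R : Type*} (x : κ → R) (y : R) : κ ⊕ Unit → R := Sum.elim x fun _ => y

section ShiftTuple

variable {V : Type*} [NormedAddCommGroup V] [NormedSpace ℝ V]

/-- The tuple of operators consisting of scalars and a multiple of a given operator. -/
noncomputable def scalarTuple (S : V →L[ℝ] V) (ρ : ℝ) (x : κ → ℝ) : κ ⊕ Unit → (V →L[ℝ] V) :=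
  Sum.elim (fun i => x i • 1) fun _ => ρ • S

theorem norm_scalarTuple_lt {S : V →L[ℝ] V} (hS : ‖S‖ ≤ 1) {δ ρ : ℝ} (hδ : 0 < δ) {x : κ → ℝ}
    (hx : ‖x‖ < δ) (hρ : |ρ| < δ) : ‖scalarTuple S ρ x‖ < δ := by
  rw [pi_norm_lt_iff hδ] at hx ⊢
  rintro (i | i)
  · have h1 : ‖(1 : V →L[ℝ] V)‖ ≤ 1 := ContinuousLinearMap.norm_id_le
    calc ‖x i • (1 : V →L[ℝ] V)‖ ≤ ‖x i‖ * 1 := by rw [norm_smul]; gcongr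
      _ < δ := by rw [mul_one]; exact hx i
  · calc ‖ρ • S‖ ≤ |ρ| * 1 := by
          rw [norm_smul, Real.norm_eq_abs]; gcongr
      _ < δ := by rw [mul_one]; exact hρ

theorem analyticAt_scalarTuple (S : V →L[ℝ] V) (ρ : ℝ) (x : κ → ℝ) :
    AnalyticAt ℝ (scalarTuple (κ := κ) S ρ) x := by
  rw [analyticAt_pi_iff]
  rintro (i | i)
  · exact ((ContinuousLinearMap.proj (R := ℝ) (φ := fun _ : κ => ℝ) i).analyticAt x).smul
      analyticAt_const
  · exact analyticAt_const

/-- The solutions of an analytic family of linear equations, with an isomorphism at `0`, are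
analytic. -/
theorem exists_analyticAt_solution [CompleteSpace V] {E W : Type*} [NormedAddCommGroup E]
    [NormedSpace ℝ E] [NormedAddCommGroup W] [NormedSpace ℝ W] [CompleteSpace W]
    {F : E → V →L[ℝ] V} (hF : AnalyticAt ℝ F 0) (J : W →L[ℝ] V)
    (hinj : ∀ b a, F 0 b + J a = 0 → b = 0 ∧ a = 0) (hsurj : ∀ v, ∃ b a, F 0 b + J a = v) (w : V) :
    ∃ y : E → V × W, AnalyticAt ℝ y 0 ∧ ∀ᶠ x in 𝓝 0, F x (y x).1 + J (y x).2 = w := by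
  let cmp : (V →L[ℝ] V) →L[ℝ] (V × W →L[ℝ] V) :=
    (ContinuousLinearMap.compL ℝ (V × W) V V).flip (ContinuousLinearMap.fst ℝ V W)
  let L : E → (V × W →L[ℝ] V) := fun x => cmp (F x) + J.comp (ContinuousLinearMap.snd ℝ V W)
  have hLan : AnalyticAt ℝ L 0 := ((cmp.analyticAt _).comp hF).add analyticAt_const
  have hk : (L 0 : V × W →ₗ[ℝ] V).ker = ⊥ := by
    rw [LinearMap.ker_eq_bot']
    rintro ⟨b, a⟩ hba
    obtain ⟨rfl, rfl⟩ := hinj b a hba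
    rfl
  have hr : (L 0 : V × W →ₗ[ℝ] V).range = ⊤ := by
    rw [LinearMap.range_eq_top]
    intro v
    obtain ⟨b, a, h⟩ := hsurj v
    exact ⟨(b, a), h⟩
  let e := ContinuousLinearEquiv.ofBijective (L 0) hk hr
  -- Normalizing by the inverse of `L 0` gives endomorphisms equal to 1 at the origin, where
  -- inversion in the Banach algebra is analytic.
  let G : E → (V →L[ℝ] V) := fun x => (L x).comp (e.symm : V →L[ℝ] V × W)
  have hG : AnalyticAt ℝ G 0 :=
    (((ContinuousLinearMap.compL ℝ V (V × W) V).flip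
      (e.symm : V →L[ℝ] V × W)).analyticAt _).comp hLan
  have hG0 : G 0 = 1 := ContinuousLinearMap.ext fun v => e.apply_symm_apply v
  have hinv : AnalyticAt ℝ (fun x => Ring.inverse (G x)) 0 := by
    refine AnalyticAt.fun_comp (g := Ring.inverse) ?_ hG
    rw [hG0]
    exact analyticAt_inverse (1 : (V →L[ℝ] V)ˣ)
  have hunit : ∀ᶠ x in 𝓝 0, IsUnit (G x) := by
    refine hG.continuousAt.eventually (Units.isOpen.mem_nhds ?_)
    rw [hG0]; exact isUnit_one
  refine ⟨fun x => e.symm (Ring.inverse (G x) w), ((e.symm : V →L[ℝ] V × W).analyticAt _).comp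
    (((ContinuousLinearMap.apply ℝ V w).analyticAt _).comp hinv), ?_⟩
  filter_upwards [hunit] with x hx
  change (G x * Ring.inverse (G x)) w = w
  rw [Ring.mul_inverse_cancel _ hx, one_apply_eq_self]

end ShiftTuple

theorem norm_lastCoord_lt {δ : ℝ} (hδ : 0 < δ) {x : κ → ℝ} {y : ℝ} (hx : ‖x‖ < δ) (hy : |y| < δ) :
    ‖lastCoord x y‖ < δ := by
  rw [pi_norm_lt_iff hδ] at hx ⊢
  rintro (i | i)
  · exact hx i
  · exact hy

variable {p : FormalMultilinearSeries ℝ (κ ⊕ Unit → ℝ) ℝ} {δ ρ : ℝ}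

/-- Evaluation at `y` turns the operators of the tuple into the scalars `x i` and `ρ * y`. So the
operator built from the series is multiplication by the function `X ↦ f (x, ρ X)` on power series in
`X`. -/
theorem IsExtRadius.evalAt_sum_scalarTuple (h : IsExtRadius p δ) {x : κ → ℝ} (hx : ‖x‖ < δ)
    (hρ : |ρ| < δ) {y : ℝ} (hy : |y| < 1) (v : BddSeq) :
    BddSeq.evalAt y hy ((algExt p (BddSeq →L[ℝ] BddSeq)).sum (scalarTuple BddSeq.shift ρ x) v) =
      (algExt p ℝ).sum (lastCoord x (ρ * y)) * BddSeq.evalAt y hy v := by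
  have hρy : |ρ * y| < δ := by
    rw [abs_mul]
    exact (mul_le_of_le_one_right (abs_nonneg _) hy.le).trans_lt hρ
  have := h.map_ext_sum (A := BddSeq →L[ℝ] BddSeq) (A' := ℝ) (W := ℝ)
    ((BddSeq.evalAt y hy).comp (ContinuousLinearMap.apply ℝ BddSeq v))
    (norm_scalarTuple_lt BddSeq.norm_shift_le h.1 hx hρ) (norm_lastCoord_lt h.1 hx hρy) ?_
  · simpa using this
  · rintro (i | i) a
    · simp [scalarTuple, lastCoord]
    · simp [scalarTuple, lastCoord, BddSeq.evalAt_shift, mul_assoc]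

omit [Fintype κ] in
theorem tendsto_lastCoord_zero : Tendsto (fun y : ℝ => lastCoord (0 : κ → ℝ) y) (𝓝 0) (𝓝 0) := by
  refine Continuous.tendsto' ?_ _ _ ?_
  · refine continuous_pi ?_
    rintro (i | i)
    · exact continuous_const
    · exact continuous_id
  · ext (i | i) <;> rfl

theorem analyticAt_comp_lastCoord {f : (κ ⊕ Unit → ℝ) → ℝ} (hf : AnalyticAt ℝ f 0) :
    AnalyticAt ℝ (fun y : ℝ => f (lastCoord 0 y)) 0 := by
  have h0 : lastCoord (0 : κ → ℝ) (0 : ℝ) = 0 := by ext (i | i) <;> rfl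
  refine AnalyticAt.fun_comp (h0.symm ▸ hf) ?_
  rw [analyticAt_pi_iff]
  rintro (i | i)
  · exact analyticAt_const
  · exact analyticAt_id

/-- The factor `x ^ d * q x` acts on bounded sequences through a power of the shift and a unit. -/
theorem exists_unit_of_eventuallyEq (h : IsExtRadius p δ) {d : ℕ} {q : ℝ → ℝ} (hq : AnalyticAt ℝ q 0)
    (hq0 : q 0 ≠ 0)
    (hf : ∀ᶠ y in 𝓝 (0 : ℝ), (algExt p ℝ).sum (lastCoord 0 y) = y ^ d * q y) :
    ∃ ρ, 0 < ρ ∧ ρ < δ ∧ ∃ Q : (BddSeq →L[ℝ] BddSeq)ˣ,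
      (algExt p (BddSeq →L[ℝ] BddSeq)).sum (scalarTuple BddSeq.shift ρ 0) =
        ρ ^ d • (BddSeq.shift ^ d * (Q : BddSeq →L[ℝ] BddSeq)) := by
  have han : ∀ {q : ℝ → ℝ}, AnalyticAt ℝ q 0 →
      AnalyticAt ℝ (fun z : Empty ⊕ Unit → ℝ => q (z (Sum.inr ()))) 0 := fun hq =>
    AnalyticAt.fun_comp (f := fun z : Empty ⊕ Unit → ℝ => z (Sum.inr ())) hq
      ((ContinuousLinearMap.proj (R := ℝ) (φ := fun _ : Empty ⊕ Unit => ℝ) (Sum.inr ())).analyticAt 0)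
  -- Both `q` and its inverse define multiplication operators. They are inverse to each other
  -- because they are so after evaluation at all small `y ≠ 0`.
  obtain ⟨p₁, δ₁, h₁, hp₁⟩ := exists_isExtRadius (han hq)
  obtain ⟨p₂, δ₂, h₂, hp₂⟩ := exists_isExtRadius (han (hq.inv hq0))
  obtain ⟨ρ, hρ0, hρ⟩ := exists_between (lt_min h.1 (lt_min h₁.1 h₂.1))
  have hρδ : ρ < δ := hρ.trans_le (min_le_left _ _)
  have hρ₁ : ρ < δ₁ := hρ.trans_le ((min_le_right _ _).trans (min_le_left _ _))
  have hρ₂ : ρ < δ₂ := hρ.trans_le ((min_le_right _ _).trans (min_le_right _ _))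
  have habs : |ρ| = ρ := abs_of_pos hρ0
  have key : ∀ {p : FormalMultilinearSeries ℝ (Empty ⊕ Unit → ℝ) ℝ} {δ : ℝ} {q : ℝ → ℝ},
      IsExtRadius p δ → ρ < δ → (∀ x, ‖x‖ < δ → (algExt p ℝ).sum x = q (x (Sum.inr ()))) →
      ∀ (v : BddSeq) (y : ℝ) (hy : |y| < 1), BddSeq.evalAt y hy
        ((algExt p (BddSeq →L[ℝ] BddSeq)).sum (scalarTuple BddSeq.shift ρ 0) v) = q (ρ * y) * BddSeq.evalAt y hy v := by
    intro p δ q h hρ hp v y hy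
    have h0 : ‖(0 : Empty → ℝ)‖ < δ := by simpa using h.1
    rw [h.evalAt_sum_scalarTuple h0 (by rwa [habs]) hy, hp]
    · rfl
    · refine norm_lastCoord_lt h.1 h0 ?_
      rw [abs_mul, habs]
      exact (mul_le_of_le_one_right hρ0.le hy.le).trans_lt hρ
  have k₁ := key h₁ hρ₁ hp₁
  have k₂ := key h₂ hρ₂ (q := fun y => (q y)⁻¹) hp₂
  have hmul : Tendsto (fun y : ℝ => ρ * y) (𝓝[≠] 0) (𝓝 0) :=
    tendsto_nhdsWithin_of_tendsto_nhds (Continuous.tendsto' (by fun_prop) _ _ (by simp))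
  have hne : ∀ᶠ y in 𝓝[≠] (0 : ℝ), q (ρ * y) ≠ 0 :=
    hmul.eventually (hq.continuousAt.eventually_ne hq0)
  have hf' := hmul.eventually hf
  refine ⟨ρ, hρ0, hρδ, ⟨(algExt p₁ (BddSeq →L[ℝ] BddSeq)).sum (scalarTuple BddSeq.shift ρ 0),
    (algExt p₂ (BddSeq →L[ℝ] BddSeq)).sum (scalarTuple BddSeq.shift ρ 0), ?_, ?_⟩, ?_⟩
  · refine ContinuousLinearMap.ext fun v => BddSeq.eq_of_evalAt ?_
    filter_upwards [hne] with y hy hy1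
    rw [mul_apply_eq_comp, k₁, k₂, ← mul_assoc, mul_inv_cancel₀ hy, one_mul, one_apply_eq_self]
  · refine ContinuousLinearMap.ext fun v => BddSeq.eq_of_evalAt ?_
    filter_upwards [hne] with y hy hy1
    rw [mul_apply_eq_comp, k₂, k₁, ← mul_assoc, inv_mul_cancel₀ hy, one_mul, one_apply_eq_self]
  · refine ContinuousLinearMap.ext fun v => BddSeq.eq_of_evalAt ?_
    filter_upwards [hf'] with y hy hy1
    rw [h.evalAt_sum_scalarTuple (by simpa using h.1) (by rwa [habs]), hy]
    simp only [smul_apply, mul_apply_eq_comp, map_smul, BddSeq.evalAt_shift_pow,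
      k₁, smul_eq_mul]
    ring

/-- A real analytic function that does not vanish identically on the last coordinate axis vanishes
only at zeros of a Weierstrass polynomial. -/
theorem exists_weierstrassPolynomial {f : (κ ⊕ Unit → ℝ) → ℝ} (hf : AnalyticAt ℝ f 0)
    (hne : ¬ ∀ᶠ y in 𝓝 (0 : ℝ), f (lastCoord 0 y) = 0) :
    ∃ (d : ℕ) (a : Fin d → (κ → ℝ) → ℝ), (∀ l, AnalyticAt ℝ (a l) 0) ∧ (∀ l, a l 0 = 0) ∧
      ∀ᶠ z in 𝓝 (0 : κ ⊕ Unit → ℝ), f z = 0 →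
        z (Sum.inr ()) ^ d + ∑ l, a l (z ∘ Sum.inl) * z (Sum.inr ()) ^ (l : ℕ) = 0 := by
  obtain ⟨p, δ, h, hp⟩ := exists_isExtRadius hf
  obtain ⟨d, q, hq, hq0, hfq⟩ :=
    (analyticAt_comp_lastCoord hf).exists_eventuallyEq_pow_smul_nonzero_iff.2 hne
  have hfq' : ∀ᶠ y in 𝓝 (0 : ℝ), (algExt p ℝ).sum (lastCoord 0 y) = y ^ d * q y := by
    have h1 : ∀ᶠ y : ℝ in 𝓝 0, ‖lastCoord (0 : κ → ℝ) y‖ < δ :=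
      tendsto_lastCoord_zero.norm.eventually_lt_const (by simpa using h.1)
    filter_upwards [hfq, h1] with y hy hy1
    rw [hp _ hy1, hy, sub_zero, smul_eq_mul]
  obtain ⟨ρ, hρ0, hρδ, Q, hQ⟩ := exists_unit_of_eventuallyEq h hq hq0 hfq'
  let A := BddSeq →L[ℝ] BddSeq
  let F : (κ → ℝ) → A := fun x => (algExt p A).sum (scalarTuple BddSeq.shift ρ x)
  have habs : |ρ| < δ := by rwa [abs_of_pos hρ0]
  have hF : AnalyticAt ℝ F 0 :=
    (h.analyticAt (norm_scalarTuple_lt BddSeq.norm_shift_le h.1 (by simpa using h.1) habs)).comp (analyticAt_scalarTuple _ ρ 0)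
  have hF0 : ∀ b, F 0 b = ρ ^ d • (BddSeq.shift ^ d) (Q.val b) := fun b => by
    simp only [F, A, hQ]; rfl
  have hρd : ρ ^ d ≠ 0 := pow_ne_zero _ hρ0.ne'
  have hQQ : ∀ v, Q.val (Q.inv v) = v := fun v => by
    rw [← mul_apply_eq_comp, Q.val_inv, one_apply_eq_self]
  have hQQ' : ∀ v, Q.inv (Q.val v) = v := fun v => by
    rw [← mul_apply_eq_comp, Q.inv_val, one_apply_eq_self]
  -- Weierstrass division at the origin: up to a unit, `F 0` is the `d`-th power of the shift, which
  -- fills the coefficients from `d` on, while the remainder fills the first `d`.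
  have hinj : ∀ b a, F 0 b + BddSeq.ofFin d a = 0 → b = 0 ∧ a = 0 := by
    intro b a hba
    rw [hF0] at hba
    have ha : a = 0 := by
      ext i
      have := DFunLike.congr_fun hba (i : ℕ)
      simpa [BddSeq.shift_iterate_of_lt _ d i i.2, BddSeq.ofFin_apply] using this
    subst ha
    have hb : Q.val b = 0 := by
      ext n
      have := DFunLike.congr_fun hba (n + d)
      simpa [BddSeq.shift_iterate_add, hρ0.ne'] using this
    exact ⟨by rw [← hQQ' b, hb, map_zero], rfl⟩
  have hsurj : ∀ w, ∃ b a, F 0 b + BddSeq.ofFin d a = w := by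
    intro w
    refine ⟨(ρ ^ d)⁻¹ • Q.inv (w.drop d), fun i => w i, ?_⟩
    rw [hF0]
    ext n
    rw [map_smul, hQQ, map_smul, smul_smul, mul_inv_cancel₀ hρd, one_smul]
    by_cases hn : n < d
    · simp [BddSeq.shift_iterate_of_lt _ d n hn, BddSeq.ofFin_apply, hn]
    · obtain ⟨m, rfl⟩ := Nat.exists_eq_add_of_le' (not_lt.1 hn)
      simp [BddSeq.shift_iterate_add, BddSeq.ofFin_apply]
  -- Division of `X ^ d` by `f (x, ρ X)` for all `x` near 0. On the zero set of `f` only the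
  -- remainder survives, so `X ^ d` equals a polynomial of lower degree there.
  obtain ⟨y, hy, hLy⟩ := exists_analyticAt_solution hF (BddSeq.ofFin d) hinj hsurj
    ((BddSeq.shift ^ d) BddSeq.single)
  have hy0 : (y 0).2 = 0 := by
    have h1 := hLy.self_of_nhds
    refine (hinj ((y 0).1 - (ρ ^ d)⁻¹ • Q.inv BddSeq.single) (y 0).2 ?_).2
    rw [map_sub, sub_add_eq_add_sub, h1, hF0, map_smul, hQQ, map_smul, smul_smul,
      mul_inv_cancel₀ hρd, one_smul, sub_self]
  -- The powers of `ρ` undo the scaling of the last coordinate by `X = z / ρ`.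
  refine ⟨d, fun l x => -(y x).2 l * ρ ^ d / ρ ^ (l : ℕ), fun l => ?_, fun l => by simp [hy0], ?_⟩
  · have h1 : AnalyticAt ℝ (fun x => (y x).2 l) 0 :=
      (((ContinuousLinearMap.proj (R := ℝ) (φ := fun _ : Fin d => ℝ) l).comp
        (ContinuousLinearMap.snd ℝ BddSeq (Fin d → ℝ))).analyticAt _).comp hy
    exact (h1.neg.mul analyticAt_const).div_const
  · have hinl : Tendsto (fun z : κ ⊕ Unit → ℝ => z ∘ Sum.inl) (𝓝 0) (𝓝 0) :=
      Continuous.tendsto' (by fun_prop) _ _ rfl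
    have hsm : ∀ᶠ z in 𝓝 (0 : κ ⊕ Unit → ℝ), ‖z‖ < min δ ρ :=
      (continuous_norm.tendsto' _ _ norm_zero).eventually_lt_const (lt_min h.1 hρ0)
    filter_upwards [hinl.eventually hLy, hsm] with z hz hzs hfz
    have hzδ : ‖z‖ < δ := hzs.trans_le (min_le_left _ _)
    have hzρ : |z (Sum.inr ())| < ρ := (norm_le_pi_norm z _).trans_lt (hzs.trans_le (min_le_right _ _))
    have hX : |z (Sum.inr ()) / ρ| < 1 := by
      rw [abs_div, abs_of_pos hρ0, div_lt_one hρ0]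
      exact hzρ
    have hxδ : ‖z ∘ Sum.inl‖ < δ :=
      (pi_norm_lt_iff h.1).2 fun i => (norm_le_pi_norm z _).trans_lt hzδ
    have h1 := congrArg (BddSeq.evalAt _ hX) hz
    rw [map_add, h.evalAt_sum_scalarTuple hxδ habs,
      mul_div_cancel₀ _ hρ0.ne', BddSeq.evalAt_ofFin, BddSeq.evalAt_shift_pow,
      BddSeq.evalAt_single, mul_one] at h1
    have h2 : lastCoord (z ∘ Sum.inl) (z (Sum.inr ())) = z := by
      ext (i | i) <;> rfl
    rw [h2, hp z hzδ, hfz, zero_mul, zero_add] at h1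
    have h3 : z (Sum.inr ()) ^ d = ρ ^ d * (z (Sum.inr ()) / ρ) ^ d := by
      rw [div_pow, mul_div_cancel₀ _ hρd]
    rw [h3, ← h1, Finset.mul_sum, ← Finset.sum_add_distrib]
    refine Finset.sum_eq_zero fun l _ => ?_
    rw [div_pow]
    ring

end Weierstrass

/-! ### The norm matrix -/

section CoordOp

variable {ν m : Type*} [Fintype ν] [DecidableEq ν] [Fintype m]

/-- The action of a matrix on the `i`-th index of a tensor. -/
noncomputable def coordOp (i : ν) :
    (m → m → ℝ) →ₗ[ℝ] (((ν → m) → ℝ) →L[ℝ] ((ν → m) → ℝ)) where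
  toFun C := LinearMap.toContinuousLinearMap
    { toFun := fun v K => ∑ k, C (K i) k * v (Function.update K i k)
      map_add' := fun v w => by ext K; simp [mul_add, Finset.sum_add_distrib]
      map_smul' := fun c v => by ext K; simp [Finset.mul_sum, mul_left_comm] }
  map_add' C D := by ext v K; simp [add_mul, Finset.sum_add_distrib]
  map_smul' c C := by ext v K; simp [Finset.mul_sum, mul_assoc]

theorem coordOp_apply (i : ν) (C : m → m → ℝ) (v : (ν → m) → ℝ) (K : ν → m) :
    coordOp i C v K = ∑ k, C (K i) k * v (Function.update K i k) := rfl

theorem norm_coordOp_le (i : ν) {C : m → m → ℝ} {c : ℝ} (hc : 0 ≤ c) (h : ∀ r, ∑ k, |C r k| ≤ c) :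
    ‖coordOp i C‖ ≤ c := by
  refine ContinuousLinearMap.opNorm_le_bound _ hc fun v =>
    (pi_norm_le_iff_of_nonneg (by positivity)).2 fun K => ?_
  rw [coordOp_apply]
  calc ‖∑ k, C (K i) k * v (Function.update K i k)‖
      ≤ ∑ k, ‖C (K i) k * v (Function.update K i k)‖ := norm_sum_le _ _
    _ ≤ ∑ k, |C (K i) k| * ‖v‖ := by
        refine Finset.sum_le_sum fun k _ => ?_
        rw [norm_mul, Real.norm_eq_abs]
        gcongr
        exact norm_le_pi_norm v _
    _ ≤ c * ‖v‖ := by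
        rw [← Finset.sum_mul]
        gcongr
        exact h _

/-- The linear functional with coefficients a product of functions of the indices. -/
noncomputable def tensorFunctional (y : ν → m → ℂ) : ((ν → m) → ℝ) →L[ℝ] ℂ :=
  LinearMap.toContinuousLinearMap
    { toFun := fun v => ∑ K, (v K : ℂ) * ∏ j, y j (K j)
      map_add' := fun v w => by simp [add_mul, Finset.sum_add_distrib]
      map_smul' := fun c v => by simp [Finset.mul_sum, mul_assoc] }

omit [DecidableEq ν] in
theorem tensorFunctional_apply [DecidableEq ν] (y : ν → m → ℂ) (v : (ν → m) → ℝ) :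
    tensorFunctional y v = ∑ K, (v K : ℂ) * ∏ j, y j (K j) := rfl

/-- Exchanging `K i` with the summation index is an involution on pairs. It moves `C` to the `i`-th
factor of the functional, where `y i` is a left eigenvector. -/
theorem tensorFunctional_coordOp (i : ν) {C : m → m → ℝ} {y : ν → m → ℂ} {c : ℂ}
    (h : ∀ k, ∑ r, y i r * C r k = c * y i k) (v : (ν → m) → ℝ) :
    tensorFunctional y (coordOp i C v) = c * tensorFunctional y v := by
  have hw : ∀ (K : ν → m) r, ∏ j, y j (Function.update K i r j) =
      y i r * ∏ j ∈ Finset.univ.erase i, y j (K j) := by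
    intro K r
    rw [← Finset.mul_prod_erase _ _ (Finset.mem_univ i), Function.update_self]
    congr 1
    refine Finset.prod_congr rfl fun j hj => ?_
    rw [Function.update_of_ne (Finset.ne_of_mem_erase hj)]
  have hw' : ∀ (K : ν → m), ∏ j, y j (K j) =
      y i (K i) * ∏ j ∈ Finset.univ.erase i, y j (K j) := fun K =>
    (Finset.mul_prod_erase _ _ (Finset.mem_univ i)).symm
  let e : (ν → m) × m ≃ (ν → m) × m :=
    { toFun := fun q => (Function.update q.1 i q.2, q.1 i)
      invFun := fun q => (Function.update q.1 i q.2, q.1 i)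
      left_inv := fun q => by simp
      right_inv := fun q => by simp }
  calc tensorFunctional y (coordOp i C v)
      = ∑ q : (ν → m) × m, (C (q.1 i) q.2 * v (Function.update q.1 i q.2) : ℂ) *
          ∏ j, y j (q.1 j) := by
        rw [tensorFunctional_apply, Fintype.sum_prod_type]
        refine Finset.sum_congr rfl fun K _ => ?_
        rw [coordOp_apply, Complex.ofReal_sum, Finset.sum_mul]
        simp
    _ = ∑ q : (ν → m) × m, (C q.2 (q.1 i) * v q.1 : ℂ) *
          ∏ j, y j (Function.update q.1 i q.2 j) := by
        rw [← e.sum_comp]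
        refine Finset.sum_congr rfl fun q _ => ?_
        simp [e]
    _ = c * tensorFunctional y v := by
        rw [tensorFunctional_apply, Fintype.sum_prod_type, Finset.mul_sum]
        refine Finset.sum_congr rfl fun K _ => ?_
        simp only [hw, hw']
        have := congrArg (fun s => (v K : ℂ) * (∏ j ∈ Finset.univ.erase i, y j (K j)) * s) (h (K i))
        simp only [Finset.mul_sum] at this
        rw [← sub_eq_zero] at this ⊢
        rw [← this]
        congr 1
        · exact Finset.sum_congr rfl fun r _ => by ring
        · ring

end CoordOp

section Companion

/-- A rescaled companion matrix of a monic polynomial. -/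
noncomputable def companion {d : ℕ} (ρ : ℝ) (a : Fin (d + 1) → ℝ) (r k : Fin (d + 1)) : ℝ :=
  (if (r : ℕ) = k + 1 then ρ else 0) - if k = Fin.last d then a r * (ρ ^ (r : ℕ) / ρ ^ d) else 0

/-- The powers of `z / ρ` form a left eigenvector: the subdiagonal raises the exponent by one, and
the last column replaces `z ^ (d + 1)` by means of the equation of `z`. -/
theorem sum_pow_mul_companion {d : ℕ} {ρ : ℝ} (hρ : ρ ≠ 0) {a : Fin (d + 1) → ℝ} {z : ℂ}
    (hz : z ^ (d + 1) + ∑ l, (a l : ℂ) * z ^ (l : ℕ) = 0) (k : Fin (d + 1)) :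
    ∑ r : Fin (d + 1), (z / ρ) ^ (r : ℕ) * companion ρ a r k = z * (z / ρ) ^ (k : ℕ) := by
  have hρ' : (ρ : ℂ) ≠ 0 := by exact_mod_cast hρ
  simp only [companion, Complex.ofReal_sub, mul_sub, Finset.sum_sub_distrib]
  induction k using Fin.lastCases with
  | last =>
    rw [Finset.sum_eq_zero, zero_sub]
    · simp only [if_true, Complex.ofReal_mul, Complex.ofReal_div, Complex.ofReal_pow, Fin.val_last]
      have h1 : ∀ r : Fin (d + 1), (z / ρ) ^ (r : ℕ) * (a r * ((ρ : ℂ) ^ (r : ℕ) / (ρ : ℂ) ^ d)) =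
          a r * z ^ (r : ℕ) / (ρ : ℂ) ^ d := fun r => by
        rw [div_pow]
        field_simp
      simp only [h1]
      rw [← Finset.sum_div, eq_neg_of_add_eq_zero_right hz, div_pow]
      ring
    · intro r _
      rw [if_neg (by simpa using (Nat.ne_of_lt r.2)), Complex.ofReal_zero, mul_zero]
  | cast k =>
    rw [Finset.sum_eq_single k.succ]
    · simp [Fin.castSucc_ne_last, pow_succ]
      field_simp
    · intro r _ hr
      rw [if_neg (fun h => hr (Fin.ext (by simpa using h))), Complex.ofReal_zero, mul_zero]
    · simp

/-- The purpose of the rescaling: the subdiagonal entries become `ρ` instead of 1, so for small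
coefficients the matrix lies within a small radius of convergence. -/
theorem sum_abs_companion_le {d : ℕ} {ρ : ℝ} (hρ : 0 < ρ) (a : Fin (d + 1) → ℝ) (r : Fin (d + 1)) :
    ∑ k, |companion ρ a r k| ≤ ρ + |a r| * (ρ ^ (r : ℕ) / ρ ^ d) := by
  calc ∑ k, |companion ρ a r k|
      ≤ ∑ k : Fin (d + 1), ((if (r : ℕ) = k + 1 then ρ else 0) +
          if k = Fin.last d then |a r| * (ρ ^ (r : ℕ) / ρ ^ d) else 0) := by
        refine Finset.sum_le_sum fun k _ => (abs_sub _ _).trans ?_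
        refine add_le_add ?_ ?_
        · split_ifs
          · exact (abs_of_pos hρ).le
          · exact abs_zero.le
        · split_ifs
          · rw [abs_mul, abs_of_nonneg (a := ρ ^ (r : ℕ) / ρ ^ d) (by positivity)]
          · exact abs_zero.le
    _ ≤ _ := by
        rw [Finset.sum_add_distrib, Finset.sum_ite_eq']
        simp only [Finset.mem_univ, if_true]
        gcongr
        induction r using Fin.cases with
        | zero => simp [hρ.le]
        | succ r =>
          rw [Finset.sum_eq_single r.castSucc]
          · simp
          · intro k _ hk
            exact if_neg fun h => hk (Fin.ext (by simpa using h.symm))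
          · simp

end Companion

section NormMatrix

open Polynomial in
/-- The monic polynomial with given lower coefficients. -/
noncomputable def monicPoly {R : Type*} [CommRing R] {d : ℕ} (c : Fin d → R) : R[X] :=
  X ^ d + ∑ l, C (c l) * X ^ (l : ℕ)

theorem aeval_monicPoly {R A : Type*} [CommRing R] [CommRing A] [Algebra R A] {d : ℕ} (c : Fin d → R)
    (z : A) : Polynomial.aeval z (monicPoly c) =
      z ^ d + ∑ l, algebraMap R A (c l) * z ^ (l : ℕ) := by
  simp [monicPoly]

variable {κ ν : Type*} [Fintype κ] [Fintype ν] {d : ℕ} {a : Fin (d + 1) → (κ → ℝ) → ℝ}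

omit [Fintype κ] in
-- A root with `δ ≤ ‖z‖` would satisfy `‖z‖ ^ (d + 1) ≤ ‖z‖ ^ (d + 1) * c`, where `c` is a weighted
-- sum of the coefficients that tends to 0 with `x`.
theorem eventually_forall_root_norm_lt (ha : ∀ l, ContinuousAt (a l) 0) (ha0 : ∀ l, a l 0 = 0)
    {δ : ℝ} (hδ : 0 < δ) : ∀ᶠ x in 𝓝 0, ∀ z : ℂ,
      Polynomial.aeval z (monicPoly fun l => a l x) = 0 → ‖z‖ < δ := by
  have h1 : Tendsto (fun x => ∑ l, |a l x| / δ ^ (d + 1 - l : ℕ)) (𝓝 0) (𝓝 0) := by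
    have : Tendsto (fun x => ∑ l, |a l x| / δ ^ (d + 1 - l : ℕ)) (𝓝 0)
        (𝓝 (∑ l, |a l 0| / δ ^ (d + 1 - l : ℕ))) :=
      tendsto_finsetSum _ fun l _ => ((ha l).tendsto.abs).div_const _
    simpa [ha0] using this
  filter_upwards [h1.eventually_lt_const one_pos] with x hx z hz
  by_contra! hlt
  rw [aeval_monicPoly] at hz
  have hz0 : 0 < ‖z‖ := hδ.trans_le hlt
  have h2 : ‖z‖ ^ (d + 1) ≤ ‖z‖ ^ (d + 1) * ∑ l, |a l x| / δ ^ (d + 1 - l : ℕ) := by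
    calc ‖z‖ ^ (d + 1) = ‖∑ l, algebraMap ℝ ℂ (a l x) * z ^ (l : ℕ)‖ := by
          rw [← norm_pow, eq_neg_of_add_eq_zero_left hz, norm_neg]
      _ ≤ ∑ l, ‖algebraMap ℝ ℂ (a l x) * z ^ (l : ℕ)‖ := norm_sum_le _ _
      _ ≤ ∑ l, ‖z‖ ^ (d + 1) * (|a l x| / δ ^ (d + 1 - l : ℕ)) := by
          refine Finset.sum_le_sum fun l _ => ?_
          have h3 : ‖z‖ ^ (d + 1) = ‖z‖ ^ (d + 1 - l : ℕ) * ‖z‖ ^ (l : ℕ) := by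
            rw [← pow_add]; congr 1; omega
          have h4 : 1 ≤ ‖z‖ ^ (d + 1 - l : ℕ) / δ ^ (d + 1 - l : ℕ) := by
            rw [one_le_div (by positivity)]; gcongr
          rw [norm_mul, norm_algebraMap', Real.norm_eq_abs, norm_pow, h3]
          calc |a l x| * ‖z‖ ^ (l : ℕ) = |a l x| * ‖z‖ ^ (l : ℕ) * 1 := (mul_one _).symm
            _ ≤ |a l x| * ‖z‖ ^ (l : ℕ) * (‖z‖ ^ (d + 1 - l : ℕ) / δ ^ (d + 1 - l : ℕ)) := by gcongr
            _ = _ := by ring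
      _ = _ := by rw [Finset.mul_sum]
  have h5 : 0 < ‖z‖ ^ (d + 1) := by positivity
  nlinarith

/-- Analytic functions act on the algebra obtained by adjoining roots of a Weierstrass polynomial
through an analytic matrix, whose eigenvalues are the values at these roots. -/
theorem exists_normMatrix [DecidableEq ν] {h : (κ ⊕ ν → ℝ) → ℝ} (hh : AnalyticAt ℝ h 0)
    (ha : ∀ l, AnalyticAt ℝ (a l) 0) (ha0 : ∀ l, a l 0 = 0) :
    ∃ (A : (κ → ℝ) → Matrix (ν → Fin (d + 1)) (ν → Fin (d + 1)) ℝ) (ρ : ℝ)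
      (H : (κ → ℝ) → (ν → ℂ) → ℂ), 0 < ρ ∧ (∀ J K, AnalyticAt ℝ (fun x => A x J K) 0) ∧
      (∀ᶠ z in 𝓝 (0 : κ ⊕ ν → ℝ),
        H (z ∘ Sum.inl) (fun i => (z (Sum.inr i) : ℂ)) = h z) ∧
      ∀ᶠ x in 𝓝 0, ∀ z : ν → ℂ,
        (∀ i, Polynomial.aeval (z i) (monicPoly fun l => a l x) = 0) →
        H x (fun i => starRingEnd ℂ (z i)) = starRingEnd ℂ (H x z) ∧
        ∀ K, ∑ J, (∏ i, (z i / ρ) ^ (J i : ℕ)) * (A x J K : ℂ) =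
          H x z * ∏ i, (z i / ρ) ^ (K i : ℕ) := by
  obtain ⟨p, δ, hr, hp⟩ := exists_isExtRadius hh
  have hδ := hr.1
  -- Near the origin the companion operators then have norm at most `ρ + ρ / 2`, which is less than
  -- `δ`.
  set ρ : ℝ := δ / 2 with hρ
  have hρ0 : 0 < ρ := by positivity
  let V := (ν → Fin (d + 1)) → ℝ
  let M : (κ → ℝ) → κ ⊕ ν → (V →L[ℝ] V) := fun x =>
    Sum.elim (fun i => x i • 1) fun i => coordOp i (companion ρ fun l => a l x)
  let vec : (κ → ℝ) → (ν → ℂ) → κ ⊕ ν → ℂ := fun x z => Sum.elim (fun i => (x i : ℂ)) z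
  have hnorm : ∀ᶠ x : κ → ℝ in 𝓝 0, ‖x‖ < δ :=
    (continuous_norm.tendsto' _ _ norm_zero).eventually_lt_const hδ
  have hM : ∀ᶠ x in 𝓝 0, ‖M x‖ < δ := by
    have hsmall : ∀ᶠ x in 𝓝 0, ∀ l, |a l x| * (ρ ^ (l : ℕ) / ρ ^ d) ≤ ρ / 2 := by
      refine eventually_all.2 fun l => ?_
      have : Tendsto (fun x => |a l x| * (ρ ^ (l : ℕ) / ρ ^ d)) (𝓝 0)
          (𝓝 (|a l 0| * (ρ ^ (l : ℕ) / ρ ^ d))) := (ha l).continuousAt.tendsto.abs.mul_const _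
      rw [ha0, abs_zero, zero_mul] at this
      exact this.eventually_le_const (by positivity)
    filter_upwards [hnorm, hsmall] with x hx hs
    rw [pi_norm_lt_iff hδ] at hx ⊢
    rintro (i | i)
    · calc ‖x i • (1 : V →L[ℝ] V)‖ ≤ ‖x i‖ * 1 := by
            rw [norm_smul]; gcongr; exact ContinuousLinearMap.norm_id_le
        _ < δ := by rw [mul_one]; exact hx i
    · refine (norm_coordOp_le i (c := ρ + ρ / 2) (by positivity) fun r =>
        (sum_abs_companion_le hρ0 _ r).trans ?_).trans_lt (by rw [hρ]; linarith)
      gcongr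
      exact hs r
  have hMan : AnalyticAt ℝ M 0 := by
    rw [analyticAt_pi_iff]
    rintro (i | i)
    · exact ((ContinuousLinearMap.proj (R := ℝ) (φ := fun _ : κ => ℝ) i).analyticAt _).smul
        analyticAt_const
    · refine ((LinearMap.toContinuousLinearMap (coordOp (m := Fin (d + 1)) i)).analyticAt _).comp
        (f := fun x => companion ρ fun l => a l x) ?_
      rw [analyticAt_pi_iff]
      intro r
      rw [analyticAt_pi_iff]
      intro k
      unfold companion
      split_ifs
      · exact analyticAt_const.sub ((ha r).mul analyticAt_const)
      · exact analyticAt_const.sub analyticAt_const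
      · exact analyticAt_const.sub ((ha r).mul analyticAt_const)
      · exact analyticAt_const.sub analyticAt_const
  -- `V` is a tensor power of `ℝ^(d+1)` with one factor per variable in `ν`, each variable acting by
  -- the companion matrix on its own factor.
  let F : (κ → ℝ) → (V →L[ℝ] V) := fun x => (algExt p (V →L[ℝ] V)).sum (M x)
  have hF : AnalyticAt ℝ F 0 := (hr.analyticAt hM.self_of_nhds).comp hMan
  refine ⟨fun x J K => F x (Pi.single K 1) J, ρ, fun x z => (algExt p ℂ).sum (vec x z), hρ0,
    fun J K => ?_, ?_, ?_⟩
  · exact ((ContinuousLinearMap.proj (R := ℝ) (φ := fun _ : ν → Fin (d + 1) => ℝ) J).comp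
      (ContinuousLinearMap.apply ℝ V (Pi.single K 1 : V))).analyticAt _ |>.comp hF
  · have hz : ∀ᶠ z : κ ⊕ ν → ℝ in 𝓝 0, ‖z‖ < δ :=
      (continuous_norm.tendsto' _ _ norm_zero).eventually_lt_const hδ
    filter_upwards [hz] with z hz
    have h1 : ‖vec (z ∘ Sum.inl) fun i => (z (Sum.inr i) : ℂ)‖ < δ := by
      rw [pi_norm_lt_iff hδ] at hz ⊢
      rintro (i | i)
      · simpa [vec] using hz (Sum.inl i)
      · simpa [vec] using hz (Sum.inr i)
    -- `H` is the sum of the same series at complex points. The three claims come from three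
    -- intertwining maps: the inclusion of `ℝ` in `ℂ`, conjugation, and the functional given by the
    -- powers of the roots.
    have := hr.map_ext_sum (A := ℝ) (A' := ℂ) (W := ℂ) Complex.ofRealCLM hz h1 ?_
    · rw [hp z hz] at this
      simpa using this.symm
    · rintro (i | i) b <;> simp [vec]
  · filter_upwards [hnorm, hM, eventually_forall_root_norm_lt (fun l => (ha l).continuousAt) ha0 hδ]
      with x hx hMx hroot z hz
    have hvec : ∀ z : ν → ℂ, (∀ i, ‖z i‖ < δ) → ‖vec x z‖ < δ := by
      intro z hz
      rw [pi_norm_lt_iff hδ] at hx ⊢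
      rintro (i | i)
      · simpa [vec] using hx i
      · exact hz i
    have hzδ : ∀ i, ‖z i‖ < δ := fun i => hroot _ (hz i)
    constructor
    · have := hr.map_ext_sum (A := ℂ) (A' := ℂ) (W := ℂ)
        (Complex.conjCLE : ℂ →L[ℝ] ℂ) (hvec z hzδ)
        (hvec (fun i => starRingEnd ℂ (z i)) fun i => by simpa using hzδ i) ?_
      · simpa using this.symm
      · rintro (i | i) b <;> simp [vec]
    · intro K
      have := hr.map_ext_sum (A := V →L[ℝ] V) (A' := ℂ) (W := ℂ)
        ((tensorFunctional fun i (r : Fin (d + 1)) => (z i / ρ) ^ (r : ℕ)).comp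
          (ContinuousLinearMap.apply ℝ V (Pi.single K 1 : V))) hMx (hvec z hzδ) ?_
      · have h2 : tensorFunctional (fun i (r : Fin (d + 1)) => (z i / ρ) ^ (r : ℕ))
            (Pi.single K 1 : V) = ∏ i, (z i / ρ) ^ (K i : ℕ) := by
          rw [tensorFunctional_apply, Finset.sum_eq_single K]
          · simp
          · intro J _ hJ
            simp [hJ]
          · simp
        simp only [ContinuousLinearMap.comp_apply, ContinuousLinearMap.apply_apply,
          one_apply_eq_self, h2, smul_eq_mul] at this
        rw [← this, tensorFunctional_apply]
        exact Finset.sum_congr rfl fun J _ => mul_comm _ _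
      · rintro (i | i) b
        · simp [M, vec]
        · simp only [M, vec, Sum.elim_inr, ContinuousLinearMap.comp_apply,
            ContinuousLinearMap.apply_apply, mul_apply_eq_comp, smul_eq_mul]
          refine tensorFunctional_coordOp i (fun k => ?_) _
          have h3 := hz i
          rw [aeval_monicPoly] at h3
          exact sum_pow_mul_companion hρ0.ne' h3 k

end NormMatrix

/-! ### Rings of germs of analytic functions -/

section Germs

variable {E : Type*} [NormedAddCommGroup E] [NormedSpace ℝ E]

/-- Germs along a filter of functions that are analytic at a given point. -/
def analyticGerms (l : Filter E) (z : E) : Subring (l.Germ ℝ) where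
  carrier := {γ | ∃ f : E → ℝ, AnalyticAt ℝ f z ∧ (f : l.Germ ℝ) = γ}
  mul_mem' := by
    rintro _ _ ⟨f, hf, rfl⟩ ⟨g, hg, rfl⟩
    exact ⟨f * g, hf.mul hg, rfl⟩
  one_mem' := ⟨fun _ => 1, analyticAt_const, rfl⟩
  add_mem' := by
    rintro _ _ ⟨f, hf, rfl⟩ ⟨g, hg, rfl⟩
    exact ⟨f + g, hf.add hg, rfl⟩
  zero_mem' := ⟨fun _ => 0, analyticAt_const, rfl⟩
  neg_mem' := by
    rintro _ ⟨f, hf, rfl⟩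
    exact ⟨-f, hf.neg, rfl⟩

/-- The germ of an analytic function. -/
def analyticGerms.mk (l : Filter E) {z : E} (f : E → ℝ) (hf : AnalyticAt ℝ f z) :
    analyticGerms l z := ⟨(f : l.Germ ℝ), f, hf, rfl⟩

theorem analyticGerms.exists_mk {l : Filter E} {z : E} (γ : analyticGerms l z) :
    ∃ f, ∃ hf : AnalyticAt ℝ f z, γ = mk l f hf := by
  obtain ⟨γ, f, hf, rfl⟩ := γ
  exact ⟨f, hf, rfl⟩

theorem analyticGerms.mk_eq_mk {l : Filter E} {z : E} {f g : E → ℝ} {hf : AnalyticAt ℝ f z}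
    {hg : AnalyticAt ℝ g z} : mk l f hf = mk l g hg ↔ f =ᶠ[l] g :=
  Subtype.ext_iff.trans Germ.coe_eq

theorem analyticGerms.mk_eq_zero {l : Filter E} {z : E} {f : E → ℝ} {hf : AnalyticAt ℝ f z} :
    mk l f hf = 0 ↔ ∀ᶠ x in l, f x = 0 :=
  Subtype.ext_iff.trans Germ.coe_eq

variable {F : Type*} [NormedAddCommGroup F] [NormedSpace ℝ F] {G : Type*} [NormedAddCommGroup G]
  [NormedSpace ℝ G]

/-- The pull back of germs along an analytic map. -/
noncomputable def analyticGerms.comap {l : Filter E} {z : E} {l' : Filter F} {w : F} (π : E → F)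
    (hl : Tendsto π l l') (hπ : AnalyticAt ℝ π z) (hz : π z = w) :
    analyticGerms l' w →+* analyticGerms l z where
  toFun γ := ⟨γ.1.compTendsto π hl, by
    obtain ⟨γ, f, hf, rfl⟩ := γ
    exact ⟨f ∘ π, AnalyticAt.comp (hz ▸ hf) hπ, rfl⟩⟩
  map_one' := rfl
  map_zero' := rfl
  map_mul' := by
    rintro ⟨_, f, hf, rfl⟩ ⟨_, g, hg, rfl⟩
    rfl
  map_add' := by
    rintro ⟨_, f, hf, rfl⟩ ⟨_, g, hg, rfl⟩
    rfl

/-- Two analytic functions whose product vanishes near a point. -/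
theorem AnalyticAt.eventually_zero_or_of_mul {f g : E → ℝ} {z : E} (hf : AnalyticAt ℝ f z)
    (hg : AnalyticAt ℝ g z) (h : ∀ᶠ x in 𝓝 z, f x * g x = 0) :
    (∀ᶠ x in 𝓝 z, f x = 0) ∨ ∀ᶠ x in 𝓝 z, g x = 0 := by
  obtain ⟨ε, hε, hball⟩ := Metric.eventually_nhds_iff_ball.1
    (hf.eventually_analyticAt.and (hg.eventually_analyticAt.and h))
  have hpre := (convex_ball z ε).isPreconnected
  have hB := Metric.isOpen_ball (x := z) (ε := ε)
  have hmem := hB.mem_nhds (Metric.mem_ball_self hε)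
  by_cases h0 : ∀ x ∈ Metric.ball z ε, g x = 0
  · right
    filter_upwards [hmem] with x hx using h0 x hx
  · left
    push Not at h0
    obtain ⟨p, hp, hgp⟩ := h0
    -- Near a point where `g` does not vanish, `f` vanishes; the identity theorem spreads this over
    -- the ball.
    have hfp : f =ᶠ[𝓝 p] 0 := by
      filter_upwards [(hball p hp).2.1.continuousAt.eventually_ne hgp, hB.mem_nhds hp] with x hx hxB
      exact (mul_eq_zero.1 (hball x hxB).2.2).resolve_right hx
    have := AnalyticOnNhd.eqOn_zero_of_preconnected_of_eventuallyEq_zero (𝕜 := ℝ)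
      (fun x hx => (hball x hx).1) hpre hp hfp
    filter_upwards [hmem] with x hx using this hx

instance (z : E) : IsDomain (analyticGerms (𝓝 z) z) := by
  have : NoZeroDivisors (analyticGerms (𝓝 z) z) := ⟨by
    rintro ⟨_, f, hf, rfl⟩ ⟨_, g, hg, rfl⟩ h
    exact (hf.eventually_zero_or_of_mul hg ((analyticGerms.mk_eq_zero (hf := hf.mul hg)).1 h)).imp
      (fun h => analyticGerms.mk_eq_zero (hf := hf).2 h)
      fun h => analyticGerms.mk_eq_zero (hf := hg).2 h⟩
  have : Nontrivial (analyticGerms (𝓝 z) z) := inferInstance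
  exact NoZeroDivisors.to_isDomain _

/-- The value of a germ at the base point. -/
noncomputable def analyticGerms.value (z : E) : analyticGerms (𝓝 z) z →+* ℝ :=
  Germ.valueRingHom.comp (analyticGerms (𝓝 z) z).subtype

theorem analyticGerms.value_mk {z : E} {f : E → ℝ} (hf : AnalyticAt ℝ f z) :
    value z (mk (𝓝 z) f hf) = f z := rfl

end Germs

/-! ### Chains of prime ideals -/

section Dimension

theorem two_le_ringKrullDim {R : Type*} [CommRing R] {P₀ P₁ P₂ : Ideal R} (h₀ : P₀.IsPrime)
    (h₁ : P₁.IsPrime) (h₂ : P₂.IsPrime) (h01 : P₀ < P₁) (h12 : P₁ < P₂) : 2 ≤ ringKrullDim R :=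
  Order.LTSeries.length_le_krullDim (α := PrimeSpectrum R)
    ⟨2, ![⟨P₀, h₀⟩, ⟨P₁, h₁⟩, ⟨P₂, h₂⟩], by
      intro i
      fin_cases i
      · exact h01
      · exact h12⟩

/-- Lying over for `P₀`, then going up twice. Injectivity is what puts the kernel inside `P₀`. -/
theorem two_le_ringKrullDim_of_isIntegral {R S : Type*} [CommRing R] [CommRing S] {φ : R →+* S}
    (hφ : φ.IsIntegral) (hinj : Function.Injective φ) {P₀ P₁ P₂ : Ideal R} (h₀ : P₀.IsPrime)
    (h₁ : P₁.IsPrime) (h₂ : P₂.IsPrime) (h01 : P₀ < P₁) (h12 : P₁ < P₂) : 2 ≤ ringKrullDim S := by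
  let := φ.toAlgebra
  have : Algebra.IsIntegral R S := ⟨hφ⟩
  have hker : Ideal.comap (algebraMap R S) ⊥ ≤ P₀ := by
    intro x hx
    have : φ x = 0 := hx
    rw [(injective_iff_map_eq_zero φ).1 hinj x this]
    exact zero_mem _
  obtain ⟨Q₀, -, hQ₀, rfl⟩ := Ideal.exists_ideal_over_prime_of_isIntegral P₀ (⊥ : Ideal S) hker
  obtain ⟨Q₁, hle, hQ₁, rfl⟩ :=
    Ideal.exists_ideal_over_prime_of_isIntegral_of_isPrime P₁ Q₀ h01.le
  obtain ⟨Q₂, hle', hQ₂, rfl⟩ :=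
    Ideal.exists_ideal_over_prime_of_isIntegral_of_isPrime P₂ Q₁ h12.le
  exact two_le_ringKrullDim hQ₀ hQ₁ hQ₂ (lt_of_le_of_ne hle fun h => h01.ne (by rw [h]))
    (lt_of_le_of_ne hle' fun h => h12.ne (by rw [h]))

/-- The zero ideal, the germs vanishing on the first coordinate axis, and the germs vanishing at the
origin. The coordinates with indices 1 and 0 show that the two inclusions are strict. -/
theorem exists_chain_analyticGerms (k : ℕ) :
    ∃ P₀ P₁ P₂ : Ideal (analyticGerms (𝓝 (0 : Fin (k + 2) → ℝ)) 0),
      P₀.IsPrime ∧ P₁.IsPrime ∧ P₂.IsPrime ∧ P₀ < P₁ ∧ P₁ < P₂ := by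
  let line : ℝ →L[ℝ] (Fin (k + 2) → ℝ) := ContinuousLinearMap.single ℝ (fun _ => ℝ) 0
  let res := analyticGerms.comap line (l := 𝓝 0) (l' := 𝓝 0) (z := 0) (w := 0)
    (line.continuous.tendsto' _ _ line.map_zero) (line.analyticAt 0) line.map_zero
  let val := analyticGerms.value (0 : Fin (k + 2) → ℝ)
  have hres : ∀ f (hf : AnalyticAt ℝ f 0), analyticGerms.mk (𝓝 (0 : Fin (k + 2) → ℝ)) f hf ∈
      RingHom.ker res ↔ ∀ᶠ t in 𝓝 0, f (line t) = 0 := fun f hf =>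
    RingHom.mem_ker.trans (analyticGerms.mk_eq_zero (f := f ∘ line)
      (hf := AnalyticAt.comp (by rwa [line.map_zero]) (line.analyticAt 0)))
  have hval : ∀ f (hf : AnalyticAt ℝ f 0), analyticGerms.mk (𝓝 (0 : Fin (k + 2) → ℝ)) f hf ∈
      RingHom.ker val ↔ f 0 = 0 := fun f hf => RingHom.mem_ker
  have hX : ∀ i, AnalyticAt ℝ (fun x : Fin (k + 2) → ℝ => x i) 0 := fun i =>
    (ContinuousLinearMap.proj (R := ℝ) (φ := fun _ : Fin (k + 2) => ℝ) i).analyticAt 0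
  refine ⟨⊥, RingHom.ker res, RingHom.ker val, Ideal.isPrime_bot, RingHom.ker_isPrime _,
    RingHom.ker_isPrime _, lt_of_le_of_ne bot_le fun h => ?_, lt_of_le_of_ne ?_ fun h => ?_⟩
  · have h1 := (hres _ (hX 1)).2 (Eventually.of_forall fun t => by simp [line])
    rw [← h, Ideal.mem_bot, analyticGerms.mk_eq_zero] at h1
    have h2 : Tendsto (fun t : ℝ => (Pi.single 1 t : Fin (k + 2) → ℝ)) (𝓝[≠] 0) (𝓝 0) :=
      tendsto_nhdsWithin_of_tendsto_nhds
        (Continuous.tendsto' (continuous_single (1 : Fin (k + 2))) _ _ (Pi.single_zero _))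
    obtain ⟨t, ht, ht0⟩ := ((h2.eventually h1).and self_mem_nhdsWithin).exists
    exact ht0 (by simpa using ht)
  · intro γ hγ
    obtain ⟨f, hf, rfl⟩ := analyticGerms.exists_mk γ
    have := ((hres f hf).1 hγ).self_of_nhds
    rw [map_zero] at this
    exact (hval f hf).2 this
  · have h1 := (hval _ (hX 0)).2 rfl
    rw [← h, hres] at h1
    obtain ⟨t, ht, ht0⟩ :=
      ((eventually_nhdsWithin_of_eventually_nhds h1).and (self_mem_nhdsWithin (s := {0}ᶜ))).exists
    exact ht0 (by simpa [line] using ht)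

end Dimension

/-! ### Integrality over fewer variables -/

section Integrality

/-- Determinant trick: `w` is killed by `h - A`, so multiplication by the adjugate gives `det (h -
A) * w = 0`, and `w` has an entry equal to 1. -/
theorem eval₂_charpoly_eq_zero_of_vecMul_eq {R S n : Type*} [CommRing R] [CommRing S] [Fintype n]
    [DecidableEq n] (φ : R →+* S) (A : Matrix n n R) (w : n → S) (h : S)
    (hw : ∀ K, ∑ J, w J * φ (A J K) = h * w K) {K₀ : n} (h1 : w K₀ = 1) : A.charpoly.eval₂ φ h = 0 := by
  set B : Matrix n n S := Matrix.scalar n h - A.map φ with hB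
  have hdet : B.det = A.charpoly.eval₂ φ h := by
    rw [Polynomial.eval₂_eq_eval_map, ← Matrix.charpoly_map, Matrix.eval_charpoly]
  have hwB : Matrix.vecMul w B = 0 := by
    ext K
    rw [hB, Matrix.vecMul_sub]
    simp [Matrix.vecMul, dotProduct, hw]
  have h2 : Matrix.vecMul w (B * B.adjugate) = 0 := by
    rw [← Matrix.vecMul_vecMul, hwB, Matrix.zero_vecMul]
  rw [Matrix.mul_adjugate, Matrix.vecMul_smul, Matrix.vecMul_one] at h2
  have := congrFun h2 K₀
  rw [← hdet]
  simpa [h1] using this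

theorem isIntegralElem_of_vecMul_eq {R S n : Type*} [CommRing R] [CommRing S] [Fintype n]
    [DecidableEq n] (φ : R →+* S) (A : Matrix n n R) (w : n → S) (h : S)
    (hw : ∀ K, ∑ J, w J * φ (A J K) = h * w K) {K₀ : n} (h1 : w K₀ = 1) : φ.IsIntegralElem h :=
  ⟨A.charpoly, A.charpoly_monic, eval₂_charpoly_eq_zero_of_vecMul_eq φ A w h hw h1⟩

/-- Transitivity of integrality when no map between `R` and `R'` is given: it suffices that the
image of `φ` is integral over `R'`. -/
theorem isIntegral_of_forall_range {R R' S : Type*} [CommRing R] [CommRing R'] [CommRing S]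
    {φ : R →+* S} (hφ : φ.IsIntegral) (φ' : R' →+* S) (h : ∀ r, φ'.IsIntegralElem (φ r)) :
    φ'.IsIntegral := by
  let := φ'.toAlgebra
  intro x
  obtain ⟨p, hp, hpx⟩ := hφ x
  let ψ : R →+* integralClosure R' S :=
    φ.codRestrict (integralClosure R' S).toSubring fun r => h r
  refine isIntegral_trans (R := R') (A := integralClosure R' S) x ⟨p.map ψ, hp.map ψ, ?_⟩
  rw [Polynomial.eval₂_map]
  exact hpx

variable {κ ν : Type*} [Fintype κ] [Fintype ν] {d : ℕ} {a : Fin (d + 1) → (κ → ℝ) → ℝ}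

theorem exists_real_normMatrix [DecidableEq ν] {h : (κ ⊕ ν → ℝ) → ℝ} (hh : AnalyticAt ℝ h 0)
    (ha : ∀ l, AnalyticAt ℝ (a l) 0) (ha0 : ∀ l, a l 0 = 0) :
    ∃ (A : (κ → ℝ) → Matrix (ν → Fin (d + 1)) (ν → Fin (d + 1)) ℝ) (ρ : ℝ), 0 < ρ ∧
      (∀ J K, AnalyticAt ℝ (fun x => A x J K) 0) ∧
      ∀ᶠ z in 𝓝 (0 : κ ⊕ ν → ℝ),
        (∀ i, Polynomial.aeval (z (Sum.inr i)) (monicPoly fun l => a l (z ∘ Sum.inl)) = 0) →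
        ∀ K, ∑ J, (∏ i, (z (Sum.inr i) / ρ) ^ (J i : ℕ)) * A (z ∘ Sum.inl) J K =
          h z * ∏ i, (z (Sum.inr i) / ρ) ^ (K i : ℕ) := by
  obtain ⟨A, ρ, H, hρ, hA, hH, hAH⟩ := exists_normMatrix hh ha ha0
  refine ⟨A, ρ, hρ, hA, ?_⟩
  have hinl : Tendsto (fun z : κ ⊕ ν → ℝ => z ∘ Sum.inl) (𝓝 0) (𝓝 0) :=
    Continuous.tendsto' (by fun_prop) _ _ rfl
  filter_upwards [hH, hinl.eventually hAH] with z hz hAz hroot K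
  have := (hAz (fun i => (z (Sum.inr i) : ℂ)) fun i => ?_).2 K
  · rw [hz] at this
    exact_mod_cast this
  · have := congrArg (algebraMap ℝ ℂ) (hroot i)
    rwa [map_zero, ← Polynomial.aeval_algebraMap_apply] at this

/-- A version of `exists_weierstrassPolynomial` with a polynomial of positive degree. -/
theorem exists_monicPoly {f : (κ ⊕ Unit → ℝ) → ℝ} (hf : AnalyticAt ℝ f 0)
    (hne : ¬ ∀ᶠ y in 𝓝 (0 : ℝ), f (lastCoord 0 y) = 0) :
    ∃ (d : ℕ) (a : Fin (d + 1) → (κ → ℝ) → ℝ), (∀ l, AnalyticAt ℝ (a l) 0) ∧ (∀ l, a l 0 = 0) ∧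
      ∀ᶠ z in 𝓝 (0 : κ ⊕ Unit → ℝ), f z = 0 →
        Polynomial.aeval (z (Sum.inr ())) (monicPoly fun l => a l (z ∘ Sum.inl)) = 0 := by
  obtain ⟨d, a, ha, ha0, h⟩ := exists_weierstrassPolynomial hf hne
  -- Multiplication by the last coordinate makes the degree positive; the new constant coefficient
  -- is 0.
  refine ⟨d, Fin.cons (fun _ => 0) a, fun l => ?_, fun l => ?_, ?_⟩
  · induction l using Fin.cases with
    | zero => exact analyticAt_const
    | succ l => exact ha l
  · induction l using Fin.cases with
    | zero => rfl
    | succ l => exact ha0 l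
  · filter_upwards [h] with z hz hfz
    rw [aeval_monicPoly, Fin.sum_univ_succ]
    simp only [Fin.cons_zero, Fin.cons_succ, map_zero, zero_mul, zero_add, Fin.val_succ, pow_succ,
      ← mul_assoc, ← Finset.sum_mul, ← add_mul]
    rw [Algebra.algebraMap_self]
    simp only [RingHom.id_apply]
    rw [hz hfz, zero_mul]

variable {E : Type*} [NormedAddCommGroup E] [NormedSpace ℝ E] {l : Filter E} {z : E}
  {F : Type*} [NormedAddCommGroup F] [NormedSpace ℝ F] {G : Type*} [NormedAddCommGroup G]
  [NormedSpace ℝ G]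

theorem tendsto_map_sub (hl : l ≤ 𝓝 z) (π : E →L[ℝ] F) :
    Tendsto (fun x => π (x - z)) l (𝓝 0) :=
  (Continuous.tendsto' (by fun_prop) _ _ (by simp)).mono_left hl

theorem analyticAt_map_sub (z : E) (π : E →L[ℝ] F) : AnalyticAt ℝ (fun x => π (x - z)) z :=
  (π.analyticAt _).comp (analyticAt_id.sub analyticAt_const)

/-- The pull back of germs at `0` along a linear map, translated to a given base point. -/
noncomputable def coordHom (hl : l ≤ 𝓝 z) (π : E →L[ℝ] F) :
    analyticGerms (𝓝 (0 : F)) 0 →+* analyticGerms l z :=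
  analyticGerms.comap _ (tendsto_map_sub hl π) (analyticAt_map_sub z π) (by simp)

theorem coordHom_mk_eq_zero (hl : l ≤ 𝓝 z) (π : E →L[ℝ] F) {f : F → ℝ} (hf : AnalyticAt ℝ f 0) :
    coordHom hl π (analyticGerms.mk _ f hf) = 0 ↔ ∀ᶠ x in l, f (π (x - z)) = 0 :=
  Subtype.ext_iff.trans Germ.coe_eq

theorem coordHom_mk_eq_coordHom_mk (hl : l ≤ 𝓝 z) (π : E →L[ℝ] F) (π' : E →L[ℝ] G) {f : F → ℝ}
    (hf : AnalyticAt ℝ f 0) {g : G → ℝ} (hg : AnalyticAt ℝ g 0) :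
    coordHom hl π (analyticGerms.mk _ f hf) = coordHom hl π' (analyticGerms.mk _ g hg) ↔
      ∀ᶠ x in l, f (π (x - z)) = g (π' (x - z)) :=
  Subtype.ext_iff.trans Germ.coe_eq

/-- The projection that forgets the last coordinate. -/
noncomputable def projInit (κ : Type*) : (κ ⊕ Unit → ℝ) →L[ℝ] (κ → ℝ) :=
  ContinuousLinearMap.pi fun i => ContinuousLinearMap.proj (Sum.inl i)

/-- Along `l` the last coordinate is a root of a Weierstrass polynomial over the others. Hence any
analytic function is an eigenvalue of a matrix of germs in the other coordinates, with the powers of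
the last coordinate as eigenvector. -/
theorem isIntegralElem_coordHom (hl : l ≤ 𝓝 z) (π : E →L[ℝ] (κ ⊕ Unit → ℝ))
    {f : (κ ⊕ Unit → ℝ) → ℝ} (hf : AnalyticAt ℝ f 0)
    (hne : ¬ ∀ᶠ y in 𝓝 (0 : ℝ), f (lastCoord 0 y) = 0)
    (hπ : coordHom hl π (analyticGerms.mk _ f hf) = 0)
    (γ : analyticGerms (𝓝 (0 : κ ⊕ Unit → ℝ)) 0) :
    (coordHom hl ((projInit κ).comp π)).IsIntegralElem (coordHom hl π γ) := by
  obtain ⟨h, hh, rfl⟩ := analyticGerms.exists_mk γ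
  obtain ⟨d, a, ha, ha0, haf⟩ := exists_monicPoly hf hne
  obtain ⟨A, ρ, hρ, hA, hAh⟩ := exists_real_normMatrix hh ha ha0
  have hw : ∀ J : Unit → Fin (d + 1),
      AnalyticAt ℝ (fun y : κ ⊕ Unit → ℝ => (y (Sum.inr ()) / ρ) ^ (J () : ℕ)) 0 := fun J =>
    (((ContinuousLinearMap.proj (R := ℝ) (φ := fun _ : κ ⊕ Unit => ℝ)
      (Sum.inr ())).analyticAt _).div_const).pow _
  refine isIntegralElem_of_vecMul_eq (n := Unit → Fin (d + 1)) _
    (Matrix.of fun J K => analyticGerms.mk _ (fun x => A x J K) (hA J K))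
    (fun J => coordHom hl π (analyticGerms.mk _ _ (hw J))) _ (fun K => ?_) (K₀ := fun _ => 0) ?_
  · have hsum : AnalyticAt ℝ (fun y : κ ⊕ Unit → ℝ =>
        ∑ J : Unit → Fin (d + 1), (y (Sum.inr ()) / ρ) ^ (J () : ℕ) * A (y ∘ Sum.inl) J K) 0 := by
      refine Finset.analyticAt_fun_sum _ fun J _ => (hw J).fun_mul ?_
      exact AnalyticAt.fun_comp (g := fun x => A x J K) (f := projInit κ)
        (by rw [map_zero]; exact hA J K) ((projInit κ).analyticAt 0)
    have hL : ∑ J : Unit → Fin (d + 1), coordHom hl π (analyticGerms.mk _ _ (hw J)) *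
        coordHom hl ((projInit κ).comp π) (analyticGerms.mk _ (fun x => A x J K) (hA J K)) =
        coordHom hl π (analyticGerms.mk _ _ hsum) := by
      refine Subtype.ext ?_
      rw [AddSubmonoidClass.coe_finsetSum]
      have : ∀ (s : Finset (Unit → Fin (d + 1))) (u : (Unit → Fin (d + 1)) → E → ℝ),
          ∑ J ∈ s, (u J : l.Germ ℝ) = ((fun x => ∑ J ∈ s, u J x : E → ℝ) : l.Germ ℝ) := by
        classical
        intro s u
        induction s using Finset.induction_on with
        | empty => simp; rfl
        | insert J s hJ ih =>
          simp only [Finset.sum_insert hJ, ih]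
          rfl
      exact this _ _
    simp only [Matrix.of_apply]
    rw [hL, ← map_mul]
    refine (coordHom_mk_eq_coordHom_mk hl π π hsum (hh.mul (hw K))).2 ?_
    have hπ' := (coordHom_mk_eq_zero hl π hf).1 hπ
    filter_upwards [hπ', (tendsto_map_sub hl π).eventually haf,
      (tendsto_map_sub hl π).eventually hAh] with x hx hax hAx
    simpa using hAx (fun _ => hax hx) K
  · have : analyticGerms.mk (𝓝 (0 : κ ⊕ Unit → ℝ)) _ (hw fun _ => 0) = 1 :=
      Subtype.ext (Germ.coe_eq.2 (Eventually.of_forall fun y => by simp))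
    rw [this, map_one]

end Integrality

/-! ### Reduction to one coordinate -/

section Descent

variable {E : Type*} [NormedAddCommGroup E] [NormedSpace ℝ E] {l : Filter E} {z : E}

/-- On each segment from 0 to a point of a small ball, the identity theorem in one variable carries
the vanishing from 0 to the other end. -/
theorem AnalyticAt.eventually_zero_of_lines {f : E → ℝ} (hf : AnalyticAt ℝ f 0)
    (h : ∀ v, ∀ᶠ t : ℝ in 𝓝 0, f (t • v) = 0) : ∀ᶠ x in 𝓝 0, f x = 0 := by
  obtain ⟨ε, hε, hball⟩ := Metric.eventually_nhds_iff_ball.1 hf.eventually_analyticAt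
  filter_upwards [Metric.ball_mem_nhds _ hε] with x hx
  have hx' : ‖x‖ < ε := by simpa using hx
  have h1 : AnalyticOnNhd ℝ (fun t : ℝ => f (t • x)) (Icc 0 1) := by
    intro t ht
    refine AnalyticAt.fun_comp (g := f) (hball _ ?_) (analyticAt_id.smul analyticAt_const)
    rw [mem_ball_zero_iff, norm_smul, Real.norm_of_nonneg ht.1]
    exact (mul_le_of_le_one_left (norm_nonneg _) ht.2).trans_lt hx'
  have := AnalyticOnNhd.eqOn_zero_of_preconnected_of_eventuallyEq_zero h1 isPreconnected_Icc
    (left_mem_Icc.2 zero_le_one) (h x) (right_mem_Icc.2 zero_le_one)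
  simpa using this

theorem AnalyticAt.exists_line_ne_zero [Nontrivial E] {f : E → ℝ} (hf : AnalyticAt ℝ f 0)
    (h : ¬ ∀ᶠ x in 𝓝 0, f x = 0) : ∃ v ≠ 0, ¬ ∀ᶠ t : ℝ in 𝓝 0, f (t • v) = 0 := by
  by_contra! hv
  refine h (hf.eventually_zero_of_lines fun v => ?_)
  rcases eq_or_ne v 0 with rfl | hv0
  · obtain ⟨w, hw⟩ := exists_ne (0 : E)
    have := (hv w hw).self_of_nhds
    rw [zero_smul] at this
    exact Eventually.of_forall fun t => by rw [smul_zero, this]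
  · exact hv v hv0

/-- A presentation of a germ ring of dimension at most one as an integral extension can be reduced
to fewer variables. -/
theorem exists_integral_coordHom_of_succ (hl : l ≤ 𝓝 z)
    (hdim : ringKrullDim (analyticGerms l z) ≤ 1) {k : ℕ} {π : E →L[ℝ] (Fin (k + 2) → ℝ)}
    (hπ : (coordHom hl π).IsIntegral) :
    ∃ π' : E →L[ℝ] (Fin (k + 1) → ℝ), (coordHom hl π').IsIntegral := by
  -- Germs in at least two variables have a chain of three primes, which an injective integral map
  -- would transfer to a ring of dimension at most one. So some nonzero `f` vanishes on the germ.
  have hinj : ¬ Function.Injective (coordHom hl π) := by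
    intro hinj
    obtain ⟨P₀, P₁, P₂, h₀, h₁, h₂, h01, h12⟩ := exists_chain_analyticGerms k
    have := (two_le_ringKrullDim_of_isIntegral hπ hinj h₀ h₁ h₂ h01 h12).trans hdim
    exact absurd this (by decide)
  rw [injective_iff_map_eq_zero] at hinj
  push Not at hinj
  obtain ⟨γ, hγ, hγ0⟩ := hinj
  obtain ⟨f, hf, rfl⟩ := analyticGerms.exists_mk γ
  rw [Ne, analyticGerms.mk_eq_zero] at hγ0
  obtain ⟨v, hv, hfv⟩ := hf.exists_line_ne_zero hγ0
  -- A linear change of coordinates turns a line on which `f` is not identically zero into the last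
  -- axis, as Weierstrass preparation requires.
  let R : (Fin (k + 2) → ℝ) ≃L[ℝ] (Fin (k + 1) ⊕ Unit → ℝ) :=
    (LinearEquiv.funCongrLeft ℝ ℝ (Fintype.equivOfCardEq (by simp))).toContinuousLinearEquiv
  have he : lastCoord (0 : Fin (k + 1) → ℝ) (1 : ℝ) ≠ 0 := fun h => by
    simpa using congrFun h (Sum.inr ())
  obtain ⟨A, hA⟩ := SeparatingDual.exists_continuousLinearEquiv_apply_eq (R := ℝ)
    (x := R v) (by simpa using hv) he
  let T : (Fin (k + 2) → ℝ) ≃L[ℝ] (Fin (k + 1) ⊕ Unit → ℝ) := R.trans A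
  have hT : T v = lastCoord (0 : Fin (k + 1) → ℝ) (1 : ℝ) := hA
  have hTf : ∀ {g : (Fin (k + 2) → ℝ) → ℝ}, AnalyticAt ℝ g 0 →
      AnalyticAt ℝ (fun x => g (T.symm x)) 0 := fun {g} hg =>
    AnalyticAt.fun_comp (g := g) (f := T.symm) (by rwa [map_zero])
      ((T.symm : (Fin (k + 1) ⊕ Unit → ℝ) →L[ℝ] (Fin (k + 2) → ℝ)).analyticAt 0)
  have hTcoord : ∀ {g : (Fin (k + 2) → ℝ) → ℝ} (hg : AnalyticAt ℝ g 0),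
      coordHom hl π (analyticGerms.mk _ g hg) =
        coordHom hl ((T : (Fin (k + 2) → ℝ) →L[ℝ] (Fin (k + 1) ⊕ Unit → ℝ)).comp π)
          (analyticGerms.mk _ _ (hTf hg)) := fun {g} hg =>
    (coordHom_mk_eq_coordHom_mk hl _ _ hg (hTf hg)).2 (Eventually.of_forall fun x => by simp)
  have hne : ¬ ∀ᶠ y in 𝓝 (0 : ℝ), f (T.symm (lastCoord 0 y)) = 0 := by
    refine fun h => hfv (h.mono fun y hy => ?_)
    have : lastCoord (0 : Fin (k + 1) → ℝ) y = y • T v := by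
      rw [hT]; ext (i | i) <;> simp
    rwa [this, map_smul, T.symm_apply_apply] at hy
  refine ⟨_, isIntegral_of_forall_range hπ (coordHom hl ((projInit (Fin (k + 1))).comp
    ((T : (Fin (k + 2) → ℝ) →L[ℝ] (Fin (k + 1) ⊕ Unit → ℝ)).comp π))) fun γ => ?_⟩
  obtain ⟨g, hg, rfl⟩ := analyticGerms.exists_mk γ
  rw [hTcoord hg]
  exact isIntegralElem_coordHom hl _ (hTf hf) hne (by rw [← hTcoord hf, hγ]) _

/-- A germ ring of dimension at most one is integral over the germs in a linear coordinate. -/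
theorem exists_integral_coordHom (hl : l ≤ 𝓝 z) (hdim : ringKrullDim (analyticGerms l z) ≤ 1)
    {k : ℕ} (π₀ : E →L[ℝ] (Fin (k + 1) → ℝ)) (σ : (Fin (k + 1) → ℝ) →L[ℝ] E)
    (hσ : ∀ x, σ (π₀ x) = x) : ∃ π : E →L[ℝ] ℝ, (coordHom hl π).IsIntegral := by
  -- At the start the map is even surjective, because `σ` lets every analytic function factor
  -- through `π₀`.
  have base : ∃ π : E →L[ℝ] (Fin (k + 1) → ℝ), (coordHom hl π).IsIntegral := by
    refine ⟨π₀, RingHom.IsIntegral.of_finite ?_⟩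
    refine RingHom.Finite.of_surjective _ fun γ => ?_
    obtain ⟨f, hf, rfl⟩ := analyticGerms.exists_mk γ
    have hg : AnalyticAt ℝ (fun y => f (σ y + z)) 0 :=
      AnalyticAt.fun_comp (g := f) (by simpa using hf) ((σ.analyticAt 0).add analyticAt_const)
    exact ⟨analyticGerms.mk _ _ hg,
      Subtype.ext (Germ.coe_eq.2 (Eventually.of_forall fun x => by simp [hσ]))⟩
  have main : ∃ π : E →L[ℝ] (Fin 1 → ℝ), (coordHom hl π).IsIntegral := by
    clear hσ
    induction k with
    | zero => exact base
    | succ k ih =>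
      obtain ⟨π, hπ⟩ := base
      obtain ⟨π', hπ'⟩ := exists_integral_coordHom_of_succ hl hdim hπ
      exact ih π' 0 ⟨π', hπ'⟩
  obtain ⟨π, hπ⟩ := main
  refine ⟨(ContinuousLinearMap.proj (R := ℝ) (φ := fun _ : Fin 1 => ℝ) 0).comp π,
    isIntegral_of_forall_range hπ _ fun γ => ?_⟩
  obtain ⟨f, hf, rfl⟩ := analyticGerms.exists_mk γ
  let c : ℝ →L[ℝ] (Fin 1 → ℝ) := ContinuousLinearMap.pi fun _ => ContinuousLinearMap.id ℝ ℝ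
  have hg : AnalyticAt ℝ (fun t => f (c t)) 0 :=
    AnalyticAt.fun_comp (g := f) (by rwa [map_zero]) (c.analyticAt 0)
  have : coordHom hl π (analyticGerms.mk _ f hf) = coordHom hl
      ((ContinuousLinearMap.proj (R := ℝ) (φ := fun _ : Fin 1 => ℝ) 0).comp π)
      (analyticGerms.mk _ _ hg) :=
    (coordHom_mk_eq_coordHom_mk hl _ _ hf hg).2 (Eventually.of_forall fun x => by
      congr 1; ext i; fin_cases i; rfl)
  rw [this]
  exact RingHom.isIntegralElem_map _

end Descent

/-! ### Squarefree Weierstrass polynomials over germs in one variable -/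

section SquarefreePart

open Polynomial

/-- Take `q` of least degree among the monic divisors of `p` a power of which is divisible by `p`. A
square factor over `K` descends to `q = y * y * r` over the integrally closed ring `R`, and `y * r`
is again such a divisor, so `y = 1`. -/
theorem exists_squarefree_part {R : Type*} (K : Type*) [CommRing R] [IsDomain R]
    [IsIntegrallyClosed R] [Field K] [Algebra R K] [IsFractionRing R K] {p : R[X]} (hp : p.Monic) :
    ∃ q : R[X], q.Monic ∧ q ∣ p ∧ (∃ N : ℕ, p ∣ q ^ N) ∧
      Squarefree (q.map (algebraMap R K)) := by
  obtain ⟨q, ⟨hq, hqp, N, hN⟩, hmin⟩ := (measure (natDegree : R[X] → ℕ)).wf.has_min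
    {q | q.Monic ∧ q ∣ p ∧ ∃ N : ℕ, p ∣ q ^ N} ⟨p, hp, dvd_rfl, 1, by rw [pow_one]⟩
  refine ⟨q, hq, hqp, ⟨N, hN⟩, fun x hx => ?_⟩
  have hx0 : x ≠ 0 := by
    rintro rfl
    rw [zero_mul, zero_dvd_iff] at hx
    exact (hq.map (algebraMap R K)).ne_zero hx
  obtain ⟨y, hy⟩ := IsIntegrallyClosed.eq_map_mul_C_of_dvd K hq ((dvd_mul_left x x).trans hx)
  have hlc : x.leadingCoeff ≠ 0 := leadingCoeff_ne_zero.2 hx0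
  have hu : IsUnit (C x.leadingCoeff) := isUnit_C.2 hlc.isUnit
  have hass : Associated (y.map (algebraMap R K)) x := ⟨hu.unit, hy⟩
  have hym' : (y.map (algebraMap R K)).Monic := by
    have := congrArg leadingCoeff hy
    rw [leadingCoeff_mul, leadingCoeff_C] at this
    exact mul_right_cancel₀ hlc (by rw [this, one_mul])
  have hym : y.Monic := monic_of_injective (IsFractionRing.injective R K) hym'
  have hyy : y * y ∣ q := by
    refine hq.dvd_of_fraction_map_dvd_fraction_map (K := K) (hym.mul hym) ?_
    rw [Polynomial.map_mul]
    exact ((hass.mul_mul hass).dvd_iff_dvd_left).2 hx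
  obtain ⟨r, hr⟩ := hyy
  have hrm : r.Monic := (hym.mul hym).of_mul_monic_left (hr ▸ hq)
  have hmem : (y * r).Monic ∧ y * r ∣ p ∧ ∃ N : ℕ, p ∣ (y * r) ^ N := by
    refine ⟨hym.mul hrm, Dvd.dvd.trans ⟨y, by rw [hr]; ring⟩ hqp, 2 * N, hN.trans ?_⟩
    rw [pow_mul]
    exact pow_dvd_pow_of_dvd ⟨r, by rw [hr]; ring⟩ N
  have hdeg := hmin _ hmem
  have h1 : q.natDegree = y.natDegree + (y * r).natDegree := by
    rw [hr, mul_assoc, hym.natDegree_mul (hym.mul hrm)]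
  have h2 : y.natDegree = 0 := by
    by_contra h
    exact hdeg (by change (y * r).natDegree < q.natDegree; omega)
  rw [hym.natDegree_eq_zero.1 h2, Polynomial.map_one] at hass
  exact hass.isUnit isUnit_one

/-- In characteristic zero, squarefree means separable over `K`; clearing denominators turns the
constant 1 into some nonzero `δ`. -/
theorem exists_bezout_derivative {R K : Type*} [CommRing R] [IsDomain R] [CharZero R] [Field K]
    [Algebra R K] [IsFractionRing R K] {q : R[X]}
    (hq : Squarefree (q.map (algebraMap R K))) :
    ∃ (a b : R[X]) (δ : R), δ ≠ 0 ∧ a * q + b * derivative q = C δ := by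
  have : CharZero K := charZero_of_injective_algebraMap (IsFractionRing.injective R K)
  obtain ⟨a, b, hab⟩ := PerfectField.separable_iff_squarefree.2 hq
  obtain ⟨s, hs0, hs⟩ := IsLocalization.integerNormalization_spec (nonZeroDivisors R) a
  obtain ⟨t, ht0, ht⟩ := IsLocalization.integerNormalization_spec (nonZeroDivisors R) b
  refine ⟨C t * IsLocalization.integerNormalization (nonZeroDivisors R) a,
    C s * IsLocalization.integerNormalization (nonZeroDivisors R) b, s * t,
    mul_ne_zero (nonZeroDivisors.ne_zero hs0) (nonZeroDivisors.ne_zero ht0), ?_⟩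
  apply map_injective _ (IsFractionRing.injective R K)
  have hsm : ∀ (r : R) (f : K[X]), r • f = C (algebraMap R K r) * f := fun r f => by
    rw [← smul_eq_C_mul, algebraMap_smul]
  simp only [Polynomial.map_add, Polynomial.map_mul, map_C, hs, ht, hsm, map_mul]
  rw [← derivative_map] at *
  linear_combination (C (algebraMap R K s) * C (algebraMap R K t)) * hab

end SquarefreePart

/-! ### Analytic germs in one variable -/

section OneVariable

theorem analyticGerms.isUnit_mk {z : ℝ} {f : ℝ → ℝ} (hf : AnalyticAt ℝ f z) (h : f z ≠ 0) :
    IsUnit (mk (𝓝 z) f hf) := by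
  refine IsUnit.of_mul_eq_one (mk (𝓝 z) _ (hf.inv h)) (Subtype.ext (Germ.coe_eq.2 ?_))
  filter_upwards [hf.continuousAt.eventually_ne h] with x hx
  exact mul_inv_cancel₀ hx

/-- If both factors vanished at 0, the derivative of their product would be 0 there instead of 1. -/
theorem analyticGerms.irreducible_mk_id :
    Irreducible (mk (z := 0) (𝓝 (0 : ℝ)) (fun t : ℝ => t) analyticAt_id) := by
  refine ⟨fun h => ?_, fun α β h => ?_⟩
  · have := h.map (analyticGerms.value (0 : ℝ))
    rw [value_mk] at this
    exact this.ne_zero rfl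
  · obtain ⟨f, hf, rfl⟩ := exists_mk α
    obtain ⟨g, hg, rfl⟩ := exists_mk β
    have h1 : (fun t : ℝ => t) =ᶠ[𝓝 0] fun t => f t * g t :=
      (mk_eq_mk (hf := analyticAt_id) (hg := hf.mul hg)).1 h
    have h2 : deriv (fun t : ℝ => t) 0 = _ := h1.deriv_eq
    rw [deriv_fun_mul hf.differentiableAt hg.differentiableAt, deriv_id''] at h2
    by_cases hf0 : f 0 = 0
    · refine Or.inr (isUnit_mk hg fun hg0 => ?_)
      rw [hf0, hg0] at h2
      simp at h2
    · exact Or.inl (isUnit_mk hf hf0)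

/-- A nonzero germ is a power of the coordinate times a unit. This yields unique factorization and
hence the integral closedness used for squarefree parts. -/
theorem analyticGerms.hasUnitMulPowIrreducibleFactorization :
    IsDiscreteValuationRing.HasUnitMulPowIrreducibleFactorization
      (analyticGerms (𝓝 (0 : ℝ)) 0) := by
  refine ⟨_, irreducible_mk_id, fun {γ} hγ => ?_⟩
  obtain ⟨f, hf, rfl⟩ := exists_mk γ
  rw [Ne, mk_eq_zero] at hγ
  obtain ⟨n, g, hg, hg0, hfg⟩ := hf.exists_eventuallyEq_pow_smul_nonzero_iff.2 hγ
  refine ⟨n, (isUnit_mk hg hg0).unit, Subtype.ext (Germ.coe_eq.2 ?_)⟩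
  filter_upwards [hfg] with t ht
  rw [ht]
  simp

instance : IsIntegrallyClosed (analyticGerms (𝓝 (0 : ℝ)) 0) := by
  have := analyticGerms.hasUnitMulPowIrreducibleFactorization.toUniqueFactorizationMonoid
  infer_instance

instance : CharZero (analyticGerms (𝓝 (0 : ℝ)) 0) :=
  charZero_of_injective_algebraMap (R := ℤ) (by
    rw [injective_iff_map_eq_zero]
    intro n hn
    have := congrArg (analyticGerms.value (0 : ℝ)) hn
    simpa using this)

end OneVariable

section MonicPoly

open Polynomial

variable {R S : Type*} [CommRing R] [CommRing S] {d : ℕ}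

theorem degree_sum_C_mul_X_pow_lt (c : Fin d → R) : (∑ l, C (c l) * X ^ (l : ℕ)).degree < (d : WithBot ℕ) := by
  rw [← mem_degreeLT]
  refine Submodule.sum_mem _ fun l _ => mem_degreeLT.2 ?_
  exact (degree_C_mul_X_pow_le _ _).trans_lt (by exact_mod_cast l.2)

theorem monic_monicPoly (c : Fin d → R) : (monicPoly c).Monic :=
  monic_X_pow_add (degree_sum_C_mul_X_pow_lt c)

theorem natDegree_monicPoly [Nontrivial R] (c : Fin d → R) : (monicPoly c).natDegree = d := by
  rw [monicPoly, natDegree, degree_add_eq_left_of_degree_lt, degree_X_pow]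
  · rfl
  · rw [degree_X_pow]
    exact degree_sum_C_mul_X_pow_lt c

theorem map_monicPoly (φ : R →+* S) (c : Fin d → R) :
    (monicPoly c).map φ = monicPoly fun l => φ (c l) := by
  simp [monicPoly, Polynomial.map_sum]

theorem monicPoly_zero : monicPoly (fun _ : Fin d => (0 : R)) = X ^ d := by
  simp [monicPoly]

theorem Polynomial.Monic.eq_monicPoly {q : R[X]} (hq : q.Monic) (hd : q.natDegree = d) :
    q = monicPoly fun l : Fin d => q.coeff l := by
  subst hd
  conv_lhs => rw [hq.as_sum]
  rw [monicPoly, ← Fin.sum_univ_eq_sum_range (fun i => C (q.coeff i) * X ^ i)]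

end MonicPoly

/-! ### Weierstrass polynomials satisfied by the coordinates -/

section PolyGerm

open Polynomial

variable {E : Type*} [NormedAddCommGroup E] [NormedSpace ℝ E] {l : Filter E} {z : E}

theorem analyticGerms.mk_sum {ι : Type*} (s : Finset ι) (f : ι → E → ℝ)
    (hf : ∀ i, AnalyticAt ℝ (f i) z) : ∑ i ∈ s, mk l (f i) (hf i) =
      mk l (fun x => ∑ i ∈ s, f i x) (Finset.analyticAt_fun_sum _ fun i _ => hf i) := by
  refine Subtype.ext ?_
  rw [AddSubmonoidClass.coe_finsetSum]
  refine (map_sum (Germ.coeRingHom l) f s).symm.trans ?_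
  change ((∑ i ∈ s, f i : E → ℝ) : l.Germ ℝ) = _
  congr 1
  ext x
  simp

variable {d : ℕ}

theorem eval₂_coordHom_monicPoly_eq_zero (hl : l ≤ 𝓝 z) (π : E →L[ℝ] ℝ) {a : Fin d → ℝ → ℝ}
    (ha : ∀ i, AnalyticAt ℝ (a i) 0) {ξ : E → ℝ} (hξ : AnalyticAt ℝ ξ z) :
    (monicPoly fun i => analyticGerms.mk (𝓝 0) (a i) (ha i)).eval₂ (coordHom hl π)
      (analyticGerms.mk l ξ hξ) = 0 ↔
      ∀ᶠ x in l, aeval (ξ x) (monicPoly fun i => a i (π (x - z))) = 0 := by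
  have hc : ∀ i : Fin d, AnalyticAt ℝ (fun x => a i (π (x - z)) * ξ x ^ (i : ℕ)) z := fun i =>
    (AnalyticAt.fun_comp (g := a i) (by simpa using ha i) (analyticAt_map_sub z π)).fun_mul
      (hξ.pow _)
  have h1 : (monicPoly fun i => analyticGerms.mk (𝓝 0) (a i) (ha i)).eval₂ (coordHom hl π)
      (analyticGerms.mk l ξ hξ) = analyticGerms.mk l (fun x => ξ x ^ d +
        ∑ i : Fin d, a i (π (x - z)) * ξ x ^ (i : ℕ))
        ((hξ.pow d).fun_add (Finset.analyticAt_fun_sum _ fun i _ => hc i)) := by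
    rw [monicPoly, eval₂_add, eval₂_X_pow, eval₂_finsetSum]
    simp only [eval₂_mul, eval₂_C, eval₂_X_pow]
    refine (congrArg _ (analyticGerms.mk_sum (l := l) Finset.univ _ hc)).trans ?_
    rfl
  rw [h1, analyticGerms.mk_eq_zero]
  simp only [aeval_monicPoly, Algebra.algebraMap_self, RingHom.id_apply]

/-- The germ of a polynomial-valued function defined by a polynomial whose coefficients are
germs. -/
noncomputable def polyGerm : (analyticGerms (𝓝 (0 : ℝ)) 0)[X] →+* (𝓝 (0 : ℝ)).Germ ℝ[X] :=
  eval₂RingHom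
    { toFun := fun γ => γ.1.map C
      map_one' := rfl
      map_zero' := congrArg (fun f : ℝ → ℝ[X] => (f : (𝓝 (0 : ℝ)).Germ ℝ[X]))
        (funext fun _ => C_0)
      map_mul' := by
        rintro ⟨_, f, hf, rfl⟩ ⟨_, g, hg, rfl⟩
        exact congrArg (fun f : ℝ → ℝ[X] => (f : (𝓝 (0 : ℝ)).Germ ℝ[X])) (funext fun _ => C_mul)
      map_add' := by
        rintro ⟨_, f, hf, rfl⟩ ⟨_, g, hg, rfl⟩
        exact congrArg (fun f : ℝ → ℝ[X] => (f : (𝓝 (0 : ℝ)).Germ ℝ[X])) (funext fun _ => C_add) }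
    ((fun _ : ℝ => (X : ℝ[X])) : (𝓝 (0 : ℝ)).Germ ℝ[X])

theorem polyGerm_C {f : ℝ → ℝ} (hf : AnalyticAt ℝ f 0) :
    polyGerm (C (analyticGerms.mk (𝓝 0) f hf)) = ((fun t => C (f t) : ℝ → ℝ[X]) :
      (𝓝 (0 : ℝ)).Germ ℝ[X]) := eval₂_C _ _

theorem polyGerm_X : polyGerm X = ((fun _ => X : ℝ → ℝ[X]) : (𝓝 (0 : ℝ)).Germ ℝ[X]) :=
  eval₂_X _ _

theorem polyGerm_monicPoly {a : Fin d → ℝ → ℝ} (ha : ∀ i, AnalyticAt ℝ (a i) 0) :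
    polyGerm (monicPoly fun i => analyticGerms.mk (𝓝 0) (a i) (ha i)) =
      ((fun t => monicPoly fun i => a i t : ℝ → ℝ[X]) : (𝓝 (0 : ℝ)).Germ ℝ[X]) := by
  rw [monicPoly, map_add, map_pow, map_sum]
  simp only [map_mul, polyGerm_C, map_pow, polyGerm_X]
  have h := map_sum (Germ.coeRingHom (𝓝 (0 : ℝ)))
    (fun (i : Fin d) (t : ℝ) => (C (a i t) * X ^ (i : ℕ) : ℝ[X])) Finset.univ
  refine (congrArg _ h.symm).trans ?_
  refine congrArg (fun f : ℝ → ℝ[X] => (f : (𝓝 (0 : ℝ)).Germ ℝ[X])) (funext fun t => ?_)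
  simp [monicPoly]

theorem polyGerm_derivative (Q : (analyticGerms (𝓝 (0 : ℝ)) 0)[X]) :
    polyGerm (derivative Q) = (polyGerm Q).map derivative := by
  induction Q using Polynomial.induction_on' with
  | add p q hp hq =>
    rw [derivative_add, map_add, map_add, hp, hq]
    generalize polyGerm p = x
    generalize polyGerm q = y
    induction x using Germ.inductionOn with | _ x
    induction y using Germ.inductionOn with | _ y
    exact congrArg (fun f : ℝ → ℝ[X] => (f : (𝓝 (0 : ℝ)).Germ ℝ[X]))
      (funext fun _ => (derivative_add).symm)
  | monomial n γ =>
    obtain ⟨f, hf, rfl⟩ := analyticGerms.exists_mk γ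
    rw [← C_mul_X_pow_eq_monomial, derivative_C_mul, derivative_X_pow, map_mul, map_mul, map_mul,
      map_pow, map_pow, polyGerm_C, polyGerm_X, map_natCast, map_natCast]
    refine congrArg (fun f : ℝ → ℝ[X] => (f : (𝓝 (0 : ℝ)).Germ ℝ[X])) (funext fun t => ?_)
    simp [derivative_X_pow]

/-- The Bézout identity for the polynomial and its derivative holds pointwise near 0, with a nonzero
germ on the right, and a nonzero germ does not vanish at small `t ≠ 0`. -/
theorem eventually_separable {a : Fin d → ℝ → ℝ} (ha : ∀ i, AnalyticAt ℝ (a i) 0)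
    (h : Squarefree ((monicPoly fun i => analyticGerms.mk (𝓝 0) (a i) (ha i)).map
      (algebraMap _ (FractionRing (analyticGerms (𝓝 (0 : ℝ)) 0))))) :
    ∀ᶠ t in 𝓝[≠] 0, (monicPoly fun i => a i t).Separable := by
  obtain ⟨A, B, δ, hδ, hAB⟩ := exists_bezout_derivative h
  obtain ⟨f, hf, rfl⟩ := analyticGerms.exists_mk δ
  have h1 := congrArg polyGerm hAB
  rw [map_add, map_mul, map_mul, polyGerm_derivative, polyGerm_monicPoly, polyGerm_C] at h1
  generalize polyGerm A = x at h1
  generalize polyGerm B = y at h1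
  induction x using Germ.inductionOn with | _ x
  induction y using Germ.inductionOn with | _ y
  have h2 : ∀ᶠ t in 𝓝 (0 : ℝ), x t * (monicPoly fun i => a i t) +
      y t * derivative (monicPoly fun i => a i t) = C (f t) := Germ.coe_eq.1 h1
  have h3 : ∀ᶠ t in 𝓝[≠] 0, f t ≠ 0 :=
    hf.eventually_eq_zero_or_eventually_ne_zero.resolve_left fun h0 =>
      hδ (analyticGerms.mk_eq_zero.2 h0)
  filter_upwards [eventually_nhdsWithin_of_eventually_nhds h2, h3] with t ht hft
  refine ⟨C (f t)⁻¹ * x t, C (f t)⁻¹ * y t, ?_⟩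
  rw [mul_assoc, mul_assoc, ← mul_add, ht, ← C_mul, inv_mul_cancel₀ hft, C_1]

/-- A function whose germ is integral over the germs in one coordinate is a root of a Weierstrass
polynomial. -/
theorem exists_weierstrass_of_isIntegralElem (hl : l ≤ 𝓝 z) (π : E →L[ℝ] ℝ) {ξ : E → ℝ}
    (hξ : AnalyticAt ℝ ξ z) (hξ0 : ξ z = 0)
    (h : (coordHom hl π).IsIntegralElem (analyticGerms.mk l ξ hξ)) :
    ∃ P : (analyticGerms (𝓝 (0 : ℝ)) 0)[X], P.Monic ∧
      P.map (analyticGerms.value (0 : ℝ)) = X ^ P.natDegree ∧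
      P.eval₂ (coordHom hl π) (analyticGerms.mk l ξ hξ) = 0 := by
  obtain ⟨p, hp, hp0⟩ := h
  choose c hc hpc using fun i => analyticGerms.exists_mk (p.coeff i)
  rw [hp.eq_monicPoly rfl] at hp0
  simp only [hpc] at hp0
  rw [eval₂_coordHom_monicPoly_eq_zero] at hp0
  -- The integral equation may have roots other than 0 over the origin. Weierstrass preparation
  -- applied to it as a function of two variables discards them.
  let f : (Unit ⊕ Unit → ℝ) → ℝ := fun y =>
    aeval (y (Sum.inr ())) (monicPoly fun i : Fin p.natDegree => c i (y (Sum.inl ())))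
  have hproj : ∀ i, AnalyticAt ℝ (fun y : Unit ⊕ Unit → ℝ => y i) 0 := fun i =>
    (ContinuousLinearMap.proj (R := ℝ) (φ := fun _ : Unit ⊕ Unit => ℝ) i).analyticAt 0
  have hf : AnalyticAt ℝ f 0 := by
    simp only [f, aeval_monicPoly, Algebra.algebraMap_self, RingHom.id_apply]
    exact ((hproj _).pow _).fun_add (Finset.analyticAt_fun_sum _ fun i _ =>
      (AnalyticAt.fun_comp (g := c i) (f := fun y : Unit ⊕ Unit → ℝ => y (Sum.inl ())) (hc i)
        (hproj _)).fun_mul ((hproj _).pow _))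
  have hne : ¬ ∀ᶠ y in 𝓝 (0 : ℝ), f (lastCoord 0 y) = 0 := fun h0 => by
    refine infinite_of_mem_nhds (0 : ℝ) h0 ?_
    refine (finite_setOfPred_isRoot (p := monicPoly fun i : Fin p.natDegree => c i 0)
      (monic_monicPoly _).ne_zero).subset fun y hy => ?_
    have : aeval y (monicPoly fun i : Fin p.natDegree => c i 0) = 0 := hy
    rwa [coe_aeval_eq_eval] at this
  obtain ⟨d, a, ha, ha0, haf⟩ := exists_monicPoly hf hne
  let e : ℝ →L[ℝ] (Unit → ℝ) := ContinuousLinearMap.pi fun _ => ContinuousLinearMap.id ℝ ℝ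
  have hb : ∀ i, AnalyticAt ℝ (fun t => a i (e t)) 0 := fun i =>
    AnalyticAt.fun_comp (g := a i) (by rw [map_zero]; exact ha i) (e.analyticAt 0)
  refine ⟨monicPoly fun i => analyticGerms.mk (𝓝 0) _ (hb i), monic_monicPoly _, ?_, ?_⟩
  · rw [map_monicPoly, natDegree_monicPoly]
    simp only [analyticGerms.value_mk, map_zero, ha0, monicPoly_zero]
  · rw [eval₂_coordHom_monicPoly_eq_zero]
    have ht : Tendsto (fun x => (Sum.elim (fun _ => π (x - z)) fun _ => ξ x : Unit ⊕ Unit → ℝ)) l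
        (𝓝 0) := by
      rw [tendsto_pi_nhds]
      rintro (i | i)
      · exact tendsto_map_sub hl π
      · exact (hξ0 ▸ hξ.continuousAt.tendsto : Tendsto ξ (𝓝 z) (𝓝 0)).mono_left hl
    filter_upwards [ht.eventually haf, hp0] with x hx hpx
    exact hx hpx

/-- Finitely many linear coordinates on a germ that is integral over one coordinate are roots of a
common Weierstrass polynomial, which is separable outside the origin. -/
theorem exists_separable_weierstrass {ι : Type*} [Fintype ι] (hl : l ≤ 𝓝 z) {π : E →L[ℝ] ℝ}
    (hπ : (coordHom hl π).IsIntegral) (ξ : ι → E →L[ℝ] ℝ) :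
    ∃ (d : ℕ) (a : Fin (d + 1) → ℝ → ℝ), (∀ i, AnalyticAt ℝ (a i) 0) ∧ (∀ i, a i 0 = 0) ∧
      (∀ᶠ t in 𝓝[≠] 0, (monicPoly fun i => a i t).Separable) ∧
      ∀ᶠ x in l, ∀ j, aeval (ξ j (x - z)) (monicPoly fun i => a i (π (x - z))) = 0 := by
  have h1 := fun j => exists_weierstrass_of_isIntegralElem hl π (analyticAt_map_sub z (ξ j))
    (by simp) (hπ _)
  choose P hP hP0 hPξ using h1
  -- The factor `X` guarantees positive degree, also for empty `ι`.
  set p : (analyticGerms (𝓝 (0 : ℝ)) 0)[X] := X * ∏ j, P j with hp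
  have hpm : p.Monic := monic_X.mul (monic_prod_of_monic _ _ fun j _ => hP j)
  obtain ⟨q, hq, hqp, ⟨N, hN⟩, hsq⟩ := exists_squarefree_part
    (FractionRing (analyticGerms (𝓝 (0 : ℝ)) 0)) hpm
  have hp0 : p.map (analyticGerms.value (0 : ℝ)) = X ^ (1 + ∑ j, (P j).natDegree) := by
    rw [hp, Polynomial.map_mul, map_X, Polynomial.map_prod, pow_add, pow_one,
      ← Finset.prod_pow_eq_pow_sum]
    simp only [hP0]
  have hq0 : q.map (analyticGerms.value (0 : ℝ)) = X ^ q.natDegree := by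
    have h2 : q.map (analyticGerms.value (0 : ℝ)) ∣ X ^ (1 + ∑ j, (P j).natDegree) :=
      hp0 ▸ Polynomial.map_dvd _ hqp
    obtain ⟨i, -, hi⟩ := (dvd_prime_pow prime_X _).1 h2
    have h3 := eq_of_monic_of_associated (hq.map _) (monic_X_pow i) hi
    have h4 := congrArg natDegree h3
    rw [hq.natDegree_map, natDegree_X_pow] at h4
    rw [h3, h4]
  have hqd : q.natDegree ≠ 0 := fun h => by
    rw [hq.natDegree_eq_zero.1 h, one_pow] at hN
    have := natDegree_eq_zero_of_isUnit (isUnit_of_dvd_one hN)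
    rw [hp, monic_X.natDegree_mul (monic_prod_of_monic _ _ fun j _ => hP j), natDegree_X] at this
    omega
  obtain ⟨d, hd⟩ := Nat.exists_eq_succ_of_ne_zero hqd
  choose c hc hqc using fun i => analyticGerms.exists_mk (q.coeff i)
  have hqe : q = monicPoly fun i : Fin (d + 1) => analyticGerms.mk (𝓝 0) (c i) (hc i) := by
    rw [hq.eq_monicPoly hd]
    simp only [hqc]
  refine ⟨d, fun i => c i, fun i => hc i, fun i => ?_, eventually_separable _ (hqe ▸ hsq), ?_⟩
  · have := congrArg (fun f => f.coeff i) hq0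
    simp only [coeff_map, hqc, analyticGerms.value_mk, coeff_X_pow, hd] at this
    exact this.trans (if_neg (by have := i.2; omega))
  · refine eventually_all.2 fun j => ?_
    rw [← eval₂_coordHom_monicPoly_eq_zero hl π (fun i => hc i) (analyticAt_map_sub z (ξ j)), ← hqe]
    -- A power of the squarefree part vanishes at the coordinate, and germs of real functions have
    -- no nilpotents.
    have h2 : q.eval₂ (coordHom hl π) (analyticGerms.mk l _ (analyticAt_map_sub z (ξ j))) ^ N = 0 := by
      rw [← eval₂_pow]
      refine eval₂_eq_zero_of_dvd_of_eval₂_eq_zero _ _ hN ?_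
      rw [hp, eval₂_mul, eval₂_finsetProd, Finset.prod_eq_zero (Finset.mem_univ j) (hPξ j), mul_zero]
    generalize q.eval₂ (coordHom hl π) (analyticGerms.mk l _ (analyticAt_map_sub z (ξ j))) = γ at h2 ⊢
    obtain ⟨f, hf, rfl⟩ := analyticGerms.exists_mk γ
    rw [analyticGerms.mk_eq_zero]
    refine (analyticGerms.mk_eq_zero (hf := hf.pow N)).1 h2 |>.mono fun x hx => ?_
    exact eq_zero_of_pow_eq_zero hx

end PolyGerm

/-! ### Continuity of the roots of a polynomial -/

section Roots

open Polynomial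

variable {m : ℕ}

/-- The value at `r` is the product of the differences between `r` and the roots. -/
theorem pow_natDegree_le_norm_eval {p : ℂ[X]} (hp : p.Monic) {r : ℂ} {η : ℝ} (hη : 0 ≤ η)
    (h : ∀ w, p.IsRoot w → η ≤ ‖r - w‖) : η ^ p.natDegree ≤ ‖p.eval r‖ := by
  have hs := IsAlgClosed.splits p
  have hroots : ∀ s : Multiset ℂ, (∀ w ∈ s, η ≤ ‖r - w‖) →
      η ^ Multiset.card s ≤ ‖(s.map fun w => r - w).prod‖ := by
    intro s
    induction s using Multiset.induction_on with
    | empty => simp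
    | cons w s ih =>
      intro hw
      rw [Multiset.card_cons, pow_succ', Multiset.map_cons, Multiset.prod_cons, norm_mul]
      exact mul_le_mul (hw w (Multiset.mem_cons_self _ _))
        (ih fun v hv => hw v (Multiset.mem_cons_of_mem hv)) (pow_nonneg hη _) (norm_nonneg _)
  have h1 : p.eval r = (p.roots.map fun w => r - w).prod := by
    conv_lhs => rw [hs.eq_prod_roots_of_monic hp]
    rw [eval_multiset_prod, Multiset.map_map]
    simp
  rw [h1, hs.natDegree_eq_card_roots]
  exact hroots _ fun w hw => h w ((mem_roots hp.ne_zero).1 hw)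

theorem eventually_exists_root_near {a : Fin m → ℝ → ℝ} {t₀ : ℝ} (ha : ∀ i, ContinuousAt (a i) t₀)
    {r : ℂ} (hr : aeval r (monicPoly fun i => a i t₀) = 0) {η : ℝ} (hη : 0 < η) :
    ∀ᶠ t in 𝓝 t₀, ∃ w : ℂ, aeval w (monicPoly fun i => a i t) = 0 ∧ ‖w - r‖ < η := by
  have h1 : Tendsto (fun t => ‖aeval r (monicPoly fun i => a i t)‖) (𝓝 t₀) (𝓝 0) := by
    rw [← norm_zero (E := ℂ), ← hr]
    simp only [aeval_monicPoly]
    refine (tendsto_const_nhds.add (tendsto_finsetSum _ fun i _ => ?_)).norm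
    exact ((Complex.continuous_ofReal.tendsto _).comp (ha i).tendsto).mul_const _
  filter_upwards [h1.eventually_lt_const (pow_pos hη m)] with t ht
  by_contra! h
  refine absurd ht (not_lt.2 ?_)
  have h2 := pow_natDegree_le_norm_eval (p := (monicPoly fun i => a i t).map (algebraMap ℝ ℂ))
    (r := r) ((monic_monicPoly _).map _) hη.le fun w hw => by
      rw [norm_sub_rev]
      exact h w (by rwa [IsRoot.def, eval_map_algebraMap] at hw)
  rwa [(monic_monicPoly _).natDegree_map, natDegree_monicPoly, eval_map_algebraMap] at h2

/-- The complex roots of a monic polynomial with real coefficients. -/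
noncomputable def complexRoots (c : Fin m → ℝ) : Finset ℂ := ((monicPoly c).aroots ℂ).toFinset

theorem mem_complexRoots {c : Fin m → ℝ} {w : ℂ} :
    w ∈ complexRoots c ↔ aeval w (monicPoly c) = 0 := by
  rw [complexRoots, Multiset.mem_toFinset, mem_aroots]
  exact and_iff_right (monic_monicPoly c).ne_zero

theorem card_complexRoots_le (c : Fin m → ℝ) : (complexRoots c).card ≤ m := by
  refine (Multiset.toFinset_card_le _).trans ?_
  have := card_roots' ((monicPoly c).map (algebraMap ℝ ℂ))
  rwa [(monic_monicPoly _).natDegree_map, natDegree_monicPoly] at this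

theorem card_complexRoots {c : Fin m → ℝ} (hc : (monicPoly c).Separable) :
    (complexRoots c).card = m := by
  rw [complexRoots, Multiset.toFinset_card_of_nodup, IsAlgClosed.card_aroots_eq_natDegree,
    natDegree_monicPoly]
  exact nodup_roots hc.map

theorem conj_mem_complexRoots {c : Fin m → ℝ} {w : ℂ} (h : w ∈ complexRoots c) :
    starRingEnd ℂ w ∈ complexRoots c := by
  rw [mem_complexRoots, aeval_monicPoly] at *
  have := congrArg (starRingEnd ℂ) h
  simpa using this

/-- The real roots of a monic polynomial. -/
noncomputable def realRoots (c : Fin m → ℝ) : Finset ℝ := (monicPoly c).roots.toFinset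

theorem mem_realRoots {c : Fin m → ℝ} {x : ℝ} : x ∈ realRoots c ↔ aeval x (monicPoly c) = 0 := by
  rw [realRoots, Multiset.mem_toFinset, mem_roots (monic_monicPoly c).ne_zero, IsRoot.def,
    coe_aeval_eq_eval]

theorem ofReal_mem_complexRoots {c : Fin m → ℝ} {x : ℝ} :
    (x : ℂ) ∈ complexRoots c ↔ x ∈ realRoots c := by
  rw [mem_complexRoots, mem_realRoots]
  exact (aeval_algebraMap_eq_zero_iff ℂ x _)

/-- The real roots of a polynomial with simple roots move continuously and in order. -/
theorem eventually_exists_realRoots_near {a : Fin m → ℝ → ℝ} {t₀ : ℝ}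
    (ha : ∀ i, ContinuousAt (a i) t₀) (hsep : (monicPoly fun i => a i t₀).Separable) {η : ℝ}
    (hη : 0 < η) : ∀ᶠ t in 𝓝 t₀, ∃ f : ℝ → ℝ,
      StrictMonoOn f (realRoots fun i => a i t₀) ∧
      f '' (realRoots fun i => a i t₀) = realRoots (fun i => a i t) ∧
      ∀ r ∈ realRoots fun i => a i t₀, |f r - r| < η := by
  set S := complexRoots fun i => a i t₀ with hS
  -- Open discs of radius `η'` around the distinct roots at `t₀` are disjoint. For `t` near `t₀`
  -- each contains a root, hence exactly one, as there are as many discs as the degree.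
  obtain ⟨η', hη', hη'le, hdist⟩ : ∃ η' > 0, η' ≤ η ∧
      ∀ r ∈ S, ∀ r' ∈ S, r ≠ r' → 2 * η' ≤ ‖r - r'‖ := by
    obtain ⟨c, hc, hcS⟩ : ∃ c > 0, ∀ q ∈ S.offDiag, c ≤ ‖q.1 - q.2‖ := by
      rcases S.offDiag.eq_empty_or_nonempty with h | h
      · exact ⟨1, one_pos, by simp [h]⟩
      · obtain ⟨q, hq, hqmin⟩ := S.offDiag.exists_min_image (fun q => ‖q.1 - q.2‖) h
        exact ⟨_, norm_pos_iff.2 (sub_ne_zero.2 (Finset.mem_offDiag.1 hq).2.2), hqmin⟩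
    refine ⟨min η (c / 2), lt_min hη (half_pos hc), min_le_left _ _, fun r hr r' hr' hne => ?_⟩
    have := hcS (r, r') (Finset.mem_offDiag.2 ⟨hr, hr', hne⟩)
    have h2 := min_le_right η (c / 2)
    linarith
  have hev : ∀ᶠ t in 𝓝 t₀, ∀ r ∈ S, ∃ w ∈ complexRoots fun i => a i t, ‖w - r‖ < η' := by
    refine (Finset.eventually_all S).2 fun r hr => ?_
    filter_upwards [eventually_exists_root_near ha (mem_complexRoots.1 hr) hη'] with t ht
    obtain ⟨w, hw, hwr⟩ := ht
    exact ⟨w, mem_complexRoots.2 hw, hwr⟩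
  filter_upwards [hev] with t ht
  have : ∀ r, ∃ w, r ∈ S → w ∈ (complexRoots fun i => a i t) ∧ ‖w - r‖ < η' := fun r => by
    by_cases hr : r ∈ S
    · obtain ⟨w, hw⟩ := ht r hr
      exact ⟨w, fun _ => hw⟩
    · exact ⟨0, fun h => absurd h hr⟩
  choose g hg using this
  have hclose : ∀ {r r' w : ℂ}, r ∈ S → r' ∈ S → ‖w - r‖ < η' → ‖w - r'‖ < η' → r = r' := by
    intro r r' w hr hr' h h'
    by_contra hne
    have h1 := hdist r hr r' hr' hne
    have h2 : ‖r - r'‖ ≤ ‖w - r'‖ + ‖w - r‖ := by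
      have : r - r' = (w - r') - (w - r) := by ring
      rw [this]; exact norm_sub_le _ _
    linarith
  have hinj : InjOn g S := fun r hr r' hr' h =>
    hclose hr hr' (hg r hr).2 (by rw [h]; exact (hg r' hr').2)
  have himage : S.image g = complexRoots fun i => a i t := by
    refine Finset.eq_of_subset_of_card_le (Finset.image_subset_iff.2 fun r hr => (hg r hr).1) ?_
    rw [Finset.card_image_of_injOn hinj, hS, card_complexRoots hsep]
    exact card_complexRoots_le _
  have huniq : ∀ {w r : ℂ}, w ∈ (complexRoots fun i => a i t) → r ∈ S → ‖w - r‖ < η' → w = g r := by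
    intro w r hw hr hwr
    rw [← himage, Finset.mem_image] at hw
    obtain ⟨r', hr', rfl⟩ := hw
    rw [hclose hr' hr (hg r' hr').2 hwr]
  -- The root near a real root is as close to it as its own conjugate, so the two agree.
  have hreal : ∀ r ∈ realRoots fun i => a i t₀, ((g r).re : ℂ) = g r := by
    intro r hr
    have hrS : (r : ℂ) ∈ S := ofReal_mem_complexRoots.2 hr
    rw [← Complex.conj_eq_iff_re]
    refine huniq (conj_mem_complexRoots (hg _ hrS).1) hrS ?_
    have : starRingEnd ℂ (g r) - r = starRingEnd ℂ (g r - r) := by simp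
    rw [this, Complex.norm_conj]
    exact (hg _ hrS).2
  have hnear : ∀ r ∈ realRoots fun i => a i t₀, |(g r).re - r| < η' := by
    intro r hr
    have := (hg r (ofReal_mem_complexRoots.2 hr)).2
    rw [← hreal r hr, ← Complex.ofReal_sub, Complex.norm_real] at this
    exact this
  refine ⟨fun r => (g r).re, fun r hr r' hr' hlt => ?_, ?_, fun r hr =>
    (hnear r hr).trans_le hη'le⟩
  · have h1 := hdist r (ofReal_mem_complexRoots.2 hr) r' (ofReal_mem_complexRoots.2 hr')
      (by exact_mod_cast hlt.ne)
    rw [← Complex.ofReal_sub, Complex.norm_real, Real.norm_eq_abs, abs_sub_comm,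
      abs_of_pos (sub_pos.2 hlt)] at h1
    have h2 := (abs_lt.1 (hnear r hr)).2
    have h3 := (abs_lt.1 (hnear r' hr')).1
    change (g r).re < (g r').re
    linarith
  · ext x
    constructor
    · rintro ⟨r, hr, rfl⟩
      refine ofReal_mem_complexRoots.1 ?_
      change (((g r).re : ℝ) : ℂ) ∈ _
      rw [hreal r hr]
      exact (hg r (ofReal_mem_complexRoots.2 hr)).1
    · intro hx
      have hxc : (x : ℂ) ∈ complexRoots fun i => a i t := ofReal_mem_complexRoots.2 hx
      rw [← himage, Finset.mem_image] at hxc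
      obtain ⟨r, hr, hrx⟩ := hxc
      -- Conversely, a real root near `r` is equally near the conjugate of `r`, so `r` is real.
      have hre : ((r.re : ℝ) : ℂ) = r := by
        rw [← Complex.conj_eq_iff_re]
        have hcr : starRingEnd ℂ r ∈ S := conj_mem_complexRoots hr
        refine hclose hcr hr (w := x) ?_ (hrx ▸ (hg r hr).2)
        have : (x : ℂ) - starRingEnd ℂ r = starRingEnd ℂ (x - r) := by simp
        rw [this, Complex.norm_conj]
        exact hrx ▸ (hg r hr).2
      refine ⟨r.re, ?_, ?_⟩
      · refine ofReal_mem_complexRoots.1 ?_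
        rw [hre]; exact hr
      · change (g (r.re : ℂ)).re = x
        rw [hre, hrx, Complex.ofReal_re]

/-- Continuous enumeration of the real roots of a family of polynomials with simple roots. -/
theorem exists_continuousOn_realRoots {a : Fin m → ℝ → ℝ} {ε : ℝ}
    (ha : ∀ i, ∀ t ∈ Ioo 0 ε, ContinuousAt (a i) t)
    (hsep : ∀ t ∈ Ioo 0 ε, (monicPoly fun i => a i t).Separable) :
    ∃ (k : ℕ) (u : Fin k → ℝ → ℝ), (∀ i, ∀ t ∈ Ioo 0 ε, ContinuousAt (u i) t) ∧
      ∀ t ∈ Ioo 0 ε, (Function.Injective fun i => u i t) ∧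
        ∀ x, aeval x (monicPoly fun i => a i t) = 0 ↔ ∃ i, u i t = x := by
  have hloc : ∀ t₀ ∈ Ioo 0 ε, ∀ᶠ t in 𝓝 t₀,
      (realRoots fun i => a i t).card = (realRoots fun i => a i t₀).card := by
    intro t₀ ht₀
    filter_upwards [eventually_exists_realRoots_near (fun i => ha i t₀ ht₀) (hsep t₀ ht₀) one_pos]
      with t ht
    obtain ⟨f, hf, himg, -⟩ := ht
    rw [← Set.ncard_coe_finset, ← Set.ncard_coe_finset, ← himg, hf.injOn.ncard_image]
  -- The number of real roots is locally constant, hence constant. Nearby root sets correspond in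
  -- order, which makes the increasing enumeration continuous.
  obtain ⟨k, hk⟩ : ∃ k, ∀ t ∈ Ioo 0 ε, (realRoots fun i => a i t).card = k := by
    rcases (Ioo 0 ε).eq_empty_or_nonempty with h | ⟨t₁, ht₁⟩
    · exact ⟨0, by simp [h]⟩
    · refine ⟨(realRoots fun i => a i t₁).card, fun t ht => ?_⟩
      refine isPreconnected_Ioo.constant (f := fun t => (realRoots fun i => a i t).card)
        (fun t₀ ht₀ => ContinuousAt.continuousWithinAt ?_) ht ht₁
      exact (continuousAt_const (y := (realRoots fun i => a i t₀).card)).congr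
        ((hloc t₀ ht₀).mono fun _ h => h.symm)
  classical
  refine ⟨k, fun i t => if h : (realRoots fun i => a i t).card = k then
    (realRoots fun i => a i t).orderEmbOfFin h i else 0, fun i t₀ ht₀ => ?_, fun t ht => ⟨?_, ?_⟩⟩
  · rw [Metric.continuousAt_iff']
    intro η hη
    filter_upwards [eventually_exists_realRoots_near (fun i => ha i t₀ ht₀) (hsep t₀ ht₀) hη,
      isOpen_Ioo.mem_nhds ht₀] with t ht htI
    obtain ⟨f, hf, himg, hnear⟩ := ht
    rw [dif_pos (hk t htI), dif_pos (hk t₀ ht₀), Real.dist_eq]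
    have h1 : (fun j => f ((realRoots fun i => a i t₀).orderEmbOfFin (hk t₀ ht₀) j)) =
        (realRoots fun i => a i t).orderEmbOfFin (hk t htI) := by
      refine Finset.orderEmbOfFin_unique _ (fun j => ?_) fun j j' hjj' => ?_
      · rw [← Finset.mem_coe, ← himg]
        exact mem_image_of_mem _ (Finset.orderEmbOfFin_mem _ _ _)
      · exact hf (Finset.orderEmbOfFin_mem _ _ _) (Finset.orderEmbOfFin_mem _ _ _)
          ((OrderEmbedding.strictMono _) hjj')
    rw [← congrFun h1 i]
    exact hnear _ (Finset.orderEmbOfFin_mem _ _ _)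
  · simp only [dif_pos (hk t ht)]
    exact RelEmbedding.injective _
  · intro x
    simp only [dif_pos (hk t ht)]
    rw [← mem_realRoots, ← Finset.mem_coe, ← Finset.range_orderEmbOfFin _ (hk t ht)]
    rfl

end Roots

/-! ### Counting solutions -/

section Vandermonde

open Polynomial

variable {ν : Type*} [Fintype ν] [DecidableEq ν] {m : ℕ}

/-- The tensor power of a Vandermonde matrix. -/
noncomputable def tensorVandermonde (r : Fin m → ℂ) : Matrix (ν → Fin m) (ν → Fin m) ℂ :=
  Matrix.of fun J K => ∏ i, r (J i) ^ (K i : ℕ)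

/-- A vector in the kernel is the coefficient vector of a polynomial of degree less than `m` in each
variable that vanishes on a grid with `m` values per variable; such a polynomial is zero. -/
theorem det_tensorVandermonde_ne_zero {r : Fin m → ℂ} (hr : Function.Injective r) :
    (tensorVandermonde (ν := ν) r).det ≠ 0 := by
  intro h
  obtain ⟨v, hv, hv0⟩ := Matrix.exists_mulVec_eq_zero_iff.2 h
  let e : (ν → Fin m) → ν →₀ ℕ := fun K => Finsupp.equivFunOnFinite.symm fun i => (K i : ℕ)
  have he : Function.Injective e := fun K L h => by
    ext i
    exact DFunLike.congr_fun h i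
  let p : MvPolynomial ν ℂ := ∑ K, MvPolynomial.monomial (e K) (v K)
  have hp : p = 0 := by
    refine MvPolynomial.eq_zero_of_eval_zero_at_prod_finset p (fun _ => Finset.univ.image r)
      (fun i => ?_) fun x hx => ?_
    · rw [Finset.card_image_of_injective _ hr, Finset.card_univ, Fintype.card_fin]
      obtain ⟨K₀, -⟩ := Function.ne_iff.1 hv
      have hm : 0 < m := (K₀ i).pos
      refine (MvPolynomial.degreeOf_sum_le _ _ _).trans_lt ((Finset.sup_lt_iff hm).2 fun K _ => ?_)
      by_cases hK : v K = 0
      · rw [hK, map_zero, MvPolynomial.degreeOf_zero]; exact hm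
      · rw [MvPolynomial.degreeOf_monomial_eq _ _ hK]
        exact (K i).2
    · choose J hJ using fun i => Finset.mem_image.1 (hx i)
      have := congrFun hv0 J
      simp only [p, map_sum, MvPolynomial.eval_monomial]
      rw [← Pi.zero_apply (M := fun _ => ℂ) J, ← this]
      refine Finset.sum_congr rfl fun K _ => ?_
      rw [mul_comm, Finsupp.prod_fintype _ _ (by simp)]
      simp [tensorVandermonde, e, (hJ _).2]
  refine hv (funext fun K => ?_)
  have h1 := congrArg (MvPolynomial.coeff (e K)) hp
  simp only [p, MvPolynomial.coeff_sum, MvPolynomial.coeff_monomial, he.eq_iff,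
    MvPolynomial.coeff_zero] at h1
  simpa using h1

theorem charpoly_eq_prod_of_mul_eq {n : Type*} [Fintype n] [DecidableEq n] {W A : Matrix n n ℂ}
    {h : n → ℂ} (hW : W.det ≠ 0) (hA : W * A = Matrix.diagonal h * W) :
    A.charpoly = ∏ J, (X - C (h J)) := by
  have hu : IsUnit W := (Matrix.isUnit_iff_isUnit_det _).2 hW.isUnit
  have h1 : A = (hu.unit⁻¹ : (Matrix n n ℂ)ˣ).val * Matrix.diagonal h * hu.unit.val := by
    rw [mul_assoc, IsUnit.unit_spec, ← hA, ← mul_assoc, IsUnit.val_inv_mul, one_mul]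
  rw [h1, Matrix.coe_units_inv, Matrix.charpoly_units_conj', Matrix.charpoly_diagonal]

/-- The multiplicity of the root 0 is the index of the lowest nonzero coefficient. -/
theorem card_filter_eq_zero_of_coeff {n : Type*} [Fintype n] [DecidableEq n] {h : n → ℂ} {e : ℕ}
    (h0 : ∀ i < e, (∏ J, (X - C (h J))).coeff i = 0) (he : (∏ J, (X - C (h J))).coeff e ≠ 0) :
    (Finset.univ.filter fun J => h J = 0).card = e := by
  set p : ℂ[X] := ∏ J, (X - C (h J)) with hp
  have hpm : p.Monic := monic_prod_of_monic _ _ fun J _ => monic_X_sub_C _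
  have h1 : p.natTrailingDegree = e :=
    le_antisymm (natTrailingDegree_le_of_ne_zero he)
      (le_natTrailingDegree hpm.ne_zero fun i hi => h0 i hi)
  rw [← h1, ← rootMultiplicity_eq_natTrailingDegree', ← count_roots, hp,
    roots_prod _ _ hpm.ne_zero, Multiset.count_bind]
  simp only [roots_X_sub_C, Multiset.count_singleton]
  rw [Finset.card_filter]
  simp only [eq_comm]
  rfl

end Vandermonde

/-! ### Generic multiplicity of the eigenvalue zero -/

section Generic

open Polynomial

theorem analyticAt_aeval {σ : Type*} {f : ℝ → σ → ℝ} {z : ℝ}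
    (hf : ∀ i, AnalyticAt ℝ (fun x => f x i) z) (p : MvPolynomial σ ℝ) :
    AnalyticAt ℝ (fun x => MvPolynomial.aeval (f x) p) z :=
  AnalyticAt.aeval_mvPolynomial hf p

/-- The multiplicity of the eigenvalue zero in an analytic family of matrices is constant outside
the origin. -/
theorem exists_generic_coeff_charpoly {n : Type*} [Fintype n] [DecidableEq n]
    {A : ℝ → Matrix n n ℝ} (hA : ∀ i j, AnalyticAt ℝ (fun t => A t i j) 0) :
    (∀ i, AnalyticAt ℝ (fun t => (A t).charpoly.coeff i) 0) ∧
    ∃ e : ℕ, (∀ i < e, ∀ᶠ t in 𝓝[≠] 0, (A t).charpoly.coeff i = 0) ∧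
      ∀ᶠ t in 𝓝[≠] 0, (A t).charpoly.coeff e ≠ 0 := by
  have han : ∀ i, AnalyticAt ℝ (fun t => (A t).charpoly.coeff i) 0 := by
    intro i
    have h1 : ∀ t, (A t).charpoly.coeff i = MvPolynomial.aeval (fun q : n × n => A t q.1 q.2)
        ((Matrix.charpoly.univ ℝ n).coeff i) := fun t =>
      (Matrix.charpoly.univ_coeff_eval₂Hom n (algebraMap ℝ ℝ) (fun q : n × n => A t q.1 q.2) i).symm
    generalize (Matrix.charpoly.univ ℝ n).coeff i = p at h1
    simp only [h1]
    exact analyticAt_aeval (f := fun t (q : n × n) => A t q.1 q.2) (fun q => hA q.1 q.2) p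
  refine ⟨han, ?_⟩
  have hex : ∃ e, ∀ᶠ t in 𝓝[≠] 0, (A t).charpoly.coeff e ≠ 0 := by
    refine ⟨Fintype.card n, Eventually.of_forall fun t => ?_⟩
    have := (A t).charpoly_monic.coeff_natDegree
    rw [Matrix.charpoly_natDegree_eq_dim] at this
    rw [this]; exact one_ne_zero
  classical
  -- An analytic coefficient either vanishes identically near 0 or is nonzero on both sides of it.
  -- This dichotomy is what makes `e` the same for positive and negative `t`.
  refine ⟨Nat.find hex, fun i hi => ?_, Nat.find_spec hex⟩
  exact eventually_nhdsWithin_of_eventually_nhds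
    ((han i).eventually_eq_zero_or_eventually_ne_zero.resolve_right (Nat.find_min hex hi))

end Generic

/-! ### Parity of the number of real solutions -/

section Counting

open Polynomial

theorem card_filter_fixed_modEq {α : Type*} [DecidableEq α] (s : Finset α) (g : α → α)
    (hs : ∀ a ∈ s, g a ∈ s) (hg : ∀ a ∈ s, g (g a) = a) :
    (s.filter fun a => g a = a).card ≡ s.card [MOD 2] := by
  have h1 : ∑ a ∈ s, (if g a = a then 0 else 1 : ZMod 2) = 0 := by
    refine Finset.sum_involution (fun a _ => g a) (fun a ha => ?_) (fun a ha h h' => ?_)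
      (fun a ha => hs a ha) fun a ha => hg a ha
    · rw [hg a ha]
      by_cases h : g a = a
      · rw [if_pos h, if_pos h.symm]; rfl
      · rw [if_neg h, if_neg (Ne.symm h)]; rfl
    · exact h (if_pos h')
  rw [← ZMod.natCast_eq_natCast_iff, Finset.card_filter, Finset.card_eq_sum_ones, Nat.cast_sum,
    Nat.cast_sum, ← sub_eq_zero, ← neg_sub, neg_eq_zero, ← Finset.sum_sub_distrib, ← h1]
  refine Finset.sum_congr rfl fun a _ => ?_
  split_ifs <;> simp

variable {ν : Type*} [Fintype ν] [DecidableEq ν] {d : ℕ} {a : Fin (d + 1) → ℝ → ℝ}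
  {G : (Unit ⊕ ν → ℝ) → ℝ}

/-- The point with a given parameter and given coordinates. -/
abbrev withParam (t : ℝ) (w : ν → ℝ) : Unit ⊕ ν → ℝ := Sum.elim (fun _ => t) w

omit [DecidableEq ν] in
-- The roots of a Weierstrass polynomial tend to 0 with the parameter, so all tuples of real roots
-- eventually lie in any given neighborhood of the origin.
theorem eventually_withParam (ha : ∀ l, AnalyticAt ℝ (a l) 0) (ha0 : ∀ l, a l 0 = 0)
    {p : (Unit ⊕ ν → ℝ) → Prop} (hp : ∀ᶠ z in 𝓝 0, p z) :
    ∀ᶠ t in 𝓝 0, ∀ w : ν → ℝ, (∀ i, aeval (w i) (monicPoly fun l => a l t) = 0) →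
      p (withParam t w) := by
  obtain ⟨δ, hδ, hpδ⟩ := Metric.eventually_nhds_iff_ball.1 hp
  have h1 := eventually_forall_root_norm_lt (κ := Unit) (a := fun l x => a l (x ()))
    (fun l => ContinuousAt.comp (g := a l) (f := fun x : Unit → ℝ => x ()) (ha l).continuousAt
      (continuous_apply _).continuousAt) ha0 hδ
  have h2 : Tendsto (fun (t : ℝ) (_ : Unit) => t) (𝓝 0) (𝓝 0) :=
    Continuous.tendsto' (by fun_prop) _ _ rfl
  filter_upwards [h2.eventually h1, Metric.ball_mem_nhds (0 : ℝ) hδ] with t ht htδ w hw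
  refine hpδ _ ?_
  rw [mem_ball_zero_iff, pi_norm_lt_iff hδ]
  rintro (i | i)
  · simpa using htδ
  · have := ht (w i) ((aeval_algebraMap_eq_zero_iff ℂ (w i) _).2 (hw i))
    simpa using this

/-- An analytic function restricted to the tuples of roots of a Weierstrass polynomial: its values
are the roots of a polynomial with analytic coefficients. -/
theorem exists_value_polynomial (ha : ∀ l, AnalyticAt ℝ (a l) 0) (ha0 : ∀ l, a l 0 = 0)
    (hsep : ∀ᶠ t in 𝓝[≠] 0, (monicPoly fun l => a l t).Separable) (hG : AnalyticAt ℝ G 0) :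
    ∃ (χ : ℝ → ℝ[X]) (H : ℝ → (ν → ℂ) → ℂ) (e N : ℕ),
      (∀ t, (χ t).natDegree = N) ∧ (∀ i, AnalyticAt ℝ (fun t => (χ t).coeff i) 0) ∧
      (∀ i < e, ∀ᶠ t in 𝓝[≠] 0, (χ t).coeff i = 0) ∧ (∀ᶠ t in 𝓝[≠] 0, (χ t).coeff e ≠ 0) ∧
      (∀ᶠ t in 𝓝 0, ∀ w : ν → ℝ, (∀ i, aeval (w i) (monicPoly fun l => a l t) = 0) →
        H t (fun i => (w i : ℂ)) = G (withParam t w) ∧ (χ t).eval (G (withParam t w)) = 0) ∧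
      (∀ᶠ t in 𝓝 0, ∀ z : ν → ℂ, (∀ i, aeval (z i) (monicPoly fun l => a l t) = 0) →
        H t (fun i => starRingEnd ℂ (z i)) = starRingEnd ℂ (H t z)) ∧
      ∀ᶠ t in 𝓝[≠] 0, ((Fintype.piFinset fun _ : ν => complexRoots fun l => a l t).filter
        fun z => H t z = 0).card = e := by
  let c : ℝ →L[ℝ] (Unit → ℝ) := ContinuousLinearMap.pi fun _ => ContinuousLinearMap.id ℝ ℝ
  have hc : Tendsto c (𝓝 0) (𝓝 0) := c.continuous.tendsto' _ _ (map_zero c)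
  obtain ⟨A, ρ, H, hρ, hA, hH, hAH⟩ := exists_normMatrix (κ := Unit) (ν := ν) hG
    (a := fun l x => a l (x ())) (fun l => AnalyticAt.fun_comp (g := a l)
      (f := fun x : Unit → ℝ => x ()) (ha l) ((ContinuousLinearMap.proj (R := ℝ)
        (φ := fun _ : Unit => ℝ) ()).analyticAt 0)) ha0
  have hA' : ∀ J K, AnalyticAt ℝ (fun t => A (c t) J K) 0 := fun J K =>
    AnalyticAt.fun_comp (g := fun x => A x J K) (by rw [map_zero]; exact hA J K) (c.analyticAt 0)
  obtain ⟨han, e, he0, he⟩ := exists_generic_coeff_charpoly hA'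
  have hAc := hc.eventually hAH
  refine ⟨fun t => (A (c t)).charpoly, fun t => H (c t), e, _,
    fun t => Matrix.charpoly_natDegree_eq_dim _, han, he0, he, ?_, ?_, ?_⟩
  · filter_upwards [hAc, eventually_withParam ha ha0 hH] with t ht hHt w hw
    have hHw : H (c t) (fun i => (w i : ℂ)) = G (withParam t w) := hHt w hw
    refine ⟨hHw, ?_⟩
    have h1 := (ht (fun i => (w i : ℂ)) fun i =>
      (aeval_algebraMap_eq_zero_iff ℂ (w i) _).2 (hw i)).2
    rw [hHw] at h1
    have h2 := eval₂_charpoly_eq_zero_of_vecMul_eq (algebraMap ℝ ℂ) (A (c t))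
      (fun J => ∏ i, ((w i : ℂ) / ρ) ^ (J i : ℕ)) _ h1 (K₀ := fun _ => 0) (by simp)
    exact (aeval_algebraMap_eq_zero_iff ℂ (G (withParam t w)) _).1 h2
  · filter_upwards [hAc] with t ht z hz
    exact (ht z hz).1
  · have he0' : ∀ᶠ t in 𝓝[≠] 0, ∀ i < e, (A (c t)).charpoly.coeff i = 0 := by
      have := (Finset.eventually_all (Finset.range e)).2 fun i hi => he0 i (Finset.mem_range.1 hi)
      exact this.mono fun t ht i hi => ht i (Finset.mem_range.2 hi)
    filter_upwards [hsep, eventually_nhdsWithin_of_eventually_nhds hAc, he0', he] with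
      t hst ht h0 h1
    -- With all roots distinct, the tensor Vandermonde matrix diagonalizes `A`. The multiplicity of
    -- the eigenvalue 0 thus counts the tuples at which `H` vanishes.
    let r : Fin (d + 1) ≃ complexRoots fun l => a l t :=
      (Finset.equivFinOfCardEq (card_complexRoots hst)).symm
    have hrinj : Function.Injective fun j => (r j : ℂ) / ρ := fun i j hij => by
      have hρ' : (ρ : ℂ) ≠ 0 := by exact_mod_cast hρ.ne'
      exact r.injective (Subtype.ext ((div_left_inj' hρ').1 hij))
    have hW : tensorVandermonde (ν := ν) (fun j => (r j : ℂ) / ρ) *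
        (A (c t)).map (algebraMap ℝ ℂ) =
        Matrix.diagonal (fun J => H (c t) fun i => r (J i)) *
          tensorVandermonde (ν := ν) (fun j => (r j : ℂ) / ρ) := by
      ext J K
      rw [Matrix.diagonal_mul, Matrix.mul_apply]
      exact (ht (fun i => r (J i)) fun i => mem_complexRoots.1 (r (J i)).2).2 K
    have hprod := charpoly_eq_prod_of_mul_eq (det_tensorVandermonde_ne_zero hrinj) hW
    rw [Matrix.charpoly_map] at hprod
    rw [← card_filter_eq_zero_of_coeff (h := fun J : ν → Fin (d + 1) => H (c t) fun i => r (J i))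
      (e := e)]
    · symm
      refine Finset.card_bij (fun J _ i => (r (J i) : ℂ)) (fun J hJ => ?_)
        (fun J _ J' _ h => funext fun i => r.injective (Subtype.ext (congrFun h i)))
        fun z hz => ?_
      · rw [Finset.mem_filter, Fintype.mem_piFinset]
        exact ⟨fun i => (r (J i)).2, (Finset.mem_filter.1 hJ).2⟩
      · rw [Finset.mem_filter, Fintype.mem_piFinset] at hz
        have h2 : (fun i => ((r (r.symm ⟨z i, hz.1 i⟩) : complexRoots fun l => a l t) : ℂ)) = z :=
          funext fun i => by rw [Equiv.apply_symm_apply]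
        refine ⟨fun i => r.symm ⟨z i, hz.1 i⟩, ?_, h2⟩
        rw [Finset.mem_filter]
        refine ⟨Finset.mem_univ _, ?_⟩
        rw [h2]
        exact hz.2
    · intro i hi
      rw [← hprod, coeff_map, h0 i hi, map_zero]
    · rw [← hprod, coeff_map]
      exact (_root_.map_ne_zero _).2 h1

/-- The solutions over a parameter of an analytic equation in roots of a Weierstrass polynomial. -/
def solutionSet (a : Fin (d + 1) → ℝ → ℝ) (G : (Unit ⊕ ν → ℝ) → ℝ) (t : ℝ) : Set (ν → ℝ) :=
  {w | (∀ i, aeval (w i) (monicPoly fun l => a l t) = 0) ∧ G (withParam t w) = 0}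

/-- The parity of the number of solutions is the same on both sides of the origin. -/
theorem exists_ncard_solutionSet_modEq (ha : ∀ l, AnalyticAt ℝ (a l) 0) (ha0 : ∀ l, a l 0 = 0)
    (hsep : ∀ᶠ t in 𝓝[≠] 0, (monicPoly fun l => a l t).Separable) (hG : AnalyticAt ℝ G 0) :
    ∃ e, ∀ᶠ t in 𝓝[≠] 0, (solutionSet a G t).ncard ≡ e [MOD 2] := by
  obtain ⟨χ, H, e, N, -, -, -, -, hreal, hconj, hcard⟩ := exists_value_polynomial ha ha0 hsep hG
  refine ⟨e, ?_⟩
  filter_upwards [eventually_nhdsWithin_of_eventually_nhds hreal,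
    eventually_nhdsWithin_of_eventually_nhds hconj, hcard] with t h1 h2 h3
  rw [← h3]
  set S := (Fintype.piFinset fun _ : ν => complexRoots fun l => a l t).filter
    fun z => H t z = 0 with hS
  have hmem : ∀ z, z ∈ S ↔ (∀ i, z i ∈ complexRoots fun l => a l t) ∧ H t z = 0 := fun z => by
    rw [hS, Finset.mem_filter, Fintype.mem_piFinset]
  have hfix := card_filter_fixed_modEq S (fun z i => starRingEnd ℂ (z i)) (fun z hz => ?_)
    fun z _ => by simp
  · refine Nat.ModEq.trans ?_ hfix
    -- Real solutions are the complex solutions fixed by conjugation; the others come in conjugate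
    -- pairs.
    have h4 : (fun (w : ν → ℝ) i => (w i : ℂ)) '' solutionSet a G t =
        (S.filter fun z => (fun i => starRingEnd ℂ (z i)) = z) := by
      ext z
      rw [Finset.coe_filter]
      constructor
      · rintro ⟨w, ⟨hw, hw0⟩, rfl⟩
        refine ⟨(hmem _).2 ⟨fun i => ofReal_mem_complexRoots.2 (mem_realRoots.2 (hw i)), ?_⟩,
          funext fun i => Complex.conj_ofReal _⟩
        rw [(h1 w hw).1, hw0, Complex.ofReal_zero]
      · rintro ⟨hz, hzc⟩
        have hzr : (fun i => ((z i).re : ℂ)) = z := funext fun i =>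
          Complex.conj_eq_iff_re.1 (congrFun hzc i)
        rw [hmem] at hz
        have hw : ∀ i, aeval (z i).re (monicPoly fun l => a l t) = 0 := fun i => by
          rw [← mem_realRoots, ← ofReal_mem_complexRoots]
          exact (congrFun hzr i).symm ▸ hz.1 i
        refine ⟨fun i => (z i).re, ⟨hw, ?_⟩, hzr⟩
        have h5 := (h1 _ hw).1
        rw [hzr, hz.2] at h5
        exact_mod_cast h5.symm
    rw [← Set.ncard_coe_finset, ← h4, Set.ncard_image_of_injective]
    intro w w' h
    exact funext fun i => Complex.ofReal_injective (congrFun h i)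
  · rw [hmem] at hz ⊢
    exact ⟨fun i => conj_mem_complexRoots (hz.1 i), by
      rw [h2 z fun i => mem_complexRoots.1 (hz.1 i), hz.2, map_zero]⟩

/-- A continuous family of tuples of roots that starts with a solution consists of solutions. -/
theorem eventually_solution_persists (ha : ∀ l, AnalyticAt ℝ (a l) 0) (ha0 : ∀ l, a l 0 = 0)
    (hsep : ∀ᶠ t in 𝓝[≠] 0, (monicPoly fun l => a l t).Separable) (hG : AnalyticAt ℝ G 0) :
    ∀ᶠ t₀ in 𝓝[≠] 0, ∀ γ : ℝ → ν → ℝ, ContinuousAt γ t₀ →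
      (∀ᶠ t in 𝓝 t₀, ∀ i, aeval (γ t i) (monicPoly fun l => a l t) = 0) →
      G (withParam t₀ (γ t₀)) = 0 → ∀ᶠ t in 𝓝 t₀, G (withParam t (γ t)) = 0 := by
  obtain ⟨χ, H, e, N, hN, han, he0, he, hreal, -, -⟩ := exists_value_polynomial ha ha0 hsep hG
  have he0' : ∀ᶠ t in 𝓝[≠] 0, ∀ i < e, (χ t).coeff i = 0 := by
    have := (Finset.eventually_all (Finset.range e)).2 fun i hi => he0 i (Finset.mem_range.1 hi)
    exact this.mono fun t ht i hi => ht i (Finset.mem_range.2 hi)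
  have hcont : ∀ᶠ t in 𝓝 0, ∀ i ∈ Finset.range (N + 1),
      ContinuousAt (fun t => (χ t).coeff i) t :=
    (Finset.eventually_all _).2 fun i _ =>
      (han i).eventually_analyticAt.mono fun _ h => h.continuousAt
  have hGc := eventually_withParam (p := fun z => ContinuousAt G z) ha ha0
    (hG.eventually_analyticAt.mono fun _ h => h.continuousAt)
  have hall := (eventually_nhdsWithin_of_eventually_nhds (s := {(0 : ℝ)}ᶜ)
    (hreal.and (hcont.and hGc))).and (he0'.and he)
  filter_upwards [eventually_eventually_nhdsWithin.2 hall, self_mem_nhdsWithin] with t₀ h ht₀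
  rw [(isOpen_compl_singleton.nhdsWithin_eq ht₀)] at h
  intro γ hγ hroot h0
  obtain ⟨⟨-, hc₀, hG₀⟩, -, he₀⟩ := h.self_of_nhds
  have hg : ContinuousAt (fun t => G (withParam t (γ t))) t₀ := by
    refine ContinuousAt.comp (g := G) (hG₀ _ hroot.self_of_nhds) ?_
    refine continuousAt_pi.2 ?_
    rintro (i | i)
    · exact continuousAt_id
    · exact continuousAt_pi.1 hγ i
  have heN : e ≤ N := by
    rw [← hN t₀]; exact le_natDegree_of_ne_zero he₀
  -- Near `t₀` the equation of the values `G` reads `G ^ e * B = 0`, and `B` at `t₀` is the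
  -- coefficient of index `e`, which is nonzero.
  let B : ℝ → ℝ := fun t =>
    ∑ i ∈ Finset.range (N + 1 - e), (χ t).coeff (e + i) * G (withParam t (γ t)) ^ i
  have hB : ContinuousAt B t₀ := by
    refine tendsto_finsetSum _ fun i hi => ?_
    refine ContinuousAt.mul (hc₀ _ ?_) (hg.pow i)
    rw [Finset.mem_range] at hi ⊢
    omega
  have hB0 : B t₀ ≠ 0 := by
    have : B t₀ = (χ t₀).coeff e := by
      change ∑ i ∈ Finset.range (N + 1 - e), (χ t₀).coeff (e + i) * G (withParam t₀ (γ t₀)) ^ i = _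
      rw [h0, show N + 1 - e = (N - e) + 1 by omega, Finset.sum_range_succ']
      simp
    rw [this]; exact he₀
  filter_upwards [h, hroot, hB.eventually_ne hB0] with t ht hrt hBt
  have h1 := (ht.1.1 _ hrt).2
  rw [eval_eq_sum_range, hN, show N + 1 = e + (N + 1 - e) by omega, Finset.sum_range_add,
    Finset.sum_eq_zero fun i hi => by rw [ht.2.1 i (Finset.mem_range.1 hi), zero_mul], zero_add] at h1
  have h2 : G (withParam t (γ t)) ^ e * B t = 0 := by
    rw [← h1, Finset.mul_sum]
    exact Finset.sum_congr rfl fun i _ => by ring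
  exact eq_zero_of_pow_eq_zero ((mul_eq_zero.1 h2).resolve_right hBt)

end Counting

/-! ### Sheets over one side of the origin -/

section Sheets

open Polynomial

variable {ν : Type*} [Fintype ν] {d : ℕ} {a : Fin (d + 1) → ℝ → ℝ}
  {G : (Unit ⊕ ν → ℝ) → ℝ}

/-- Each tuple of continuous root functions solves the equation everywhere on the interval or
nowhere: being a solution is open by `eventually_solution_persists` and closed by continuity. The
sheets are the tuples that solve it. -/
theorem exists_sheets (ha : ∀ l, AnalyticAt ℝ (a l) 0) (ha0 : ∀ l, a l 0 = 0)
    (hsep : ∀ᶠ t in 𝓝[≠] 0, (monicPoly fun l => a l t).Separable) (hG : AnalyticAt ℝ G 0) :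
    ∃ ε > 0, ∃ (n : ℕ) (γ : Fin n → ℝ → ν → ℝ), (∀ j, ∀ t ∈ Ioo 0 ε, ContinuousAt (γ j) t) ∧
      ∀ t ∈ Ioo 0 ε, (Function.Injective fun j => γ j t) ∧
        ∀ w, w ∈ solutionSet a G t ↔ ∃ j, γ j t = w := by
  classical
  have hpos : 𝓝[>] (0 : ℝ) ≤ 𝓝[≠] 0 := nhdsWithin_mono _ fun t ht => ne_of_gt ht
  have hac : ∀ᶠ t in 𝓝 (0 : ℝ), ∀ l, ContinuousAt (a l) t :=
    eventually_all.2 fun l => (ha l).eventually_analyticAt.mono fun _ h => h.continuousAt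
  have hGc := eventually_withParam (p := fun z => ContinuousAt G z) ha ha0
    (hG.eventually_analyticAt.mono fun _ h => h.continuousAt)
  have hall := ((hsep.and (eventually_solution_persists ha ha0 hsep hG)).filter_mono hpos).and
    (eventually_nhdsWithin_of_eventually_nhds (hac.and hGc))
  obtain ⟨ε, hε, hεall⟩ := mem_nhdsGT_iff_exists_Ioo_subset.1 hall
  have hε0 : (0 : ℝ) < ε := hε
  obtain ⟨k, u, huc, hu⟩ := exists_continuousOn_realRoots
    (fun i t ht => (hεall ht).2.1 i) fun t ht => (hεall ht).1.1
  have hroot : ∀ (J : ν → Fin k), ∀ t ∈ Ioo 0 ε, ∀ i,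
      aeval (u (J i) t) (monicPoly fun l => a l t) = 0 := fun J t ht i =>
    ((hu t ht).2 _).2 ⟨J i, rfl⟩
  have hcont : ∀ (J : ν → Fin k), ∀ t ∈ Ioo 0 ε, ContinuousAt (fun t i => u (J i) t) t :=
    fun J t ht => continuousAt_pi.2 fun i => huc (J i) t ht
  have hGcont : ∀ (J : ν → Fin k), ∀ t ∈ Ioo 0 ε,
      ContinuousAt (fun t => G (withParam t fun i => u (J i) t)) t := by
    intro J t ht
    refine ContinuousAt.comp (g := G) ((hεall ht).2.2 _ (hroot J t ht)) ?_
    refine continuousAt_pi.2 ?_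
    rintro (i | i)
    · exact continuousAt_id
    · exact huc (J i) t ht
  have hconst : ∀ (J : ν → Fin k), ∀ t ∈ Ioo 0 ε, ∀ t' ∈ Ioo 0 ε,
      G (withParam t fun i => u (J i) t) = 0 → G (withParam t' fun i => u (J i) t') = 0 := by
    intro J t ht t' ht' h0
    classical
    have := isPreconnected_Ioo.constant
      (f := fun t => decide (G (withParam t fun i => u (J i) t) = 0)) (fun t₀ ht₀ => ?_) ht ht'
    · simpa [h0] using this
    · refine ContinuousAt.continuousWithinAt ?_
      refine (continuousAt_const
        (y := decide (G (withParam t₀ fun i => u (J i) t₀) = 0))).congr ?_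
      by_cases h : G (withParam t₀ fun i => u (J i) t₀) = 0
      · have hI : ∀ᶠ t in 𝓝 t₀, t ∈ Ioo 0 ε := isOpen_Ioo.mem_nhds ht₀
        filter_upwards [(hεall ht₀).1.2 _ (hcont J t₀ ht₀) (hI.mono (hroot J)) h] with s hs
        rw [h, hs]
      · filter_upwards [(hGcont J t₀ ht₀).eventually_ne h] with s hs
        simp [h, hs]
  classical
  let 𝒥 := {J : ν → Fin k // ∀ t ∈ Ioo 0 ε, G (withParam t fun i => u (J i) t) = 0}
  let e : 𝒥 ≃ Fin (Fintype.card 𝒥) := Fintype.equivFin 𝒥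
  refine ⟨ε, hε0, Fintype.card 𝒥, fun j t i => u ((e.symm j).1 i) t,
    fun j t ht => hcont _ t ht, fun t ht => ⟨fun j j' h => ?_, fun w => ⟨fun hw => ?_, ?_⟩⟩⟩
  · exact e.symm.injective (Subtype.ext (funext fun i => (hu t ht).1 (congrFun h i)))
  · choose J hJ using fun i => ((hu t ht).2 _).1 (hw.1 i)
    have hJw : (fun i => u (J i) t) = w := funext hJ
    refine ⟨e ⟨J, fun t' ht' => hconst J t ht t' ht' ?_⟩, ?_⟩
    · rw [hJw]; exact hw.2
    · have := congrArg (fun (J : 𝒥) i => u (J.1 i) t) (e.symm_apply_apply ⟨J, fun t' ht' =>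
        hconst J t ht t' ht' (by rw [hJw]; exact hw.2)⟩)
      exact this.trans hJw
  · rintro ⟨j, rfl⟩
    exact ⟨hroot _ t ht, (e.symm j).2 t ht⟩

end Sheets

/-! ### From sheets to a star -/

section Star

/-- A union of graphs of finitely many sheets, approaching the origin from both sides, is a star. -/
theorem isEvenStarPoint_of_sheets {V : Type*} [TopologicalSpace V] [T2Space V] [Zero V] {W : Set V}
    (h0 : (0 : V) ∈ W) {π : V → ℝ} (hπ : Continuous π) (hπ0 : π 0 = 0) {Sol : ℝ → Set V}
    (h1 : ∀ᶠ w in 𝓝 0, w ∈ W → w ∈ Sol (π w))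
    (h2 : ∀ᶠ t in 𝓝 0, ∀ w ∈ Sol t, w ∈ W ∧ π w = t)
    (h3 : ∀ U ∈ 𝓝 (0 : V), ∀ᶠ t in 𝓝 0, Sol t ⊆ U) (h4 : Sol 0 ⊆ {0}) {N : ℕ} (hN : Even N)
    {ε₀ : ℝ} (hε₀ : 0 < ε₀) {σ : Fin N → ℝ} (hσ : ∀ j, σ j = 1 ∨ σ j = -1)
    {γ : Fin N → ℝ → V} (hγ : ∀ j, ∀ t ∈ Ioo 0 ε₀, ContinuousAt (γ j) t)
    (hinj : ∀ t ∈ Ioo 0 ε₀, ∀ j j', σ j = σ j' → γ j t = γ j' t → j = j')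
    (hmem : ∀ t ∈ Ioo 0 ε₀, ∀ j, γ j t ∈ Sol (σ j * t))
    (hsurj : ∀ t ∈ Ioo 0 ε₀, ∀ s : ℝ, s = 1 ∨ s = -1 → ∀ w ∈ Sol (s * t),
      ∃ j, σ j = s ∧ γ j t = w) : IsEvenStarPoint (⟨0, h0⟩ : W) := by
  obtain ⟨B, hB1, hBo, hB0⟩ := eventually_nhds_iff.1 h1
  obtain ⟨ε₁, hε₁, hball⟩ := Metric.eventually_nhds_iff_ball.1 (h2.and (h3 B (hBo.mem_nhds hB0)))
  set ε := min ε₀ ε₁ with hε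
  have hε0 : 0 < ε := lt_min hε₀ hε₁
  have hsub : ∀ {t}, t ∈ Ioo 0 ε → t ∈ Ioo 0 ε₀ := fun ht => ⟨ht.1, ht.2.trans_le (min_le_left _ _)⟩
  have hσabs : ∀ j, |σ j| = 1 := fun j => by rcases hσ j with h | h <;> simp [h]
  have hσsq : ∀ j, σ j * σ j = 1 := fun j => by rcases hσ j with h | h <;> simp [h]
  have hσball : ∀ {t}, t ∈ Ioo 0 ε → ∀ j, σ j * t ∈ Metric.ball (0 : ℝ) ε₁ := fun {t} ht j => by
    rw [mem_ball_zero_iff, Real.norm_eq_abs, abs_mul, hσabs, one_mul, abs_of_pos ht.1]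
    exact ht.2.trans_le (min_le_right _ _)
  have hγW : ∀ {t}, t ∈ Ioo 0 ε → ∀ j, γ j t ∈ W ∧ π (γ j t) = σ j * t ∧ γ j t ∈ B :=
    fun {t} ht j => by
      have hm := hmem t (hsub ht) j
      have hb := hball _ (hσball ht j)
      exact ⟨(hb.1 _ hm).1, (hb.1 _ hm).2, hb.2 hm⟩
  -- the parametrization of the arms
  let h : ℝ → ℝ := fun s => ε * Real.sigmoid s
  have hmono : StrictMono h := fun s s' hs => mul_lt_mul_of_pos_left (Real.sigmoid_strictMono hs) hε0
  have hhc : Continuous h := continuous_const.mul continuous_sigmoid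
  have hrange : range h = Ioo 0 ε := by
    ext t
    constructor
    · rintro ⟨s, rfl⟩
      exact ⟨mul_pos hε0 (Real.sigmoid_pos s), mul_lt_of_lt_one_right hε0 (Real.sigmoid_lt_one s)⟩
    · intro ht
      have : t / ε ∈ range Real.sigmoid := by
        rw [Real.range_sigmoid]
        exact ⟨div_pos ht.1 hε0, (div_lt_one hε0).2 ht.2⟩
      obtain ⟨s, hs⟩ := this
      exact ⟨s, by change ε * Real.sigmoid s = t; rw [hs, mul_div_cancel₀ _ hε0.ne']⟩
  have hI : ∀ s, h s ∈ Ioo 0 ε := fun s => hrange ▸ mem_range_self s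
  have hbot : Tendsto h atBot (𝓝 0) := by
    have := Real.tendsto_sigmoid_atBot.const_mul ε
    rwa [mul_zero] at this
  have hemb : IsEmbedding h :=
    hmono.isEmbedding_of_ordConnected (hrange ▸ ordConnected_Ioo)
  let α : Fin N → ℝ → W := fun j s => ⟨γ j (h s), (hγW (hI s) j).1⟩
  have hαπ : ∀ j s, π (α j s) = σ j * h s := fun j s => (hγW (hI s) j).2.1
  have hαabs : ∀ j s, |π (α j s)| = h s := fun j s => by
    rw [hαπ, abs_mul, hσabs, one_mul, abs_of_pos (hI s).1]
  have hαc : ∀ j, Continuous (α j) := fun j => continuous_iff_continuousAt.2 fun s =>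
    Topology.IsInducing.subtypeVal.continuousAt_iff.2
      (ContinuousAt.comp (g := γ j) (hγ j _ (hsub (hI s))) hhc.continuousAt)
  have hπW : Continuous fun w : W => π w := hπ.comp continuous_subtype_val
  -- The function `|π|` recovers the parameter `h`, so it supplies a continuous inverse on the arm.
  have hαemb : ∀ j, IsEmbedding (α j) := fun j =>
    IsEmbedding.of_comp (g := fun w : W => |π w|) (hαc j) hπW.abs
      (by rw [show (fun w : W => |π w|) ∘ α j = h from funext (hαabs j)]; exact hemb)
  have hBW : ∀ᶠ w : W in 𝓝 ⟨0, h0⟩, (w : V) ∈ B :=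
    continuous_subtype_val.continuousAt.eventually (hBo.mem_nhds hB0)
  -- points of `W` lie on arms
  have hcover : ∀ w : W, (w : V) ∈ B → ∀ s : ℝ, s = 1 ∨ s = -1 → s * π w ∈ Ioo 0 ε →
      ∃ j, σ j = s ∧ γ j (s * π w) = w := by
    intro w hw s hs hsw
    refine hsurj _ (hsub hsw) s hs w ?_
    have hss : s * (s * π w) = π w := by rcases hs with rfl | rfl <;> ring
    rw [hss]
    exact hB1 _ hw w.2
  refine ⟨N, α, hN, fun j => ⟨⟨hαemb j, ?_⟩, ?_⟩, fun j s hs => ?_, fun j j' hjj' => ?_, fun s => ?_⟩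
  · rw [isOpen_iff_mem_nhds]
    rintro _ ⟨s₀, rfl⟩
    have hBs : ∀ᶠ w : W in 𝓝 (α j s₀), (w : V) ∈ B :=
      continuous_subtype_val.continuousAt.eventually (hBo.mem_nhds (hγW (hI s₀) j).2.2)
    have hval : σ j * π (α j s₀) = h s₀ := by rw [hαπ, ← mul_assoc, hσsq, one_mul]
    have hπs : ∀ᶠ w : W in 𝓝 (α j s₀), σ j * π w ∈ Ioo 0 ε := by
      refine (continuous_const.mul hπW).continuousAt.eventually (isOpen_Ioo.mem_nhds ?_)
      change σ j * π (α j s₀) ∈ _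
      rw [hval]; exact hI s₀
    -- Near a point of arm `j`, every point of `W` lies on an arm with the same sign. The other
    -- sheets with this sign stay away by continuity, so it lies on arm `j`, which is therefore
    -- open.
    have hne : ∀ᶠ w : W in 𝓝 (α j s₀), ∀ j', σ j' = σ j → j' ≠ j → γ j' (σ j * π w) ≠ w := by
      refine eventually_all.2 fun j' => ?_
      by_cases hj' : σ j' = σ j ∧ j' ≠ j
      · have hc : ContinuousAt (fun w : W => γ j' (σ j * π w)) (α j s₀) :=
          ContinuousAt.comp (g := γ j') (f := fun w : W => σ j * π w)
            (by rw [hval]; exact hγ j' _ (hsub (hI s₀))) (continuous_const.mul hπW).continuousAt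
        have hd : γ j' (σ j * π (α j s₀)) ≠ (α j s₀ : V) := by
          rw [hval]
          exact fun heq => hj'.2 (hinj _ (hsub (hI s₀)) _ _ hj'.1 heq)
        filter_upwards [hc.ne_iff_eventually_ne (g := fun w : W => (w : V))
          continuous_subtype_val.continuousAt |>.1 hd] with w hw _ _ using hw
      · exact Eventually.of_forall fun w ha hb => absurd ⟨ha, hb⟩ hj'
    filter_upwards [hBs, hπs, hne] with w hwB hwI hwne
    obtain ⟨j', hj', hw⟩ := hcover w hwB _ (hσ j) hwI
    have : j' = j := by
      by_contra h
      exact hwne j' hj' h hw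
    subst this
    rw [← hrange] at hwI
    obtain ⟨s, hs⟩ := hwI
    exact ⟨s, Subtype.ext (by change γ j' (h s) = w; rw [hs, hw])⟩
  · rw [nhds_subtype_eq_comap, tendsto_comap_iff, tendsto_iff_forall_eventually_mem]
    intro U hU
    have hσh : Tendsto (fun s => σ j * h s) atBot (𝓝 0) := by
      have := hbot.const_mul (σ j)
      rwa [mul_zero] at this
    filter_upwards [hσh.eventually (h3 U hU)] with s hs
    exact hs (hmem _ (hsub (hI s)) j)
  · have h5 := hαabs j s
    rw [hs] at h5
    change |π 0| = h s at h5
    rw [hπ0, abs_zero] at h5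
    exact (hI s).1.ne h5
  · rw [Set.disjoint_left]
    rintro _ ⟨s, rfl⟩ ⟨s', hs'⟩
    have e1 : h s' = h s := by rw [← hαabs j' s', hs', hαabs]
    have e2 : σ j' * h s' = σ j * h s := by rw [← hαπ j' s', hs', hαπ]
    rw [e1] at e2
    have e3 := mul_right_cancel₀ (hI s).1.ne' e2
    have e4 : γ j' (h s') = γ j (h s) := congrArg Subtype.val hs'
    rw [e1] at e4
    exact hjj' (hinj _ (hsub (hI s)) _ _ e3.symm e4.symm)
  · have hπs : ∀ᶠ w : W in 𝓝 ⟨0, h0⟩, |π w| < h s := by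
      refine hπW.abs.continuousAt.eventually_lt_const ?_
      change |π 0| < h s
      rw [hπ0, abs_zero]; exact (hI s).1
    filter_upwards [hBW, hπs] with w hwB hws
    rcases eq_or_ne (π w) 0 with hw0 | hw0
    · left
      have := hB1 _ hwB w.2
      rw [hw0] at this
      exact Subtype.ext (h4 this)
    · right
      obtain ⟨c, hc, hcw⟩ : ∃ c : ℝ, (c = 1 ∨ c = -1) ∧ c * π w = |π w| := by
        rcases abs_choice (π w) with h | h
        · exact ⟨1, Or.inl rfl, by rw [h, one_mul]⟩
        · exact ⟨-1, Or.inr rfl, by rw [h, neg_one_mul]⟩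
      have hcI : c * π w ∈ Ioo 0 ε := by
        rw [hcw]; exact ⟨abs_pos.2 hw0, hws.trans (hI s).2⟩
      obtain ⟨j, hj, hwj⟩ := hcover w hwB c hc hcI
      have hcI' := hcI
      rw [← hrange] at hcI'
      obtain ⟨s', hs'⟩ := hcI'
      refine mem_iUnion.2 ⟨j, s', ?_, Subtype.ext (by change γ j (h s') = w; rw [hs', hwj])⟩
      rw [mem_Iio, ← hmono.lt_iff_lt, hs', hcw]
      exact hws

end Star

/-! ### Analytic sets of dimension at most one -/

section Coordinates

open Polynomial

variable {ν : Type*} [Fintype ν] {d : ℕ} {a : Fin (d + 1) → ℝ → ℝ}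

theorem tendsto_neg_nhdsNE_zero : Tendsto (fun t : ℝ => -t) (𝓝[≠] 0) (𝓝[≠] 0) := by
  refine tendsto_nhdsWithin_iff.2 ⟨?_, ?_⟩
  · exact (continuous_neg.tendsto' 0 0 neg_zero).mono_left nhdsWithin_le_nhds
  · exact eventually_mem_nhdsWithin.mono fun t ht => neg_ne_zero.2 ht

theorem analyticAt_apply_zero {ι : Type*} [Fintype ι] (i : ι) :
    AnalyticAt ℝ (fun z : ι → ℝ => z i) 0 :=
  (ContinuousLinearMap.proj (R := ℝ) (φ := fun _ : ι => ℝ) i).analyticAt 0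

/-- A set cut out by one nonnegative analytic function, whose coordinates satisfy a Weierstrass
polynomial over a linear coordinate, is an even star near the origin. -/
theorem isEvenStarPoint_of_monicPoly {W : Set (ν → ℝ)} (h0 : 0 ∈ W) (π : (ν → ℝ) →L[ℝ] ℝ)
    (ha : ∀ l, AnalyticAt ℝ (a l) 0) (ha0 : ∀ l, a l 0 = 0)
    (hsep : ∀ᶠ t in 𝓝[≠] 0, (monicPoly fun l => a l t).Separable)
    (hroot : ∀ᶠ w in 𝓝[W] 0, ∀ i, aeval (w i) (monicPoly fun l => a l (π w)) = 0)
    {g : (ν → ℝ) → ℝ} (hg : AnalyticAt ℝ g 0) (hg0 : ∀ w, 0 ≤ g w)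
    (hW : ∀ᶠ w in 𝓝 0, w ∈ W ↔ g w = 0) : IsEvenStarPoint (⟨0, h0⟩ : W) := by
  classical
  let inr : (Unit ⊕ ν → ℝ) →L[ℝ] (ν → ℝ) :=
    ContinuousLinearMap.pi fun i => ContinuousLinearMap.proj (Sum.inr i)
  -- As `g` is nonnegative, the single equation `G = 0` encodes both `π w = t` and `g w = 0`.
  let G : (Unit ⊕ ν → ℝ) → ℝ := fun z => (π (inr z) - z (Sum.inl ())) ^ 2 + g (inr z)
  have hG : AnalyticAt ℝ G 0 :=
    ((((π.comp inr).analyticAt 0).sub (analyticAt_apply_zero _)).pow 2).add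
      (AnalyticAt.fun_comp (g := g) (by rwa [map_zero]) (inr.analyticAt 0))
  have hGw : ∀ t w, G (withParam t w) = (π w - t) ^ 2 + g w := fun _ _ => rfl
  -- Sheets exist over positive parameters; those over negative ones come from replacing `t` by
  -- `-t`.
  let neg : (Unit ⊕ ν → ℝ) →L[ℝ] (Unit ⊕ ν → ℝ) := ContinuousLinearMap.pi
    (Sum.elim (fun i => -ContinuousLinearMap.proj (Sum.inl i)) fun i =>
      ContinuousLinearMap.proj (Sum.inr i))
  have hneg : ∀ t w, neg (withParam t w) = withParam (-t) w := fun t w => by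
    ext (i | i) <;> rfl
  have ha' : ∀ l, AnalyticAt ℝ (fun t => a l (-t)) 0 := fun l =>
    AnalyticAt.fun_comp (g := a l) (by rw [neg_zero]; exact ha l) analyticAt_id.neg
  have hG' : AnalyticAt ℝ (fun z => G (neg z)) 0 :=
    AnalyticAt.fun_comp (g := G) (by rwa [map_zero]) (neg.analyticAt 0)
  obtain ⟨ε, hε, n, γ, hγ, hγs⟩ := exists_sheets ha ha0 hsep hG
  obtain ⟨ε', hε', n', γ', hγ', hγs'⟩ := exists_sheets (G := fun z => G (neg z)) ha'
    (fun l => by rw [neg_zero, ha0]) (tendsto_neg_nhdsNE_zero.eventually hsep) hG'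
  have hsol : ∀ t, solutionSet (fun l t => a l (-t)) (fun z => G (neg z)) t =
      solutionSet a G (-t) := fun t => by
    ext w
    change _ ∧ G (neg (withParam t w)) = 0 ↔ _
    rw [hneg]
    rfl
  simp only [hsol] at hγs'
  have hcard : ∀ {m : ℕ} {δ : Fin m → ν → ℝ} {T : Set (ν → ℝ)}, Function.Injective δ →
      (∀ w, w ∈ T ↔ ∃ j, δ j = w) → T.ncard = m := by
    intro m δ T hδ hT
    have : T = range δ := by ext w; exact hT w
    rw [this, ← image_univ, Set.ncard_image_of_injective _ hδ, Set.ncard_univ, Nat.card_fin]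
  -- The numbers of sheets on the two sides are both congruent to the same `e` modulo 2.
  have heven : Even (n + n') := by
    obtain ⟨e, he⟩ := exists_ncard_solutionSet_modEq ha ha0 hsep hG
    have hpos : 𝓝[>] (0 : ℝ) ≤ 𝓝[≠] 0 := nhdsWithin_mono _ fun t ht => ne_of_gt ht
    have hI : ∀ᶠ t in 𝓝[>] (0 : ℝ), t ∈ Ioo 0 ε := Ioo_mem_nhdsGT hε
    have hI' : ∀ᶠ t in 𝓝[>] (0 : ℝ), t ∈ Ioo 0 ε' := Ioo_mem_nhdsGT hε'
    obtain ⟨t, ⟨h1, h2⟩, ht, ht'⟩ := (((he.and (tendsto_neg_nhdsNE_zero.eventually he)).filter_mono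
      hpos).and (hI.and hI')).exists
    rw [hcard (hγs t ht).1 (hγs t ht).2] at h1
    rw [hcard (hγs' t ht').1 (hγs' t ht').2] at h2
    have h3 : n % 2 = n' % 2 := h1.trans h2.symm
    rw [Nat.even_add, Nat.even_iff, Nat.even_iff, h3]
  let f : Fin (n + n') → Fin n ⊕ Fin n' := finSumFinEquiv.symm
  have hf : Function.Bijective f := finSumFinEquiv.symm.bijective
  let σ : Fin n ⊕ Fin n' → ℝ := Sum.elim (fun _ => 1) fun _ => -1
  let Γ : Fin n ⊕ Fin n' → ℝ → ν → ℝ := Sum.elim γ γ'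
  have hlt : ∀ {t}, t ∈ Ioo 0 (min ε ε') → t ∈ Ioo 0 ε ∧ t ∈ Ioo 0 ε' := fun ht =>
    ⟨⟨ht.1, ht.2.trans_le (min_le_left _ _)⟩, ht.1, ht.2.trans_le (min_le_right _ _)⟩
  refine isEvenStarPoint_of_sheets h0 π.continuous (map_zero π) (Sol := solutionSet a G)
    ?_ ?_ ?_ ?_ heven (lt_min hε hε') (σ := σ ∘ f) (γ := Γ ∘ f) ?_ ?_ ?_ ?_ ?_
  · filter_upwards [eventually_nhdsWithin_iff.1 hroot, hW] with w h1 h2 hw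
    exact ⟨h1 hw, by rw [hGw, h2.1 hw, sub_self]; norm_num⟩
  · filter_upwards [eventually_withParam (p := fun z => inr z ∈ W ↔ g (inr z) = 0) ha ha0
      ((inr.continuous.tendsto' 0 0 (map_zero _)).eventually hW)] with t ht w hw
    have h1 := ht w hw.1
    have h2 := hw.2
    rw [hGw] at h2
    have h3 := hg0 w
    have h4 := sq_nonneg (π w - t)
    refine ⟨h1.2 (by change g w = 0; linarith), ?_⟩
    exact sub_eq_zero.1 (pow_eq_zero_iff two_ne_zero |>.1 (by linarith))
  · intro U hU
    filter_upwards [eventually_withParam (p := fun z => inr z ∈ U) ha ha0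
      ((inr.continuous.tendsto' 0 0 (map_zero _)).eventually hU)] with t ht w hw
    exact ht w hw.1
  · intro w hw
    refine funext fun i => ?_
    have h1 := hw.1 i
    simp only [ha0, monicPoly_zero, map_pow, aeval_X] at h1
    exact (pow_eq_zero_iff (Nat.succ_ne_zero d)).1 h1
  · intro j
    rcases hj : f j with i | i <;> simp [σ, hj]
  · intro j t ht
    rcases hj : f j with i | i
    · simpa [Γ, hj] using hγ i t (hlt ht).1
    · simpa [Γ, hj] using hγ' i t (hlt ht).2
  · intro t ht j j' hs hjj
    refine hf.1 ?_
    simp only [Function.comp_apply] at hs hjj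
    rcases hj : f j with i | i <;> rcases hj' : f j' with i' | i' <;> rw [hj, hj'] at hs hjj
    · exact congrArg _ ((hγs t (hlt ht).1).1 hjj)
    · norm_num [σ] at hs
    · norm_num [σ] at hs
    · exact congrArg _ ((hγs' t (hlt ht).2).1 hjj)
  · intro t ht j
    rcases hj : f j with i | i
    · simpa [Γ, σ, hj] using ((hγs t (hlt ht).1).2 _).2 ⟨i, rfl⟩
    · simpa [Γ, σ, hj] using ((hγs' t (hlt ht).2).2 _).2 ⟨i, rfl⟩
  · rintro t ht s (rfl | rfl) w hw
    · rw [one_mul] at hw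
      obtain ⟨i, hi⟩ := ((hγs t (hlt ht).1).2 _).1 hw
      obtain ⟨j, hj⟩ := hf.2 (Sum.inl i)
      exact ⟨j, by simp [σ, hj], by simpa [Γ, hj] using hi⟩
    · rw [neg_one_mul] at hw
      obtain ⟨i, hi⟩ := ((hγs' t (hlt ht).2).2 _).1 hw
      obtain ⟨j, hj⟩ := hf.2 (Sum.inr i)
      exact ⟨j, by simp [σ, hj], by simpa [Γ, hj] using hi⟩

/-- A real analytic set whose ring of germs has dimension at most one is an even star. -/
theorem isEvenStarPoint_of_ringKrullDim_le_one {n m : ℕ} {Z U : Set (EuclideanSpace ℝ (Fin n))}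
    {g : EuclideanSpace ℝ (Fin n) → EuclideanSpace ℝ (Fin m)} {z : EuclideanSpace ℝ (Fin n)}
    (hz : z ∈ Z) (hU : U ∈ 𝓝 z) (hZ : ∀ x ∈ U, x ∈ Z ↔ g x = 0) (hg : AnalyticAt ℝ g z)
    (hdim : ringKrullDim (analyticGerms (𝓝[Z] z) z) ≤ 1) : IsEvenStarPoint (⟨z, hz⟩ : Z) := by
  let e := EuclideanSpace.equiv (Fin n) ℝ
  -- Padding by a zero coordinate provides at least one coordinate, also when `n = 0`.
  let i₀ : (Fin n → ℝ) →L[ℝ] (Fin (n + 1) → ℝ) :=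
    ContinuousLinearMap.pi (Fin.cons 0 fun i => ContinuousLinearMap.proj i)
  let p₀ : (Fin (n + 1) → ℝ) →L[ℝ] (Fin n → ℝ) :=
    ContinuousLinearMap.pi fun i => ContinuousLinearMap.proj i.succ
  obtain ⟨π, hπ⟩ := exists_integral_coordHom nhdsWithin_le_nhds hdim (i₀.comp (e : _ →L[ℝ] _))
    ((e.symm : _ →L[ℝ] _).comp p₀) fun x => e.injective (funext fun i => by simp [i₀, p₀])
  obtain ⟨d, a, ha, ha0, hsep, hroot⟩ := exists_separable_weierstrass nhdsWithin_le_nhds hπ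
    fun i : Fin n => (ContinuousLinearMap.proj i).comp (e : _ →L[ℝ] (Fin n → ℝ))
  let τ : EuclideanSpace ℝ (Fin n) ≃ₜ (Fin n → ℝ) :=
    (Homeomorph.addRight (-z)).trans e.toHomeomorph
  have hτ : ∀ x, τ x = e (x - z) := fun x => by simp [τ, sub_eq_add_neg]
  have hτz : τ z = 0 := by rw [hτ, sub_self, map_zero]
  have hτs : ∀ w, τ.symm w = e.symm w + z := fun w => by
    rw [Homeomorph.symm_apply_eq, hτ, add_sub_cancel_right, e.apply_symm_apply]
  have hτs0 : τ.symm 0 = z := by rw [← hτz, τ.symm_apply_apply]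
  have hmaps : Tendsto τ.symm (𝓝 0) (𝓝 z) := τ.symm.continuous.tendsto' 0 z hτs0
  let W : Set (Fin n → ℝ) := τ.symm ⁻¹' Z
  have h0 : (0 : Fin n → ℝ) ∈ W := by change τ.symm 0 ∈ Z; rwa [hτs0]
  have hcoord : ∀ j, AnalyticAt ℝ (fun w => g (τ.symm w) j) 0 := by
    intro j
    have hτa : AnalyticAt ℝ τ.symm 0 := by
      have := ((e.symm : (Fin n → ℝ) →L[ℝ] EuclideanSpace ℝ (Fin n)).analyticAt 0).add
        (analyticAt_const (v := z))
      exact this.congr (Eventually.of_forall fun w => (hτs w).symm)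
    exact ((EuclideanSpace.proj j : EuclideanSpace ℝ (Fin m) →L[ℝ] ℝ).analyticAt _).fun_comp
      (AnalyticAt.fun_comp (g := g) (by rwa [hτs0]) hτa)
  have hstar : IsEvenStarPoint (⟨0, h0⟩ : W) := by
    -- The sum of the squares of the components of `g` is one nonnegative function with the same
    -- zeros.
    refine isEvenStarPoint_of_monicPoly h0 (π.comp (e.symm : _ →L[ℝ] _)) ha ha0 hsep ?_
      (g := fun w => ∑ j, g (τ.symm w) j ^ 2)
      (Finset.analyticAt_fun_sum _ fun j _ => (hcoord j).fun_pow 2)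
      (fun w => Finset.sum_nonneg fun j _ => sq_nonneg _) ?_
    · have : Tendsto τ.symm (𝓝[W] 0) (𝓝[Z] z) :=
        tendsto_nhdsWithin_iff.2 ⟨hmaps.mono_left nhdsWithin_le_nhds, eventually_mem_nhdsWithin⟩
      filter_upwards [this.eventually hroot] with w hw i
      simpa [hτs] using hw i
    · filter_upwards [hmaps.eventually hU] with w hw
      refine (hZ _ hw).trans ?_
      rw [Finset.sum_eq_zero_iff_of_nonneg fun j _ => sq_nonneg _]
      refine ⟨fun h j _ => by rw [h]; simp, fun h => ?_⟩
      ext j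
      simpa using h j (Finset.mem_univ j)
  let h : W ≃ₜ Z := τ.symm.sets rfl
  have := hstar.map h.isOpenEmbedding
  convert this using 1
  exact Subtype.ext hτs0.symm

end Coordinates

/-! ### Smooth points -/

section Smooth

/-- The zero set of a submersion is locally parametrized by the kernel of the derivative. -/
theorem exists_isOpenEmbedding_ker {E F : Type*} [NormedAddCommGroup E] [NormedSpace ℝ E]
    [CompleteSpace E] [NormedAddCommGroup F] [NormedSpace ℝ F] [FiniteDimensional ℝ F] {g : E → F}
    {g' : E →L[ℝ] F} {z : E} (hg : HasStrictFDerivAt g g' z) (hg' : Function.Surjective g')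
    {U : Set E} (hU : IsOpen U) (hz : z ∈ U ∧ g z = 0) :
    ∃ ψ : g'.ker → {x | x ∈ U ∧ g x = 0}, IsOpenEmbedding ψ ∧ ψ 0 = ⟨z, hz⟩ := by
  have hr : g'.range = ⊤ := LinearMap.range_eq_top.2 hg'
  set Φ := hg.implicitToOpenPartialHomeomorph g g' hr with hΦ
  have hzs : z ∈ Φ.source := hg.mem_implicitToOpenPartialHomeomorph_source hr
  have hΦz : Φ z = (0, 0) := by rw [hΦ, hg.implicitToOpenPartialHomeomorph_self hr, hz.2]
  have hfst : ∀ x, (Φ x).1 = g x := fun x => rfl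
  have hnhds : ∀ᶠ v : g'.ker in 𝓝 0, ((0 : F), v) ∈ Φ.target ∧ Φ.symm (0, v) ∈ U := by
    have ht : ((0 : F), (0 : g'.ker)) ∈ Φ.target := hΦz ▸ Φ.map_source hzs
    have hc : Tendsto (fun v : g'.ker => ((0 : F), v)) (𝓝 0) (𝓝 (0, 0)) :=
      (Continuous.prodMk_right (0 : F)).tendsto 0
    have hs : Tendsto Φ.symm (𝓝 (0, 0)) (𝓝 z) := hΦz ▸ Φ.tendsto_symm hzs
    exact (hc.eventually (Φ.open_target.mem_nhds ht)).and
      ((hs.comp hc).eventually (hU.mem_nhds hz.1))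
  obtain ⟨r, hr0, hball⟩ := Metric.eventually_nhds_iff_ball.1 hnhds
  -- The implicit function theorem parametrizes only near 0; `β` compresses the whole kernel into a
  -- small ball where it applies.
  set β := OpenPartialHomeomorph.univBall (0 : g'.ker) r with hβ
  have hβs : β.source = univ := OpenPartialHomeomorph.univBall_source _ _
  have hβe : IsOpenEmbedding β := β.isOpenEmbedding hβs
  have hβm : ∀ v, β v ∈ Metric.ball (0 : g'.ker) r := fun v =>
    OpenPartialHomeomorph.univBall_target (0 : g'.ker) hr0 ▸ β.map_source (hβs ▸ mem_univ v)
  have hΦβ : ∀ v, Φ (Φ.symm (0, β v)) = (0, β v) := fun v => Φ.right_inv (hball _ (hβm v)).1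
  let ψ : g'.ker → {x | x ∈ U ∧ g x = 0} := fun v =>
    ⟨Φ.symm (0, β v), (hball _ (hβm v)).2, by rw [← hfst, hΦβ]⟩
  refine ⟨ψ, IsOpenEmbedding.of_continuous_injective_isOpenMap ?_ ?_ ?_, Subtype.ext ?_⟩
  · refine continuous_iff_continuousAt.2 fun v =>
      Topology.IsInducing.subtypeVal.continuousAt_iff.2 ?_
    exact ContinuousAt.comp (g := Φ.symm) (Φ.symm.continuousAt (hball _ (hβm v)).1)
      (continuous_const.prodMk hβe.continuous).continuousAt
  · intro v v' h
    have h1 : Φ.symm (0, β v) = Φ.symm (0, β v') := congrArg Subtype.val h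
    have h2 := congrArg Φ h1
    rw [hΦβ, hΦβ] at h2
    exact hβe.injective (congrArg Prod.snd h2)
  · refine isOpenMap_iff_nhds_le.2 fun v N hN => ?_
    have h1 : ∀ᶠ x : {x | x ∈ U ∧ g x = 0} in 𝓝 (ψ v), (x : E) ∈ Φ.source :=
      continuous_subtype_val.continuousAt.eventually
        (Φ.open_source.mem_nhds (Φ.map_target (hball _ (hβm v)).1))
    have h2 : Tendsto (fun x : {x | x ∈ U ∧ g x = 0} => (Φ x).2) (𝓝 (ψ v)) (𝓝 (β v)) := by
      have h3 : ContinuousAt (fun x : {x | x ∈ U ∧ g x = 0} => (Φ x).2) (ψ v) :=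
        continuousAt_snd.comp (ContinuousAt.comp (g := Φ)
          (Φ.continuousAt (Φ.map_target (hball _ (hβm v)).1)) continuous_subtype_val.continuousAt)
      have h4 : (Φ (ψ v)).2 = β v := congrArg Prod.snd (hΦβ v)
      rw [← h4]
      exact h3
    filter_upwards [h1, h2.eventually (hβe.isOpenMap.image_mem_nhds hN)] with x hx hx'
    obtain ⟨v', hv', hxv⟩ := hx'
    have h5 : Φ x = (0, β v') := Prod.ext ((hfst x).trans x.2.2) hxv.symm
    have : ψ v' = x := Subtype.ext (by
      change Φ.symm (0, β v') = x
      rw [← h5, Φ.left_inv hx])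
    exact this ▸ hv'
  · change Φ.symm (0, β 0) = z
    rw [hβ, OpenPartialHomeomorph.univBall_apply_zero, ← hΦz, Φ.left_inv hzs]

variable {K : Type*} [NormedAddCommGroup K] [NormedSpace ℝ K]

/-- No point of a space of dimension at least two has a neighborhood that is a line. -/
theorem not_isLinePoint_of_one_lt_rank (hK : 1 < Module.rank ℝ K) (y : K) : ¬ IsLinePoint y := by
  intro h
  obtain ⟨φ, hφ, rfl, -⟩ := h.exists_subset univ_mem
  obtain ⟨r, hr, hball⟩ := Metric.nhds_basis_ball.mem_iff.1
    (hφ.isOpen_range.mem_nhds (mem_range_self 0))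
  set β := OpenPartialHomeomorph.univBall (φ 0) r with hβ
  have hβs : β.source = univ := OpenPartialHomeomorph.univBall_source _ _
  have hβe : IsOpenEmbedding β := β.isOpenEmbedding hβs
  have hβm : ∀ v, β v ∈ range φ := fun v =>
    hball (OpenPartialHomeomorph.univBall_target (φ 0) hr ▸ β.map_source (hβs ▸ mem_univ v))
  choose θ hθ using hβm
  have hθe : IsOpenEmbedding θ := IsOpenEmbedding.of_comp _ hφ
    (by rw [show φ ∘ θ = β from funext hθ]; exact hβe)
  have hθ0 : θ 0 = 0 := hφ.injective (by rw [hθ, hβ, OpenPartialHomeomorph.univBall_apply_zero])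
  -- Removing a point disconnects a line but not a space of dimension at least two.
  have hpre : OrdConnected (θ '' {0}ᶜ) :=
    ((isConnected_compl_singleton_of_one_lt_rank hK (0 : K)).isPreconnected.image _
      hθe.continuous.continuousOn).ordConnected
  obtain ⟨ε, hε, hI⟩ := Metric.nhds_basis_closedBall.mem_iff.1
    (hθe.isOpen_range.mem_nhds ⟨0, hθ0⟩)
  rw [Real.closedBall_eq_Icc] at hI
  have hmem : ∀ t ∈ Icc (0 - ε) (0 + ε), t ≠ 0 → t ∈ θ '' {0}ᶜ := by
    intro t ht ht0
    obtain ⟨v, rfl⟩ := hI ht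
    exact ⟨v, fun hv => ht0 (by rw [mem_singleton_iff.1 hv, hθ0]), rfl⟩
  obtain ⟨v, hv, hv0⟩ := hpre.out
    (hmem (0 - ε) ⟨le_rfl, by linarith⟩ (by linarith : (0 - ε : ℝ) < 0).ne)
    (hmem (0 + ε) ⟨by linarith, le_rfl⟩ (by linarith : (0 : ℝ) < 0 + ε).ne')
    (⟨by linarith, by linarith⟩ : (0 : ℝ) ∈ Icc (0 - ε) (0 + ε))
  exact hv (hθe.injective (hv0.trans hθ0.symm))

/-- An even star that is locally a vector space is a line or an isolated point. -/
theorem IsEvenStarPoint.isLinePoint_or_isOpen_singleton [FiniteDimensional ℝ K] {Y : Type*}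
    [TopologicalSpace Y] {ψ : K → Y} (hψ : IsOpenEmbedding ψ) (h : IsEvenStarPoint (ψ 0)) :
    IsLinePoint (ψ 0) ∨ IsOpen {ψ 0} := by
  rcases lt_trichotomy (Module.finrank ℝ K) 1 with hK | hK | hK
  · right
    have : Subsingleton K := Module.finrank_zero_iff.1 (Nat.lt_one_iff.1 hK)
    rw [← image_singleton]
    exact hψ.isOpenMap _ (isOpen_discrete _)
  · left
    have e : ℝ ≃L[ℝ] K := ContinuousLinearEquiv.ofFinrankEq (by rw [hK, Module.finrank_self])
    exact IsLinePoint.map hψ ⟨e, e.toHomeomorph.isOpenEmbedding, 0, map_zero e⟩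
  · exfalso
    have hK' : 1 < Module.rank ℝ K := by
      rw [← Module.finrank_eq_rank]
      exact_mod_cast hK
    have : Nontrivial K := Module.nontrivial_of_finrank_pos (R := ℝ) (by lia)
    -- A star has line points arbitrarily close to its center, but a space of dimension at least two
    -- has none.
    obtain ⟨y, hy⟩ := (h.of_map hψ).eventually_isLinePoint.exists
    exact not_isLinePoint_of_one_lt_rank hK' y hy

end Smooth

/-! ### Stalks of local models -/

namespace LocalModelData

variable (M : LocalModelData)

theorem incl_injective : Function.Injective (incl.{u} M) := fun _ _ h =>
  ULift.down_injective (Subtype.ext h)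

theorem isInducing_incl : IsInducing (incl.{u} M) :=
  IsInducing.subtypeVal.comp Homeomorph.ulift.isInducing

variable {M}

theorem eventually_mem_range_incl {p : M.space} {W : Opens M.space} (hp : p ∈ W) :
    ∀ᶠ x in 𝓝[M.zeroSet] M.incl p, ∃ y : W, M.incl y = x := by
  have h1 : (W : Set M.space) ∈ Filter.comap M.incl (𝓝 (M.incl p)) := by
    rw [← (isInducing_incl M).nhds_eq_comap]
    exact W.isOpen.mem_nhds hp
  obtain ⟨T, hT, hTW⟩ := mem_comap.1 h1
  filter_upwards [mem_nhdsWithin_of_mem_nhds hT, eventually_mem_nhdsWithin] with x hx hxZ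
  exact ⟨⟨⟨⟨x, hxZ⟩⟩, hTW hx⟩, rfl⟩

/-- A section of the structure sheaf, extended by zero. -/
noncomputable def extend {W : Opens M.space} (s : W → ℝ) : EuclideanSpace ℝ (Fin M.n) → ℝ :=
  Function.extend (fun y : W => M.incl y) s 0

theorem extend_incl {W : Opens M.space} (s : W → ℝ) (y : W) : extend s (M.incl y) = s y :=
  ((incl_injective M).comp Subtype.val_injective).extend_apply s 0 y

theorem extend_eventuallyEq {p : M.space} {W : Opens M.space} (hp : p ∈ W) {s : W → ℝ}
    {f : EuclideanSpace ℝ (Fin M.n) → ℝ}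
    (h : ∀ᶠ x in 𝓝 (M.incl p), ∀ y : W, M.incl y = x → s y = f x) :
    extend s =ᶠ[𝓝[M.zeroSet] M.incl p] f := by
  filter_upwards [eventually_mem_range_incl hp, mem_nhdsWithin_of_mem_nhds h] with x hx hx'
  obtain ⟨y, rfl⟩ := hx
  rw [extend_incl, hx' y rfl]

/-- The germ at a point of a section of the structure sheaf. -/
noncomputable def sectionGerm {p : M.space} {W : Opens M.space} (hp : p ∈ W) :
    M.sections W →+* analyticGerms (𝓝[M.zeroSet] M.incl p) (M.incl p) where
  toFun s := ⟨(extend s.1 : (𝓝[M.zeroSet] M.incl p).Germ ℝ), by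
    obtain ⟨Ω, F, hΩ, hpΩ, hF, hs⟩ := s.2 ⟨p, hp⟩
    refine ⟨F, hF _ hpΩ, Germ.coe_eq.2 (extend_eventuallyEq hp ?_).symm⟩
    filter_upwards [hΩ.mem_nhds hpΩ] with x hx y hy
    rw [hs y (hy ▸ hx), hy]⟩
  map_one' := Subtype.ext (Germ.coe_eq.2 (extend_eventuallyEq hp
    (Eventually.of_forall fun _ _ _ => rfl)))
  map_zero' := Subtype.ext (Germ.coe_eq.2 (extend_eventuallyEq hp
    (Eventually.of_forall fun _ _ _ => rfl)))
  map_mul' s t := Subtype.ext (Germ.coe_eq.2 (extend_eventuallyEq hp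
    (Eventually.of_forall fun x y hy => by subst hy; simp [extend_incl])))
  map_add' s t := Subtype.ext (Germ.coe_eq.2 (extend_eventuallyEq hp
    (Eventually.of_forall fun x y hy => by subst hy; simp [extend_incl])))

theorem sectionGerm_resHom {p : M.space} {V W : Opens M.space} (h : V ≤ W) (hp : p ∈ V)
    (s : M.sections W) : sectionGerm hp (resHom h s) = sectionGerm (h hp) s :=
  Subtype.ext (Germ.coe_eq.2 (extend_eventuallyEq hp (Eventually.of_forall fun x y hy => by
    subst hy; exact (extend_incl s.1 ⟨y.1, h y.2⟩).symm)))

theorem exists_sectionGerm_eq (p : M.space)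
    (γ : analyticGerms (𝓝[M.zeroSet] M.incl p) (M.incl p)) :
    ∃ (W : Opens M.space) (hp : p ∈ W) (s : M.sections W), sectionGerm hp s = γ := by
  obtain ⟨f, hf, rfl⟩ := analyticGerms.exists_mk γ
  obtain ⟨Ω, hΩf, hΩ, hpΩ⟩ := eventually_nhds_iff.1 hf.eventually_analyticAt
  refine ⟨⟨M.incl ⁻¹' Ω, hΩ.preimage (isInducing_incl M).continuous⟩, hpΩ,
    ⟨fun y => f (M.incl y), fun y => ⟨Ω, f, hΩ, y.2, hΩf, fun _ _ => rfl⟩⟩, ?_⟩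
  exact Subtype.ext (Germ.coe_eq.2 (extend_eventuallyEq (W := ⟨_, _⟩) hpΩ
    (Eventually.of_forall fun x y hy => congrArg f hy)))

/-- The structure presheaf as a presheaf of rings. -/
noncomputable abbrev ringPresheaf (M : LocalModelData) : TopCat.Presheaf CommRingCat.{u} M.space :=
  M.presheaf ⋙ forget₂ (CommAlgCat.{u} ℝ) CommRingCat.{u}

/-- Germs of sections as a cocone over the sections near a point. -/
noncomputable def germCocone (p : M.space) :
    Limits.Cocone ((OpenNhds.inclusion p).op ⋙ ringPresheaf.{u} M) where
  pt := CommRingCat.of (ULift.{u} (analyticGerms (𝓝[M.zeroSet] M.incl p) (M.incl p)))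
  ι :=
    { app W := CommRingCat.ofHom (ULift.ringEquiv.symm.toRingHom.comp (sectionGerm W.unop.2))
      naturality V W i := by
        ext s
        exact congrArg ULift.up (sectionGerm_resHom i.unop.le W.unop.2 s) }

/-- The map from the stalk to germs along the zero set is surjective, since an analytic germ
restricts to a section near `p`; dimension cannot increase under a surjection. -/
theorem ringKrullDim_analyticGerms_le (p : M.space) :
    ringKrullDim (analyticGerms (𝓝[M.zeroSet] M.incl p) (M.incl p)) ≤
      ringKrullDim ((ringPresheaf.{u} M).stalk p) := by
  let φ : (ringPresheaf.{u} M).stalk p ⟶ (germCocone p).pt := Limits.colimit.desc _ (germCocone p)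
  refine ringKrullDim_le_of_surjective (ULift.ringEquiv.toRingHom.comp φ.hom) fun γ => ?_
  obtain ⟨W, hp, s, rfl⟩ := exists_sectionGerm_eq p γ
  refine ⟨(ringPresheaf M).germ W p hp s, ?_⟩
  have h := Limits.colimit.ι_desc (germCocone p) (op ⟨W, hp⟩)
  have h' := congrArg (fun f => (f.hom s).down) h
  exact h'

end LocalModelData

/-! ### Transfer along charts and conclusion -/

namespace RealRingedSpace

variable {X : RealRingedSpace.{u}} {x : X}

/-- The chart induces an isomorphism of stalks after forgetting the `ℝ`-algebra structure, and
restriction to an open set does not change the stalk. -/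
theorem ChartAt.ringKrullDim_stalk (c : ChartAt X x) :
    ringKrullDim ((LocalModelData.ringPresheaf.{u} c.model).stalk (c.iso.hom.hom.base ⟨x, c.mem⟩)) =
      dimAt X x := by
  let F := forget₂ (CommAlgCat.{u} ℝ) CommRingCat.{u}
  let f : X.toPresheafedSpace.restrict c.V.isOpenEmbedding ⟶ c.model.toRingedSpace.toPresheafedSpace := c.iso.hom.hom
  have : IsIso f := inferInstanceAs (IsIso ((SheafedSpace.forgetToPresheafedSpace).map c.iso.hom))
  let f' := F.mapPresheaf.map f
  have := PresheafedSpace.stalkMap.isIso f' ⟨x, c.mem⟩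
  let e1 := asIso (f'.stalkMap ⟨x, c.mem⟩)
  let e2 := (F.mapPresheaf.obj X.toPresheafedSpace).restrictStalkIso c.V.isOpenEmbedding ⟨x, c.mem⟩
  exact ringKrullDim_eq_of_ringEquiv ((e1.trans e2).commRingCatIsoToRingEquiv)

end RealRingedSpace

namespace LocalModelData

variable {M : LocalModelData}

theorem isEvenStarPoint_of_ringKrullDim_stalk_le_one (p : M.space)
    (h : ringKrullDim ((ringPresheaf.{u} M).stalk p) ≤ 1) : IsEvenStarPoint p := by
  have := isEvenStarPoint_of_ringKrullDim_le_one (Z := M.zeroSet) p.down.2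
    (M.isOpen_U.mem_nhds p.down.2.1) (fun x hx => ⟨fun h => h.2, fun h => ⟨hx, h⟩⟩)
    (M.analytic_g _ p.down.2.1) ((ringKrullDim_analyticGerms_le p).trans h)
  exact this.map Homeomorph.ulift.{u}.symm.isOpenEmbedding

theorem SmoothAt.isLinePoint_or_isOpen_singleton {p : toRingedSpace.{u} M} (hp : M.SmoothAt p)
    (h : IsEvenStarPoint (Y := M.space) p) :
    IsLinePoint (Y := M.space) p ∨ IsOpen (X := M.space) {p} := by
  obtain ⟨ψ, hψ, hψ0⟩ := exists_isOpenEmbedding_ker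
    (M.analytic_g _ (p : M.space).down.2.1).hasStrictFDerivAt hp M.isOpen_U
    (p : M.space).down.2
  have hψ' := Homeomorph.ulift.{u}.symm.isOpenEmbedding.comp hψ
  have hp0 : (Homeomorph.ulift.{u}.symm ∘ ψ) 0 = (p : M.space) := congrArg ULift.up hψ0
  rw [← hp0] at h ⊢
  exact h.isLinePoint_or_isOpen_singleton hψ'

end LocalModelData

namespace RealRingedSpace

variable {X : RealRingedSpace.{u}} {x : X}

/-- The local model of a chart is homeomorphic to an open subset of the space. -/
theorem ChartAt.exists_isOpenEmbedding (c : ChartAt X x) :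
    ∃ j : c.model.space → X, IsOpenEmbedding j ∧ j (c.iso.hom.hom.base ⟨x, c.mem⟩) = x := by
  let h := TopCat.homeoOfIso ((SheafedSpace.forget _).mapIso c.iso)
  refine ⟨fun p => (h.symm p).1, c.V.isOpenEmbedding.comp h.symm.isOpenEmbedding, ?_⟩
  exact congrArg Subtype.val (h.symm_apply_apply ⟨x, c.mem⟩)

theorem isEvenStarPoint (hX : IsRealAnalyticSpace X) (hdim : dimAt X x ≤ 1) :
    IsEvenStarPoint x := by
  obtain ⟨c⟩ := hX x
  obtain ⟨j, hj, hjx⟩ := c.exists_isOpenEmbedding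
  rw [← hjx]
  exact (LocalModelData.isEvenStarPoint_of_ringKrullDim_stalk_le_one _
    (c.ringKrullDim_stalk.trans_le hdim)).map hj

theorem IsSmoothPoint.isLinePoint_or_isOpen_singleton (hx : IsSmoothPoint X x)
    (h : IsEvenStarPoint x) : IsLinePoint x ∨ IsOpen {x} := by
  obtain ⟨c, hc⟩ := hx
  obtain ⟨j, hj, hjx⟩ := c.exists_isOpenEmbedding
  rw [← hjx] at h ⊢
  refine (hc.isLinePoint_or_isOpen_singleton (h.of_map hj)).imp (fun h => h.map hj) fun h => ?_
  exact image_singleton (f := j) ▸ hj.isOpenMap _ h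

end RealRingedSpace

theorem mainTheorem4 (X : RealRingedSpace.{u}) [T2Space X]
    (hX : RealRingedSpace.IsRealAnalyticSpace X)
    (hdim : ∀ x : X, RealRingedSpace.dimAt X x = 1)
    (hsing : IsCompact (RealRingedSpace.singularSet X)) (x : X) :
    Finite (SpaceEnd (connectedComponent x)) ∧
      Even (Nat.card (SpaceEnd (connectedComponent x))) := by
  have hstar : ∀ y : X, IsEvenStarPoint y := fun y =>
    RealRingedSpace.isEvenStarPoint hX (hdim y).le
  exact finite_even_ends hstar hsing (fun y hy =>
    (not_not.1 hy : RealRingedSpace.IsSmoothPoint X y).isLinePoint_or_isOpen_singleton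
      (hstar y)) x
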